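/- Theorem. There is a deterministic algorithm for the following problem. Given an integer $m\ge 2$ and a nonempty set $S\subseteq \mathbb{Z}_m=\mathbb{Z}/m\mathbb{Z}$ of size $n$ (the input consists of $m$, $n$ and the elements of $S$, listed in arbitrary order as integers in $\{0,\dots,m-1\}$), compute the set of all subset sums modulo $m$, $$\Sigma(S)=\Bigl\{\sum_{s\in T}s \bmod m \;:\; T\subseteq S\Bigr\}$$ (with the empty sum $0$ included), output as its characteristic vector indexed by $0,\dots,m-1$. The algorithm runs in $$O\bigl(\min\{\sqrt{n}\,m,\;m^{5/4}\}\,\log^2 m\bigr)$$ time. Here time is the number of unit-cost instructions (addition, subtraction, multiplication, integer division, remainder, comparison, indirect load and store, conditional branching) on a word RAM: there are a single program $P$, a positive integer $c$ and a constant $C$, all independent of $m$ and $S$, such that for every word size $w$ with $2^w\ge m^c$ the program $P$ with words of $w$ bits computes $\Sigma(S)$ in at most $C\min\{\sqrt{n}\,m,\;m^{5/4}\}\log^2 m$ steps. -/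

import Mathlib

/-!
# Subset sums in `ZMod m` and a word RAM with unit-cost instructions

The machine is the usual deterministic word RAM.  It has registers `0, 1, 2, …` (a program mentions
only finitely many of them) and a random-access memory, both holding `w`-bit words, that is, natural
numbers below `2 ^ w`.  Arithmetic is modulo `2 ^ w`, memory is addressed indirectly through
registers, and every executed instruction and every evaluated test takes one unit of time.  Programs
are finite objects that do not depend on the input or on the word size.
-/

namespace WordRAM

/-- The arithmetic and comparison instructions. -/
inductive BinOp where
  | add | sub | mul | div | mod | lt | eq

/-- The result of an instruction on words of `w` bits.  Addition, subtraction and multiplication wrap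
around modulo `2 ^ w`, `div` and `mod` are integer quotient and remainder, and the comparisons return
`1` for true and `0` for false. -/
def BinOp.eval (w : ℕ) : BinOp → ℕ → ℕ → ℕ
  | .add, a, b => (a + b) % 2 ^ w
  | .sub, a, b => (a + (2 ^ w - b % 2 ^ w)) % 2 ^ w
  | .mul, a, b => (a * b) % 2 ^ w
  | .div, a, b => (a / b) % 2 ^ w
  | .mod, a, b => (a % b) % 2 ^ w
  | .lt, a, b => (if a < b then 1 else 0) % 2 ^ w
  | .eq, a, b => (if a = b then 1 else 0) % 2 ^ w

/-- Programs.  All arguments of type `ℕ` are register names, except the literal `k` in `const`. -/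
inductive Prog where
  /-- do nothing -/
  | skip
  /-- `reg[dst] := k` -/
  | const (dst k : ℕ)
  /-- `reg[dst] := reg[a] ∘ reg[b]` -/
  | op (o : BinOp) (dst a b : ℕ)
  /-- `reg[dst] := mem[reg[a]]` -/
  | load (dst a : ℕ)
  /-- `mem[reg[a]] := reg[src]` -/
  | store (a src : ℕ)
  /-- sequential composition -/
  | seq (p q : Prog)
  /-- `if reg[r] ≠ 0 then p else q` -/
  | ite (r : ℕ) (p q : Prog)
  /-- `while reg[r] ≠ 0 do p` -/
  | loop (r : ℕ) (p : Prog)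

/-- The contents of the registers and of the memory. -/
structure State where
  reg : ℕ → ℕ
  mem : ℕ → ℕ

/-- The state after `reg[r] := v`. -/
def State.setReg (s : State) (r v : ℕ) : State :=
  { s with reg := Function.update s.reg r v }

/-- The state after `mem[a] := v`. -/
def State.setMem (s : State) (a v : ℕ) : State :=
  { s with mem := Function.update s.mem a v }

/-- `Exec w p s t s'`: with words of `w` bits, the program `p` started in the state `s` halts in the
state `s'` after exactly `t` units of time. -/
inductive Exec (w : ℕ) : Prog → State → ℕ → State → Prop where
  | skip (s : State) : Exec w .skip s 1 s
  | const (dst k : ℕ) (s : State) : Exec w (.const dst k) s 1 (s.setReg dst (k % 2 ^ w))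
  | op (o : BinOp) (dst a b : ℕ) (s : State) :
      Exec w (.op o dst a b) s 1 (s.setReg dst (o.eval w (s.reg a) (s.reg b)))
  | load (dst a : ℕ) (s : State) : Exec w (.load dst a) s 1 (s.setReg dst (s.mem (s.reg a)))
  | store (a src : ℕ) (s : State) : Exec w (.store a src) s 1 (s.setMem (s.reg a) (s.reg src))
  | seq {p q : Prog} {s s₁ s₂ : State} {t₁ t₂ : ℕ} :
      Exec w p s t₁ s₁ → Exec w q s₁ t₂ s₂ → Exec w (.seq p q) s (t₁ + t₂) s₂
  | ite_true {r : ℕ} {p q : Prog} {s s' : State} {t : ℕ} :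
      s.reg r ≠ 0 → Exec w p s t s' → Exec w (.ite r p q) s (1 + t) s'
  | ite_false {r : ℕ} {p q : Prog} {s s' : State} {t : ℕ} :
      s.reg r = 0 → Exec w q s t s' → Exec w (.ite r p q) s (1 + t) s'
  | loop_done {r : ℕ} {p : Prog} {s : State} :
      s.reg r = 0 → Exec w (.loop r p) s 1 s
  | loop_step {r : ℕ} {p : Prog} {s s₁ s₂ : State} {t₁ t₂ : ℕ} :
      s.reg r ≠ 0 → Exec w p s t₁ s₁ → Exec w (.loop r p) s₁ t₂ s₂ →
        Exec w (.loop r p) s (1 + t₁ + t₂) s₂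

/-- The machine is deterministic: final state and running time are determined by the start. -/
theorem Exec.det {w : ℕ} {p : Prog} {s s₁ s₂ : State} {t₁ t₂ : ℕ}
    (h₁ : Exec w p s t₁ s₁) (h₂ : Exec w p s t₂ s₂) : t₁ = t₂ ∧ s₁ = s₂ := by
  induction h₁ generalizing t₂ s₂ with
  | skip | const | op | load | store => cases h₂; exact ⟨rfl, rfl⟩
  | seq _ _ ih₁ ih₂ =>
    cases h₂ with
    | seq a b => obtain ⟨rfl, rfl⟩ := ih₁ a; obtain ⟨rfl, rfl⟩ := ih₂ b; exact ⟨rfl, rfl⟩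
  | ite_true hr _ ih | ite_false hr _ ih =>
    cases h₂ with
    | ite_true hr' a => first | exact absurd hr hr' | (obtain ⟨rfl, rfl⟩ := ih a; exact ⟨rfl, rfl⟩)
    | ite_false hr' a => first | exact absurd hr' hr | (obtain ⟨rfl, rfl⟩ := ih a; exact ⟨rfl, rfl⟩)
  | loop_done hr =>
    cases h₂ with
    | loop_done => exact ⟨rfl, rfl⟩
    | loop_step hr' => exact absurd hr hr'
  | loop_step hr _ _ ih₁ ih₂ =>
    cases h₂ with
    | loop_done hr' => exact absurd hr' hr
    | loop_step _ a b => obtain ⟨rfl, rfl⟩ := ih₁ a; obtain ⟨rfl, rfl⟩ := ih₂ b; exact ⟨rfl, rfl⟩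

end WordRAM

/-- The set of all subset sums of a finite set `S ⊆ ℤ/mℤ`, the empty sum included. -/
def subsetSums {m : ℕ} (S : Finset (ZMod m)) : Set (ZMod m) :=
  {x | ∃ T ⊆ S, ∑ y ∈ T, y = x}

/-- The input for the modulus `m` and a list `l` of residues: register `0` holds `m`, register `1`
holds the length of `l`, the memory cells `0, …, l.length - 1` hold the entries of `l` as integers in
`{0, …, m - 1}`, and everything else is `0`. -/
def inputState (m : ℕ) (l : List (ZMod m)) : WordRAM.State where
  reg r := if r = 0 then m else if r = 1 then l.length else 0
  mem i := (l.getD i 0).val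

/-- The memory cells `0, …, m - 1` hold the characteristic vector of `A ⊆ ℤ/mℤ`: the cell `x` holds
`1` if the class of `x` lies in `A`, and `0` otherwise. -/
def HoldsSet {m : ℕ} (s : WordRAM.State) (A : Set (ZMod m)) : Prop :=
  ∀ x : ℕ, x < m → ((x : ZMod m) ∈ A → s.mem x = 1) ∧ ((x : ZMod m) ∉ A → s.mem x = 0)

/-! A new summand `s` replaces the set `A` of sums found so far by `A ∪ (A + s)`. All these unions
together add at most `m - 1` residues. It therefore suffices to pay `O(log m)` for each new residue,
and `O(m log m)` in all for auxiliary data. The resulting time `O(m log m)` is below both terms of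
the asserted minimum.

The new residues are found by comparing the periodic 0/1 word of `A` with its translate by `s`.
Since `A \ (A + s)` and `(A + s) \ A` have equally many elements, the number of places where the
words differ is proportional to the growth of `A` (`mc_diff_le`). A search down the tree of dyadic
blocks that enters only blocks which differ visits `O(log m)` blocks per such place
(`Search.length_le`).

Blocks are compared in constant time through names, as in the method of Karp, Miller and Rosenberg.
A block of length `2 ^ (k + 1)` is named after the pair of names of its halves, by an injective
table of pairs, so that equal names mean equal blocks (`nm_eq_iff`). Words are long enough to
address this table directly and memory starts at zero, so neither hashing nor clearing is needed.

The search compares a block at a multiple `x` of its length with the block at `x + s`. Only blocks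
that start at numbers congruent to `0` or to `s` modulo their length matter. At each level at most
two of these contain a given position, so inserting a letter costs `O(log m)` (`insertAtProg_run`).

When `s` changes, level `k` must be rebuilt, at cost `O(2 ^ (L - k))`, only if `s` changes modulo `2
^ k`. In the order of reversed binary digits this happens once in `2 ^ (L - k)` steps
(`rv_sub_one`). Each level thus costs `O(2 ^ L)` over the whole run, and all levels `O(L * 2 ^ L)`
(`sum_levelCost`). -/

namespace WordRAM

/-! ### Compiling arithmetic expressions to register code -/

/-- Expressions over registers and memory. -/
inductive RExp where
  | reg (r : ℕ)
  | lit (k : ℕ)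
  | bin (o : BinOp) (a b : RExp)
  | load (a : RExp)

namespace RExp

instance : Add RExp := ⟨bin .add⟩
instance : Sub RExp := ⟨bin .sub⟩
instance : Mul RExp := ⟨bin .mul⟩
instance : Div RExp := ⟨bin .div⟩
instance : Mod RExp := ⟨bin .mod⟩
instance (n : ℕ) : OfNat RExp n := ⟨lit n⟩

/-- The comparison `a < b`. -/
def lt (a b : RExp) : RExp := bin .lt a b
/-- The comparison `a = b`. -/
def eq (a b : RExp) : RExp := bin .eq a b

end RExp

/-- The value of an operation when nothing overflows. -/
def BinOp.ideal : BinOp → ℕ → ℕ → ℕ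
  | .add, a, b => a + b
  | .sub, a, b => a - b
  | .mul, a, b => a * b
  | .div, a, b => a / b
  | .mod, a, b => a % b
  | .lt, a, b => if a < b then 1 else 0
  | .eq, a, b => if a = b then 1 else 0

/-- A condition under which an operation does not overflow. -/
def BinOp.Safe (V : ℕ) : BinOp → ℕ → ℕ → Prop
  | .add, a, b => a + b < V
  | .sub, a, b => b ≤ a ∧ a < V
  | .mul, a, b => a * b < V
  | .div, a, b => a / b < V
  | .mod, a, b => a % b < V
  | .lt, _, _ => 1 < V
  | .eq, _, _ => 1 < V

theorem BinOp.eval_eq_ideal {w : ℕ} {o : BinOp} {a b : ℕ} (h : o.Safe (2 ^ w) a b) :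
    o.eval w a b = o.ideal a b := by
  cases o <;> simp only [BinOp.Safe, BinOp.eval, BinOp.ideal] at *
  case sub =>
    rw [Nat.mod_eq_of_lt (show b < 2 ^ w by omega)]
    rw [show a + (2 ^ w - b) = (a - b) + 2 ^ w by omega, Nat.add_mod_right,
      Nat.mod_eq_of_lt (by omega)]
  case lt => split_ifs <;> simp [Nat.mod_eq_of_lt h]
  case eq => split_ifs <;> simp [Nat.mod_eq_of_lt h]
  all_goals exact Nat.mod_eq_of_lt h

namespace RExp

/-- The value of an expression when nothing overflows. -/
def eval (s : State) : RExp → ℕ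
  | reg r => s.reg r
  | lit k => k
  | bin o a b => o.ideal (a.eval s) (b.eval s)
  | load a => s.mem (a.eval s)

/-- No overflow happens in the evaluation of an expression. -/
def Ok (V : ℕ) (s : State) : RExp → Prop
  | reg _ => True
  | lit k => k < V
  | bin o a b => a.Ok V s ∧ b.Ok V s ∧ o.Safe V (a.eval s) (b.eval s)
  | load a => a.Ok V s

/-- The expression mentions only registers below `64`. -/
def wf : RExp → Bool
  | reg r => decide (r < 64)
  | lit _ => true
  | bin _ a b => a.wf && b.wf
  | load a => a.wf

/-- The expression is not a bare register. -/
def compound : RExp → Bool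
  | reg _ => false
  | _ => true

/-- The time to evaluate an expression. -/
def cost : RExp → ℕ
  | reg _ => 1
  | lit _ => 1
  | bin _ a b => a.cost + (b.cost + 1)
  | load a => a.cost + 1

/-- The register in which the value of an expression compiled with destination `d` is found. -/
def dest (d : ℕ) : RExp → ℕ
  | reg r => r
  | _ => d

/-- Code evaluating an expression into register `d`, with scratch registers from `t` on. -/
def comp : RExp → ℕ → ℕ → Prog
  | reg _, _, _ => .skip
  | lit k, d, _ => .const d k
  | bin o a b, d, t =>
    .seq (comp a t (t + 1)) (.seq (comp b (t + 1) (t + 2)) (.op o d (dest t a) (dest (t + 1) b)))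
  | load a, d, t => .seq (comp a t (t + 1)) (.load d (dest t a))

@[simp] theorem eval_reg (s : State) (r : ℕ) : (reg r).eval s = s.reg r := rfl
@[simp] theorem eval_load (s : State) (a : RExp) : (load a).eval s = s.mem (a.eval s) := rfl
@[simp] theorem eval_ofNat (s : State) (n : ℕ) :
    (ofNat(n) : RExp).eval s = OfNat.ofNat n := rfl
@[simp] theorem eval_add (s : State) (a b : RExp) : (a + b).eval s = a.eval s + b.eval s := rfl
@[simp] theorem eval_sub (s : State) (a b : RExp) : (a - b).eval s = a.eval s - b.eval s := rfl
@[simp] theorem eval_mul (s : State) (a b : RExp) : (a * b).eval s = a.eval s * b.eval s := rfl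
@[simp] theorem eval_div (s : State) (a b : RExp) : (a / b).eval s = a.eval s / b.eval s := rfl
@[simp] theorem eval_mod (s : State) (a b : RExp) : (a % b).eval s = a.eval s % b.eval s := rfl
@[simp] theorem eval_lt (s : State) (a b : RExp) :
    (lt a b).eval s = if a.eval s < b.eval s then 1 else 0 := rfl
@[simp] theorem eval_eq (s : State) (a b : RExp) :
    (eq a b).eval s = if a.eval s = b.eval s then 1 else 0 := rfl

@[simp] theorem ok_reg (V : ℕ) (s : State) (r : ℕ) : (reg r).Ok V s ↔ True := Iff.rfl
@[simp] theorem ok_load (V : ℕ) (s : State) (a : RExp) : (load a).Ok V s ↔ a.Ok V s := Iff.rfl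
@[simp] theorem ok_ofNat (V : ℕ) (s : State) (n : ℕ) :
    (ofNat(n) : RExp).Ok V s ↔ OfNat.ofNat n < V := Iff.rfl
@[simp] theorem ok_add (V : ℕ) (s : State) (a b : RExp) :
    (a + b).Ok V s ↔ a.Ok V s ∧ b.Ok V s ∧ a.eval s + b.eval s < V := Iff.rfl
@[simp] theorem ok_sub (V : ℕ) (s : State) (a b : RExp) :
    (a - b).Ok V s ↔ a.Ok V s ∧ b.Ok V s ∧ b.eval s ≤ a.eval s ∧ a.eval s < V := Iff.rfl
@[simp] theorem ok_mul (V : ℕ) (s : State) (a b : RExp) :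
    (a * b).Ok V s ↔ a.Ok V s ∧ b.Ok V s ∧ a.eval s * b.eval s < V := Iff.rfl
@[simp] theorem ok_div (V : ℕ) (s : State) (a b : RExp) :
    (a / b).Ok V s ↔ a.Ok V s ∧ b.Ok V s ∧ a.eval s / b.eval s < V := Iff.rfl
@[simp] theorem ok_mod (V : ℕ) (s : State) (a b : RExp) :
    (a % b).Ok V s ↔ a.Ok V s ∧ b.Ok V s ∧ a.eval s % b.eval s < V := Iff.rfl
@[simp] theorem ok_lt (V : ℕ) (s : State) (a b : RExp) :
    (lt a b).Ok V s ↔ a.Ok V s ∧ b.Ok V s ∧ 1 < V := Iff.rfl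
@[simp] theorem ok_eq (V : ℕ) (s : State) (a b : RExp) :
    (eq a b).Ok V s ↔ a.Ok V s ∧ b.Ok V s ∧ 1 < V := Iff.rfl

@[simp] theorem cost_reg (r : ℕ) : (reg r).cost = 1 := rfl
@[simp] theorem cost_load (a : RExp) : (load a).cost = a.cost + 1 := rfl
@[simp] theorem cost_ofNat (n : ℕ) : (ofNat(n) : RExp).cost = 1 := rfl
@[simp] theorem cost_add (a b : RExp) : (a + b).cost = a.cost + (b.cost + 1) := rfl
@[simp] theorem cost_sub (a b : RExp) : (a - b).cost = a.cost + (b.cost + 1) := rfl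
@[simp] theorem cost_mul (a b : RExp) : (a * b).cost = a.cost + (b.cost + 1) := rfl
@[simp] theorem cost_div (a b : RExp) : (a / b).cost = a.cost + (b.cost + 1) := rfl
@[simp] theorem cost_mod (a b : RExp) : (a % b).cost = a.cost + (b.cost + 1) := rfl
@[simp] theorem cost_lt (a b : RExp) : (lt a b).cost = a.cost + (b.cost + 1) := rfl
@[simp] theorem cost_eq (a b : RExp) : (eq a b).cost = a.cost + (b.cost + 1) := rfl

end RExp

@[simp] theorem State.setReg_reg (s : State) (r v r' : ℕ) :
    (s.setReg r v).reg r' = if r' = r then v else s.reg r' := by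
  simp [State.setReg, Function.update_apply]
@[simp] theorem State.setReg_mem (s : State) (r v : ℕ) : (s.setReg r v).mem = s.mem := rfl
@[simp] theorem State.setMem_reg (s : State) (a v : ℕ) : (s.setMem a v).reg = s.reg := rfl
@[simp] theorem State.setMem_mem (s : State) (a v : ℕ) :
    (s.setMem a v).mem = Function.update s.mem a v := rfl

/-- Two states agree up to the scratch registers. -/
def Sim (s s' : State) : Prop := s.mem = s'.mem ∧ ∀ r < 64, s.reg r = s'.reg r

theorem Sim.refl (s : State) : Sim s s := ⟨rfl, fun _ _ => rfl⟩

theorem Sim.setReg {s s' : State} (h : Sim s s') (r v : ℕ) :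
    Sim (s.setReg r v) (s'.setReg r v) := by
  refine ⟨h.1, fun q hq => ?_⟩
  simp [h.2 q hq]

/-- The registers from 64 on serve as an evaluation stack with top `t`, so everything below `t`
except the destination survives. A bare register is read in place, which is why the value is looked
up in `dest`. -/
theorem RExp.comp_exec {w : ℕ} {σ : State} (e : RExp) : ∀ (d t : ℕ) (s : State), 64 ≤ t →
    (d < t) → e.wf = true → e.Ok (2 ^ w) σ → Sim s σ →
    ∃ s', Exec w (e.comp d t) s e.cost s' ∧ s'.mem = s.mem ∧
      s'.reg (e.dest d) = e.eval σ ∧ ∀ r < t, r ≠ d → s'.reg r = s.reg r := by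
  induction e with
  | reg r =>
    intro d t s ht hd hw hok hs
    exact ⟨s, .skip s, rfl, hs.2 r (by simpa [RExp.wf] using hw), fun _ _ _ => rfl⟩
  | lit k =>
    intro d t s ht hd hw hok hs
    refine ⟨_, .const d k s, rfl, ?_, fun r _ hr => by simp [hr]⟩
    simp only [RExp.dest, State.setReg_reg, if_true, RExp.eval]
    exact Nat.mod_eq_of_lt hok
  | bin o a b iha ihb =>
    intro d t s ht hd hw hok hs
    simp only [RExp.wf, Bool.and_eq_true] at hw
    obtain ⟨s₁, h₁, m₁, v₁, f₁⟩ := iha t (t + 1) s (by omega) (by omega) hw.1 hok.1 hs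
    have hs₁ : Sim s₁ σ := ⟨m₁.trans hs.1, fun r hr =>
      (f₁ r (by omega) (by omega)).trans (hs.2 r hr)⟩
    obtain ⟨s₂, h₂, m₂, v₂, f₂⟩ := ihb (t + 1) (t + 2) s₁ (by omega) (by omega) hw.2 hok.2.1 hs₁
    -- The left operand lies in a register below 64 or in `t`. The evaluation of the right operand
    -- touches neither.
    have v₁' : s₂.reg (a.dest t) = a.eval σ := by
      rw [← v₁]
      apply f₂
      · cases a <;> simp_all [RExp.dest, RExp.wf]; omega
      · cases a <;> simp_all [RExp.dest, RExp.wf]; omega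
    refine ⟨_, .seq h₁ (.seq h₂ (.op o d _ _ s₂)), m₂.trans m₁, ?_, fun r hr hrd => ?_⟩
    · change State.reg (State.setReg _ d _) d = o.ideal _ _
      rw [State.setReg_reg, if_pos rfl, v₁', v₂, BinOp.eval_eq_ideal hok.2.2]
    · simp only [State.setReg_reg, hrd, if_false]
      rw [f₂ r (by omega) (by omega), f₁ r (by omega) (by omega)]
  | load a iha =>
    intro d t s ht hd hw hok hs
    obtain ⟨s₁, h₁, m₁, v₁, f₁⟩ := iha t (t + 1) s (by omega) (by omega) hw hok hs
    refine ⟨_, .seq h₁ (.load d _ s₁), m₁, ?_, fun r hr hrd => ?_⟩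
    · change State.reg (State.setReg _ d _) d = _
      rw [State.setReg_reg, if_pos rfl, v₁, m₁, hs.1, RExp.eval_load]
    · simp only [State.setReg_reg, hrd, if_false]
      rw [f₁ r (by omega) (by omega)]

/-! ### Structured statements and rules for their running time -/

/-- `reg[r] := e` -/
def asg (r : ℕ) (e : RExp) : Prog := e.comp r 64
/-- `mem[a] := e` -/
def sto (a e : RExp) : Prog :=
  .seq (a.comp 64 66) (.seq (e.comp 65 66) (.store (a.dest 64) (e.dest 65)))
/-- `if e ≠ 0 then p else q` -/
def cnd (e : RExp) (p q : Prog) : Prog := .seq (e.comp 64 65) (.ite (e.dest 64) p q)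
/-- `while e ≠ 0 do p` -/
def whl (e : RExp) (p : Prog) : Prog :=
  .seq (e.comp 64 65) (.loop (e.dest 64) (.seq p (e.comp 64 65)))

infixr:60 ";;" => Prog.seq

/-- Started in any state that agrees with `σ` up to scratch registers, `p` halts; the time and the
final state, up to scratch registers, satisfy `Q`. -/
def Run (w : ℕ) (p : Prog) (σ : State) (Q : ℕ → State → Prop) : Prop :=
  ∀ s, Sim s σ → ∃ t s' σ', Exec w p s t s' ∧ Sim s' σ' ∧ Q t σ'

theorem Run.mono {w : ℕ} {p : Prog} {σ : State} {Q Q' : ℕ → State → Prop}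
    (h : Run w p σ Q) (hQ : ∀ t σ', Q t σ' → Q' t σ') : Run w p σ Q' := by
  intro s hs
  obtain ⟨t, s', σ', h₁, h₂, h₃⟩ := h s hs
  exact ⟨t, s', σ', h₁, h₂, hQ _ _ h₃⟩

theorem Run.seq {w : ℕ} {p q : Prog} {σ : State} {Q : ℕ → State → Prop}
    (h : Run w p σ fun t₁ σ₁ => Run w q σ₁ fun t₂ σ₂ => Q (t₁ + t₂) σ₂) :
    Run w (.seq p q) σ Q := by
  intro s hs
  obtain ⟨t₁, s₁, σ₁, h₁, hs₁, h₂⟩ := h s hs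
  obtain ⟨t₂, s₂, σ₂, h₂, hs₂, h₃⟩ := h₂ s₁ hs₁
  exact ⟨_, s₂, σ₂, .seq h₁ h₂, hs₂, h₃⟩

theorem Run.skip {w : ℕ} {σ : State} {Q : ℕ → State → Prop} (h : Q 1 σ) :
    Run w .skip σ Q := fun s hs => ⟨_, s, σ, .skip s, hs, h⟩

theorem Run.asg {w r : ℕ} {e : RExp} {σ : State} {Q : ℕ → State → Prop}
    (hwf : (e.wf && e.compound && decide (r < 64)) = true) (hok : e.Ok (2 ^ w) σ)
    (h : Q e.cost (σ.setReg r (e.eval σ))) : Run w (asg r e) σ Q := by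
  intro s hs
  simp only [Bool.and_eq_true, decide_eq_true_eq] at hwf
  obtain ⟨s', h₁, m₁, v₁, f₁⟩ := e.comp_exec r 64 s le_rfl hwf.2 hwf.1.1 hok hs
  refine ⟨_, s', σ.setReg r (e.eval σ), h₁, ⟨m₁.trans hs.1, fun q hq => ?_⟩, h⟩
  have : e.dest r = r := by cases e <;> simp_all [RExp.dest, RExp.compound]
  rw [this] at v₁
  simp only [State.setReg_reg]
  split_ifs with hqr
  · rw [hqr, v₁]
  · rw [f₁ q hq hqr, hs.2 q hq]

theorem Run.asgv {w r : ℕ} {e : RExp} {σ : State} {Q : ℕ → State → Prop} (v : ℕ)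
    (hv : e.eval σ = v) (hok : e.Ok (2 ^ w) σ) (h : Q e.cost (σ.setReg r v))
    (hwf : (e.wf && e.compound && decide (r < 64)) = true) : Run w (WordRAM.asg r e) σ Q := by
  subst hv
  exact Run.asg hwf hok h

theorem Run.sto {w : ℕ} {a e : RExp} {σ : State} {Q : ℕ → State → Prop}
    (hwf : (a.wf && e.wf) = true) (ha : a.Ok (2 ^ w) σ) (he : e.Ok (2 ^ w) σ)
    (h : Q (a.cost + (e.cost + 1)) (σ.setMem (a.eval σ) (e.eval σ))) :
    Run w (sto a e) σ Q := by
  intro s hs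
  simp only [Bool.and_eq_true] at hwf
  obtain ⟨s₁, h₁, m₁, v₁, f₁⟩ := a.comp_exec 64 66 s (by omega) (by omega) hwf.1 ha hs
  have hs₁ : Sim s₁ σ := ⟨m₁.trans hs.1, fun r hr =>
    (f₁ r (by omega) (by omega)).trans (hs.2 r hr)⟩
  obtain ⟨s₂, h₂, m₂, v₂, f₂⟩ := e.comp_exec 65 66 s₁ (by omega) (by omega) hwf.2 he hs₁
  have v₁' : s₂.reg (a.dest 64) = a.eval σ := by
    rw [← v₁]
    have := hwf.1
    apply f₂
    · cases a <;> simp_all [RExp.dest, RExp.wf]; omega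
    · cases a <;> simp_all [RExp.dest, RExp.wf]; omega
  refine ⟨_, _, _, .seq h₁ (.seq h₂ (.store _ _ s₂)), ⟨?_, fun r hr => ?_⟩, h⟩
  · simp only [State.setMem_mem, v₁', v₂, m₂, m₁, hs.1]
  · simp only [State.setMem_reg]
    rw [f₂ r (by omega) (by omega), hs₁.2 r hr]

theorem Run.stov {w : ℕ} {a e : RExp} {σ : State} {Q : ℕ → State → Prop} (u v : ℕ)
    (hu : a.eval σ = u) (hv : e.eval σ = v) (ha : a.Ok (2 ^ w) σ) (he : e.Ok (2 ^ w) σ)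
    (h : Q (a.cost + (e.cost + 1)) (σ.setMem u v)) (hwf : (a.wf && e.wf) = true) :
    Run w (WordRAM.sto a e) σ Q := by
  subst hu hv
  exact Run.sto hwf ha he h

theorem Run.cnd {w : ℕ} {e : RExp} {p q : Prog} {σ : State} {Q : ℕ → State → Prop}
    (hwf : e.wf = true) (hok : e.Ok (2 ^ w) σ)
    (h₁ : e.eval σ ≠ 0 → Run w p σ fun t σ' => Q (e.cost + (1 + t)) σ')
    (h₂ : e.eval σ = 0 → Run w q σ fun t σ' => Q (e.cost + (1 + t)) σ') :
    Run w (cnd e p q) σ Q := by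
  intro s hs
  obtain ⟨s₁, x₁, m₁, v₁, f₁⟩ := e.comp_exec 64 65 s (by omega) (by omega) hwf hok hs
  have hs₁ : Sim s₁ σ := ⟨m₁.trans hs.1, fun r hr =>
    (f₁ r (by omega) (by omega)).trans (hs.2 r hr)⟩
  by_cases hc : e.eval σ = 0
  · obtain ⟨t, s', σ', x₂, hs', hQ⟩ := h₂ hc s₁ hs₁
    exact ⟨_, s', σ', .seq x₁ (.ite_false (v₁.trans hc) x₂), hs', hQ⟩
  · obtain ⟨t, s', σ', x₂, hs', hQ⟩ := h₁ hc s₁ hs₁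
    exact ⟨_, s', σ', .seq x₁ (.ite_true (by rwa [v₁]) x₂), hs', hQ⟩

/-- Amortized rule for loops: `g` is a ghost variable and `Φ` a potential. Each round, with its
test, is paid by the drop of `Φ`, which also forces termination. The extra `e.cost + 1` pays for the
first test and for leaving the loop. -/
theorem Run.whl {w : ℕ} {e : RExp} {p : Prog} {σ : State} {Q : ℕ → State → Prop} {γ : Type*}
    (I : γ → State → Prop) (Φ : γ → ℕ) (g : γ) (hwf : e.wf = true) (hI : I g σ)
    (hok : ∀ g σ, I g σ → e.Ok (2 ^ w) σ)
    (hstep : ∀ g σ, I g σ → e.eval σ ≠ 0 →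
      Run w p σ fun t σ' => ∃ g', I g' σ' ∧ Φ g' + t + (e.cost + 1) ≤ Φ g)
    (hQ : ∀ g' σ' t, I g' σ' → e.eval σ' = 0 → t + Φ g' ≤ Φ g + (e.cost + 1) → Q t σ') :
    Run w (whl e p) σ Q := by
  have key : ∀ n g σ, Φ g = n → I g σ → ∀ s, Sim s σ → s.reg (e.dest 64) = e.eval σ →
      ∃ t s' σ' g', Exec w (.loop (e.dest 64) (.seq p (e.comp 64 65))) s t s' ∧ Sim s' σ' ∧
        I g' σ' ∧ e.eval σ' = 0 ∧ t + Φ g' ≤ Φ g + 1 := by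
    intro n
    induction n using Nat.strong_induction_on with
    | _ n ih =>
      intro g σ hn hI s hs hv
      by_cases hc : e.eval σ = 0
      · exact ⟨1, s, σ, g, .loop_done (hv.trans hc), hs, hI, hc, by omega⟩
      · obtain ⟨t, s₁, σ₁, x₁, hs₁, g₁, hI₁, hΦ⟩ := hstep g σ hI hc s hs
        obtain ⟨s₂, x₂, m₂, v₂, f₂⟩ :=
          e.comp_exec 64 65 s₁ (by omega) (by omega) hwf (hok _ _ hI₁) hs₁
        have hs₂ : Sim s₂ σ₁ := ⟨m₂.trans hs₁.1, fun r hr =>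
          (f₂ r (by omega) (by omega)).trans (hs₁.2 r hr)⟩
        obtain ⟨t', s', σ', g', x₃, hs', hI', h0, ht⟩ := ih (Φ g₁) (by omega) g₁ σ₁ rfl hI₁ s₂ hs₂ v₂
        exact ⟨_, s', σ', g', .loop_step (by rwa [hv]) (.seq x₁ x₂) x₃, hs', hI', h0, by omega⟩
  intro s hs
  obtain ⟨s₁, x₁, m₁, v₁, f₁⟩ := e.comp_exec 64 65 s (by omega) (by omega) hwf (hok _ _ hI) hs
  have hs₁ : Sim s₁ σ := ⟨m₁.trans hs.1, fun r hr =>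
    (f₁ r (by omega) (by omega)).trans (hs.2 r hr)⟩
  obtain ⟨t, s', σ', g', x₂, hs', hI', h0, ht⟩ := key _ g σ rfl hI s₁ hs₁ v₁
  exact ⟨_, s', σ', .seq x₁ x₂, hs', hQ g' σ' _ hI' h0 (by omega)⟩

end WordRAM

/-!
# Subset sums modulo `m` in time `O(m log m)`

The shifts `s < 2 ^ L` are processed in the order of their reversed binary digits.  Names of dyadic
blocks of the periodic characteristic word of the current set of sums are kept for all blocks that
start at a multiple of their length, or at a number congruent to the current `s` modulo their
length.  Comparing names finds the positions where the word differs from its translate by `s`.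
-/

set_option maxRecDepth 10000

namespace ShiftTree

open WordRAM RExp

/-! ### Memory layout and names of dyadic blocks -/

/-- The length of the window on which names are kept, for `2 ^ L ≥ m`. -/
def wd (L : ℕ) : ℕ := 2 * 2 ^ L

/-- The size of a memory region. -/
def bb (L : ℕ) : ℕ := wd L ^ 16

/-- The address of the name of the block of length `2 ^ k` that starts at `x`. -/
def naddr (L k x : ℕ) : ℕ := 3 * bb L + 2 ^ k * wd L + x

/-- The address of the name of the pair `(a, b)` of names. -/
def paddr (L a b : ℕ) : ℕ := 4 * bb L + a * bb L + b

/-- The name of the block of length `2 ^ k` that starts at `x`. -/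
def nm (L : ℕ) (f : ℕ → ℕ) (k x : ℕ) : ℕ := f (naddr L k x)

/-- The name of a pair of names, `0` if there is none yet. -/
def pr (L : ℕ) (f : ℕ → ℕ) (a b : ℕ) : ℕ := f (paddr L a b)

/-- The names of all dyadic sub-blocks of the block of length `2 ^ k` at `x` are up to date. -/
def HC (L : ℕ) (f : ℕ → ℕ) : ℕ → ℕ → Prop
  | 0, _ => True
  | k + 1, x => pr L f (nm L f k x) (nm L f k (x + 2 ^ k)) = nm L f (k + 1) x ∧
      nm L f (k + 1) x ≠ 0 ∧ HC L f k x ∧ HC L f k (x + 2 ^ k)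

/-- The pair table is injective and uses only names below `c`. -/
structure Tab (L : ℕ) (f : ℕ → ℕ) (c : ℕ) : Prop where
  two_le : 2 ≤ c
  nm_lt : ∀ k ≤ L, ∀ x < wd L, nm L f k x < c
  pr_lt : ∀ a < bb L, ∀ b < bb L, pr L f a b < c
  inj : ∀ a < bb L, ∀ b < bb L, ∀ a' < bb L, ∀ b' < bb L, pr L f a b ≠ 0 →
    pr L f a b = pr L f a' b' → a = a' ∧ b = b'

theorem wd_ge (L : ℕ) : 2 ≤ wd L := by
  have := Nat.one_le_two_pow (n := L)
  unfold wd; omega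

/-- The factor is `2 ^ 14 ≤ wd L ^ 14`. It leaves room for the name counter, which never exceeds a
smaller multiple of `L * 2 ^ L` (`totalCost_le`). -/
theorem wd_sq_le (L : ℕ) : 16384 * (wd L * wd L) ≤ bb L := by
  have h := wd_ge L
  have : 2 ^ 14 * wd L ^ 2 ≤ wd L ^ 14 * wd L ^ 2 :=
    Nat.mul_le_mul_right _ (Nat.pow_le_pow_left h 14)
  calc 16384 * (wd L * wd L) = 2 ^ 14 * wd L ^ 2 := by ring
    _ ≤ wd L ^ 14 * wd L ^ 2 := this
    _ = bb L := by unfold bb; ring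

theorem pow_mul_wd_lt {L k x : ℕ} (hk : k ≤ L) (hx : x < wd L) :
    2 ^ k * wd L + x < wd L * wd L := by
  have h1 : 2 ^ k ≤ 2 ^ L := Nat.pow_le_pow_right (by norm_num) hk
  have h2 : 2 ^ k + 1 ≤ wd L := by have := Nat.one_le_two_pow (n := L); unfold wd; omega
  calc 2 ^ k * wd L + x < (2 ^ k + 1) * wd L := by ring_nf; omega
    _ ≤ wd L * wd L := Nat.mul_le_mul_right _ h2

theorem naddr_lt {L k x : ℕ} (hk : k ≤ L) (hx : x < wd L) : naddr L k x < 4 * bb L := by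
  have h1 := pow_mul_wd_lt hk hx
  have h2 := wd_sq_le L
  unfold naddr; omega

theorem le_naddr (L k x : ℕ) : 3 * bb L ≤ naddr L k x := by
  unfold naddr; omega

theorem le_paddr (L a b : ℕ) : 4 * bb L ≤ paddr L a b := by
  unfold paddr; omega

theorem mul_add_inj {W a b x y : ℕ} (hx : x < W) (hy : y < W) (h : a * W + x = b * W + y) :
    a = b ∧ x = y := by
  have hW : 0 < W := by omega
  have h1 : (a * W + x) / W = a := by
    rw [mul_comm, Nat.mul_add_div hW, Nat.div_eq_of_lt hx, add_zero]
  have h2 : (b * W + y) / W = b := by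
    rw [mul_comm, Nat.mul_add_div hW, Nat.div_eq_of_lt hy, add_zero]
  have : a = b := by rw [← h1, ← h2, h]
  subst this
  exact ⟨rfl, by omega⟩

/-- The level enters an address through the block length `2 ^ k`, which the program has at hand.
Distinct levels give distinct lengths, so nothing is lost. -/
theorem naddr_inj {L j k x y : ℕ} (hx : x < wd L) (hy : y < wd L)
    (h : naddr L j x = naddr L k y) : j = k ∧ x = y := by
  unfold naddr at h
  obtain ⟨h1, h2⟩ := mul_add_inj hx hy (show 2 ^ j * wd L + x = 2 ^ k * wd L + y by omega)
  exact ⟨Nat.pow_right_injective le_rfl h1, h2⟩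

theorem paddr_inj {L a b a' b' : ℕ} (hb : b < bb L) (hb' : b' < bb L)
    (h : paddr L a b = paddr L a' b') : a = a' ∧ b = b' := by
  unfold paddr at h
  exact mul_add_inj hb hb' (by omega)

theorem nm_update {L j k x y : ℕ} (f : ℕ → ℕ) (v : ℕ) (hx : x < wd L) (hy : y < wd L) :
    nm L (Function.update f (naddr L k x) v) j y = if j = k ∧ y = x then v else nm L f j y := by
  unfold nm
  rw [Function.update_apply]
  congr 1
  exact propext ⟨fun h => naddr_inj hy hx h, by rintro ⟨rfl, rfl⟩; rfl⟩

theorem pr_update_naddr {L k x : ℕ} (f : ℕ → ℕ) (v a b : ℕ) (hk : k ≤ L) (hx : x < wd L) :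
    pr L (Function.update f (naddr L k x) v) a b = pr L f a b := by
  unfold pr
  rw [Function.update_of_ne]
  have := naddr_lt hk hx
  have := le_paddr L a b
  omega

theorem nm_update_paddr {L k x : ℕ} (f : ℕ → ℕ) (v a b : ℕ) (hk : k ≤ L) (hx : x < wd L) :
    nm L (Function.update f (paddr L a b) v) k x = nm L f k x := by
  unfold nm
  rw [Function.update_of_ne]
  have := naddr_lt hk hx
  have := le_paddr L a b
  omega

theorem pr_update {L a b a' b' : ℕ} (f : ℕ → ℕ) (v : ℕ) (hb : b < bb L) (hb' : b' < bb L) :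
    pr L (Function.update f (paddr L a b) v) a' b' =
      if a' = a ∧ b' = b then v else pr L f a' b' := by
  unfold pr
  rw [Function.update_apply]
  congr 1
  exact propext ⟨fun h => paddr_inj hb' hb h, by rintro ⟨rfl, rfl⟩; rfl⟩

theorem lt_wd_of_add_le {L k x : ℕ} (h : x + 2 ^ k ≤ wd L) : x < wd L := by
  have := Nat.two_pow_pos k
  omega

/-- Whether a block is up to date depends only on the names inside it and on nonzero table entries.
The bound `c ≤ bb L` keeps all names within the range of the table. -/
theorem HC.congr {L c : ℕ} {f f' : ℕ → ℕ} (hT : Tab L f c) (hc : c ≤ bb L)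
    (hp : ∀ a < bb L, ∀ b < bb L, pr L f a b ≠ 0 → pr L f' a b = pr L f a b) :
    ∀ k ≤ L, ∀ x, x + 2 ^ k ≤ wd L →
    (∀ j ≤ k, ∀ y, x ≤ y → y < x + 2 ^ k → nm L f' j y = nm L f j y) →
    HC L f k x → HC L f' k x := by
  intro k
  induction k with
  | zero => intros; trivial
  | succ k ih =>
    intro hk x hx hn h
    have hk' : 2 ^ (k + 1) = 2 ^ k + 2 ^ k := by ring
    have h0 := Nat.two_pow_pos k
    obtain ⟨h1, h2, h3, h4⟩ := h
    refine ⟨?_, ?_, ih (by omega) x (by omega) ?_ h3, ih (by omega) _ (by omega) ?_ h4⟩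
    · rw [hn k (by omega) x le_rfl (by omega), hn k (by omega) (x + 2 ^ k) (by omega) (by omega),
        hn (k + 1) le_rfl x le_rfl (by omega), hp, h1]
      · exact (hT.nm_lt k (by omega) x (by omega)).trans_le hc
      · exact (hT.nm_lt k (by omega) _ (by omega)).trans_le hc
      · rw [h1]; exact h2
    · rw [hn (k + 1) le_rfl x le_rfl (by omega)]; exact h2
    · intro j hj y hy hy'
      exact hn j (by omega) y hy (by omega)
    · intro j hj y hy hy'
      exact hn j (by omega) y (by omega) (by omega)

/-- The table is injective on its nonzero entries, so the name of a block determines the names of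
its halves. Induction on the level goes down to the letters. -/
theorem nm_eq_iff {L c : ℕ} {f : ℕ → ℕ} (hT : Tab L f c) (hc : c ≤ bb L) :
    ∀ k ≤ L, ∀ x y, x + 2 ^ k ≤ wd L → y + 2 ^ k ≤ wd L → HC L f k x → HC L f k y →
    (nm L f k x = nm L f k y ↔ ∀ i < 2 ^ k, nm L f 0 (x + i) = nm L f 0 (y + i)) := by
  intro k
  induction k with
  | zero => intro _ x y _ _ _ _; simp
  | succ k ih =>
    intro hk x y hx hy hcx hcy
    have hk' : 2 ^ (k + 1) = 2 ^ k + 2 ^ k := by ring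
    have h0 := Nat.two_pow_pos k
    obtain ⟨x1, x2, x3, x4⟩ := hcx
    obtain ⟨y1, y2, y3, y4⟩ := hcy
    have hlt : ∀ z < wd L, nm L f k z < bb L :=
      fun z hz => (hT.nm_lt k (by omega) z hz).trans_le hc
    have key : nm L f (k + 1) x = nm L f (k + 1) y ↔
        nm L f k x = nm L f k y ∧ nm L f k (x + 2 ^ k) = nm L f k (y + 2 ^ k) := by
      constructor
      · intro h
        rw [← x1, ← y1] at h
        exact hT.inj _ (hlt _ (by omega)) _ (hlt _ (by omega)) _ (hlt _ (by omega)) _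
          (hlt _ (by omega)) (by rw [x1]; exact x2) h
      · rintro ⟨h1, h2⟩
        rw [← x1, ← y1, h1, h2]
    rw [key, ih (by omega) x y (by omega) (by omega) x3 y3,
      ih (by omega) _ _ (by omega) (by omega) x4 y4]
    constructor
    · rintro ⟨h1, h2⟩ i hi
      by_cases hik : i < 2 ^ k
      · exact h1 i hik
      · have := h2 (i - 2 ^ k) (by omega)
        rwa [show x + 2 ^ k + (i - 2 ^ k) = x + i by omega,
          show y + 2 ^ k + (i - 2 ^ k) = y + i by omega] at this
    · intro h
      refine ⟨fun i hi => h i (by omega), fun i hi => ?_⟩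
      rw [add_assoc, add_assoc]
      exact h _ (by omega)

/-- Giving a new name to a pair. -/
theorem Tab.alloc {L c a b : ℕ} {f : ℕ → ℕ} (hT : Tab L f c) (hb : b < bb L) : Tab L (Function.update f (paddr L a b) c) (c + 1) where
  two_le := by have := hT.two_le; omega
  nm_lt k hk x hx := by
    rw [nm_update_paddr _ _ _ _ hk hx]
    have := hT.nm_lt k hk x hx
    omega
  pr_lt a' ha' b' hb' := by
    rw [pr_update _ _ hb hb']
    have := hT.pr_lt a' ha' b' hb'
    split_ifs <;> omega
  inj a₁ ha₁ b₁ hb₁ a₂ ha₂ b₂ hb₂ := by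
    rw [pr_update _ _ hb hb₁, pr_update _ _ hb hb₂]
    have h1 := hT.pr_lt a₁ ha₁ b₁ hb₁
    have h2 := hT.pr_lt a₂ ha₂ b₂ hb₂
    split_ifs with p q q
    · intros; exact ⟨p.1.trans q.1.symm, p.2.trans q.2.symm⟩
    · intros; omega
    · intros; omega
    · exact hT.inj a₁ ha₁ b₁ hb₁ a₂ ha₂ b₂ hb₂

/-- Only an empty entry is filled, and blocks that are up to date use nonempty ones. -/
theorem HC.alloc {L c a b : ℕ} {f : ℕ → ℕ} (hT : Tab L f c) (hc : c ≤ bb L)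
    (hb : b < bb L) (hab : pr L f a b = 0) {k x : ℕ} (hk : k ≤ L) (hx : x + 2 ^ k ≤ wd L)
    (h : HC L f k x) : HC L (Function.update f (paddr L a b) c) k x := by
  refine HC.congr hT hc ?_ k hk x hx ?_ h
  · intro a' _ b' hb' h
    rw [pr_update _ _ hb hb', if_neg]
    rintro ⟨rfl, rfl⟩
    exact h hab
  · intro j hj y _ hy
    exact nm_update_paddr _ _ _ _ (by omega) (by omega)

theorem Tab.setName {L c k x v : ℕ} {f : ℕ → ℕ} (hT : Tab L f c) (hv : v < c) (hk : k ≤ L)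
    (hx : x < wd L) : Tab L (Function.update f (naddr L k x) v) c where
  two_le := hT.two_le
  nm_lt j hj y hy := by
    rw [nm_update _ _ hx hy]
    have := hT.nm_lt j hj y hy
    split_ifs <;> assumption
  pr_lt a ha b hb := by
    rw [pr_update_naddr _ _ _ _ hk hx]; exact hT.pr_lt a ha b hb
  inj a ha b hb a' ha' b' hb' := by
    rw [pr_update_naddr _ _ _ _ hk hx, pr_update_naddr _ _ _ _ hk hx]
    exact hT.inj a ha b hb a' ha' b' hb'

/-- If the stored name differs from the correct value `v`, the block is not up to date, and then no
block that is up to date has it as a sub-block. Stale names may thus be overwritten without regard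
to the rest of the tree. -/
theorem HC.setName {L k x v : ℕ} {f : ℕ → ℕ} (hk : k + 1 ≤ L)
    (hx : x + 2 ^ (k + 1) ≤ wd L) (hv : pr L f (nm L f k x) (nm L f k (x + 2 ^ k)) = v) :
    ∀ j ≤ L, ∀ y, y + 2 ^ j ≤ wd L → HC L f j y →
      HC L (Function.update f (naddr L (k + 1) x) v) j y := by
  have hxw := lt_wd_of_add_le hx
  by_cases hn : nm L f (k + 1) x = v
  · have : Function.update f (naddr L (k + 1) x) v = f := by
      rw [← hn]; exact Function.update_eq_self _ _
    rw [this]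
    exact fun _ _ _ _ h => h
  have hno : ¬ HC L f (k + 1) x := fun h => hn (h.1.symm.trans hv)
  have hsame : ∀ j ≤ L, ∀ y, y < wd L → HC L f j y →
      nm L (Function.update f (naddr L (k + 1) x) v) j y = nm L f j y := by
    intro j hj y hy h
    rw [nm_update _ _ hxw hy, if_neg]
    rintro ⟨rfl, rfl⟩
    exact hno h
  intro j
  induction j with
  | zero => intros; trivial
  | succ j ih =>
    intro hj y hy h
    have hj' : 2 ^ (j + 1) = 2 ^ j + 2 ^ j := by ring
    have h0 := Nat.two_pow_pos j
    have h' := h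
    obtain ⟨h1, h2, h3, h4⟩ := h
    refine ⟨?_, ?_, ih (by omega) y (by omega) h3, ih (by omega) _ (by omega) h4⟩
    · rw [hsame _ hj y (by omega) h', hsame j (by omega) y (by omega) h3,
        hsame j (by omega) _ (by omega) h4, pr_update_naddr _ _ _ _ hk hxw, h1]
    · rw [hsame _ hj y (by omega) h']; exact h2

theorem HC.of_setName {L k x v : ℕ} {f : ℕ → ℕ} (hk : k + 1 ≤ L)
    (hx : x + 2 ^ (k + 1) ≤ wd L) (hv : pr L f (nm L f k x) (nm L f k (x + 2 ^ k)) = v)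
    (h0 : v ≠ 0) (h1 : HC L f k x) (h2 : HC L f k (x + 2 ^ k)) :
    HC L (Function.update f (naddr L (k + 1) x) v) (k + 1) x := by
  have hxw := lt_wd_of_add_le hx
  have hk' : 2 ^ (k + 1) = 2 ^ k + 2 ^ k := by ring
  have h00 := Nat.two_pow_pos k
  refine ⟨?_, ?_, HC.setName hk hx hv k (by omega) x (by omega) h1,
    HC.setName hk hx hv k (by omega) _ (by omega) h2⟩
  · rw [nm_update _ _ hxw hxw, nm_update _ _ hxw hxw, nm_update _ _ hxw (by omega),
      pr_update_naddr _ _ _ _ hk hxw, if_neg (by omega), if_neg (by omega), if_pos ⟨rfl, rfl⟩, hv]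
  · rw [nm_update _ _ hxw hxw, if_pos ⟨rfl, rfl⟩]; exact h0

/-- A new letter only affects the blocks that contain its position. -/
theorem HC.setLeaf {L c y v : ℕ} {f : ℕ → ℕ} (hT : Tab L f c) (hc : c ≤ bb L) (hy : y < wd L)
    {k x : ℕ} (hk : k ≤ L) (hx : x + 2 ^ k ≤ wd L) (hyx : y < x ∨ x + 2 ^ k ≤ y)
    (h : HC L f k x) : HC L (Function.update f (naddr L 0 y) v) k x := by
  refine HC.congr hT hc ?_ k hk x hx ?_ h
  · intro a' _ b' _ _
    exact pr_update_naddr _ _ _ _ (by omega) hy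
  · intro j hj z _ hz
    rw [nm_update _ _ hy (by omega), if_neg]
    omega

attribute [irreducible] bb

/-! ### Computing names on the machine -/

/-- The registers that hold the modulus and the size parameters. -/
structure Env (L m w : ℕ) (σ : State) : Prop where
  r0 : σ.reg 0 = m
  r3 : σ.reg 3 = 2 ^ L
  r4 : σ.reg 4 = wd L
  r5 : σ.reg 5 = bb L
  word : 5 * bb L + bb L * bb L ≤ 2 ^ w
  m_pos : 2 ≤ m
  m_le : m ≤ 2 ^ L
  le_m : 2 ^ L < 2 * m

theorem Env.congr {L m w n : ℕ} {σ σ' : State} (h : Env L m w σ) (hn : 6 ≤ n)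
    (hf : ∀ r < n, σ'.reg r = σ.reg r) : Env L m w σ' where
  r0 := by rw [hf 0 (by omega), h.r0]
  r3 := by rw [hf 3 (by omega), h.r3]
  r4 := by rw [hf 4 (by omega), h.r4]
  r5 := by rw [hf 5 (by omega), h.r5]
  word := h.word
  m_pos := h.m_pos
  m_le := h.m_le
  le_m := h.le_m

theorem Env.word_ne {L m w : ℕ} {σ : State} (h : Env L m w σ) : w ≠ 0 := by
  have h1 := h.word
  have h2 := wd_sq_le L
  have h3 := wd_ge L
  rintro rfl
  rw [pow_zero] at h1
  nlinarith

/-- The effect of code that computes names in time `t`, changing only registers from `n` on. -/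
structure Upd (L n t : ℕ) (σ σ' : State) : Prop where
  frame : ∀ r < n, σ'.reg r = σ.reg r
  tab : Tab L σ'.mem (σ'.reg 50)
  cnt : σ'.reg 50 ≤ σ.reg 50 + t
  hc : ∀ j ≤ L, ∀ y, y + 2 ^ j ≤ wd L → HC L σ.mem j y → HC L σ'.mem j y
  low : ∀ a < 3 * bb L, σ'.mem a = σ.mem a
  leaf : ∀ y < wd L, nm L σ'.mem 0 y = nm L σ.mem 0 y

theorem Upd.trans {L n t t' : ℕ} {σ σ' σ'' : State} (h : Upd L n t σ σ') (h' : Upd L n t' σ' σ'') :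
    Upd L n (t + t') σ σ'' where
  frame r hr := (h'.frame r hr).trans (h.frame r hr)
  tab := h'.tab
  cnt := by have := h.cnt; have := h'.cnt; omega
  hc j hj y hy hh := h'.hc j hj y hy (h.hc j hj y hy hh)
  low a ha := (h'.low a ha).trans (h.low a ha)
  leaf y hy := (h'.leaf y hy).trans (h.leaf y hy)

theorem Upd.mono {L n n' t t' : ℕ} {σ σ' : State} (h : Upd L n t σ σ') (hn : n' ≤ n)
    (ht : t ≤ t') : Upd L n' t' σ σ' where
  frame r hr := h.frame r (by omega)
  tab := h.tab
  cnt := by have := h.cnt; omega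
  hc := h.hc
  low := h.low
  leaf := h.leaf

theorem Upd.anti {L n n' t : ℕ} {σ σ' : State} (h : Upd L n t σ σ') (hn : n' ≤ n) :
    Upd L n' t σ σ' := h.mono hn le_rfl

theorem Upd.of_mem_eq {L n : ℕ} {σ σ' : State} (hT : Tab L σ.mem (σ.reg 50))
    (hm : σ'.mem = σ.mem) (hf : ∀ r < n, σ'.reg r = σ.reg r) (h50 : σ'.reg 50 = σ.reg 50) :
    Upd L n 0 σ σ' where
  frame := hf
  tab := by rw [hm, h50]; exact hT
  cnt := by omega
  hc _ _ _ _ h := by rw [hm]; exact h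
  low a _ := by rw [hm]
  leaf y _ := by rw [hm]

/-- Compute the name of the block of length `reg[30]` at `reg[31]` from the names of its halves. -/
def nodeProg : Prog :=
  asg 32 (reg 30 / 2);;
  asg 33 (load (3 * reg 5 + reg 32 * reg 4 + reg 31));;
  asg 34 (load (3 * reg 5 + reg 32 * reg 4 + (reg 31 + reg 32)));;
  asg 35 (4 * reg 5 + reg 33 * reg 5 + reg 34);;
  asg 36 (load (reg 35));;
  cnd (reg 36) .skip (asg 36 (reg 50 + 0);; sto (reg 35) (reg 36);; asg 50 (reg 50 + 1));;
  sto (3 * reg 5 + reg 30 * reg 4 + reg 31) (reg 36)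

theorem pow_facts {L k : ℕ} (hk : k ≤ L) : 1 ≤ 2 ^ k ∧ 2 ^ k ≤ 2 ^ L ∧ 2 ^ L + 2 ^ L = wd L :=
  ⟨Nat.one_le_two_pow, Nat.pow_le_pow_right (by norm_num) hk, by unfold wd; ring⟩

theorem wd_lt_bb (L : ℕ) : 16384 * wd L ≤ bb L := by
  have h1 := wd_sq_le L
  have h2 := wd_ge L
  nlinarith

/-- At most one new name is issued, so running time bounds the number of names. This is how the
counter in register 50 is kept below `bb L` throughout. -/
theorem nodeProg_run {L m w k x : ℕ} {σ : State} (hE : Env L m w σ) (hk : k + 1 ≤ L)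
    (h30 : σ.reg 30 = 2 ^ (k + 1)) (h31 : σ.reg 31 = x) (hx : x + 2 ^ (k + 1) ≤ wd L)
    (hT : Tab L σ.mem (σ.reg 50)) (hc : σ.reg 50 < bb L) :
    Run w nodeProg σ fun t σ' => t ≤ 80 ∧ Upd L 32 t σ σ' ∧
      (HC L σ.mem k x → HC L σ.mem k (x + 2 ^ k) → HC L σ'.mem (k + 1) x) := by
  obtain ⟨p1, p2, p3⟩ := pow_facts (show k ≤ L by omega)
  have p4 : 2 ^ (k + 1) = 2 * 2 ^ k := by ring
  have hB := wd_lt_bb L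
  have hV := hE.word
  have hxw : x < wd L := by omega
  have hxw' : x + 2 ^ k < wd L := by omega
  have e1 := naddr_lt (show k ≤ L by omega) hxw
  have e2 := naddr_lt (show k ≤ L by omega) hxw'
  have e3 := naddr_lt hk hxw
  have ha := hT.nm_lt k (by omega) x hxw
  have hb := hT.nm_lt k (by omega) _ hxw'
  set a := nm L σ.mem k x with ha'
  set b := nm L σ.mem k (x + 2 ^ k) with hb'
  have hpa : a * bb L + bb L ≤ bb L * bb L := by nlinarith
  have hv := hT.pr_lt a (by omega) b (by omega)
  unfold naddr at e1 e2 e3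
  have q1 := hE.r4
  have q2 := hE.r5
  have h2 := hT.two_le
  have hw0 := hE.word_ne
  refine Run.seq (Run.asgv (2 ^ k) ?_ ?_ ?_ rfl)
  · simp [h30, p4]
  · simp [h30, p4]; omega
  refine Run.seq (Run.asgv a ?_ ?_ ?_ rfl)
  · simp [h31, q1, q2, ha', nm, naddr]
  · simp [h31, q1, q2]; omega
  refine Run.seq (Run.asgv b ?_ ?_ ?_ rfl)
  · simp [h31, q1, q2, hb', nm, naddr]
  · simp [h31, q1, q2]; omega
  refine Run.seq (Run.asgv (paddr L a b) ?_ ?_ ?_ rfl)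
  · simp [q2, paddr]
  · simp [q2]; omega
  refine Run.seq (Run.asgv (pr L σ.mem a b) ?_ ?_ ?_ rfl)
  · simp [pr]
  · simp
  refine Run.seq (Run.cnd rfl ?_ ?_ ?_)
  · simp
  · intro hne
    replace hne : pr L σ.mem a b ≠ 0 := by simpa using hne
    refine Run.skip (Run.stov (naddr L (k + 1) x) (pr L σ.mem a b) ?_ ?_ ?_ ?_ ?_ rfl)
    · simp [h30, h31, q1, q2, naddr]
    · simp
    · simp [h30, h31, q1, q2]; omega
    · simp
    refine ⟨by simp, ⟨?_, ?_, ?_, ?_, ?_, ?_⟩, ?_⟩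
    · intro r hr
      simp; grind
    · simpa using hT.setName hv hk hxw
    · simp
    · simpa using HC.setName hk hx rfl
    · intro a ha
      have := le_naddr L (k + 1) x
      simp only [State.setMem_mem, State.setReg_mem]
      rw [Function.update_of_ne (by omega)]
    · intro y hy
      simp [nm_update _ _ hxw hy]
    · simpa using HC.of_setName hk hx rfl hne
  · intro hne
    replace hne : pr L σ.mem a b = 0 := by simpa using hne
    refine Run.seq (Run.asgv (σ.reg 50) ?_ ?_ ?_ rfl)
    · simp
    · simp; omega
    refine Run.seq (Run.stov (paddr L a b) (σ.reg 50) ?_ ?_ ?_ ?_ ?_ rfl)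
    · simp
    · simp
    · simp
    · simp
    refine (Run.asgv (σ.reg 50 + 1) ?_ ?_ ?_ rfl)
    · simp
    · simp; omega
    refine (Run.stov (naddr L (k + 1) x) (σ.reg 50) ?_ ?_ ?_ ?_ ?_ rfl)
    · simp [h30, h31, q1, q2, naddr]
    · simp
    · simp [h30, h31, q1, q2]; omega
    · simp
    have hT' := hT.alloc (a := a) (b := b) (by omega)
    have hpr : pr L (Function.update σ.mem (paddr L a b) (σ.reg 50))
        (nm L (Function.update σ.mem (paddr L a b) (σ.reg 50)) k x)
        (nm L (Function.update σ.mem (paddr L a b) (σ.reg 50)) k (x + 2 ^ k)) = σ.reg 50 := by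
      rw [nm_update_paddr _ _ _ _ (by omega) hxw, nm_update_paddr _ _ _ _ (by omega) hxw',
        pr_update _ _ (by omega) (by omega), if_pos ⟨rfl, rfl⟩]
    have hHC : ∀ j ≤ L, ∀ y, y + 2 ^ j ≤ wd L → HC L σ.mem j y →
        HC L (Function.update σ.mem (paddr L a b) (σ.reg 50)) j y := fun j hj y hy h =>
      HC.alloc hT hc.le (by omega) hne hj hy h
    refine ⟨by simp, ⟨?_, ?_, ?_, ?_, ?_, ?_⟩, ?_⟩
    · intro r hr
      simp; grind
    · simpa using hT'.setName (show σ.reg 50 < σ.reg 50 + 1 by omega) hk hxw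
    · simp
    · simpa using fun j hj y hy h => HC.setName hk hx hpr j hj y hy (hHC j hj y hy h)
    · intro a' ha
      have := le_naddr L (k + 1) x
      have := le_paddr L a b
      simp only [State.setMem_mem, State.setReg_mem]
      rw [Function.update_of_ne (by omega), Function.update_of_ne (by omega)]
    · intro y hy
      simp [nm_update _ _ hxw hy, nm_update_paddr _ _ _ _ (Nat.zero_le L) hy]
    · simpa using fun h1 h2 => HC.of_setName hk hx hpr (by omega)
        (hHC k (by omega) x (by omega) h1) (hHC k (by omega) _ (by omega) h2)

/-- Compute the names of the blocks of length `reg[8]` at all `x` congruent to `reg[7]`. -/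
def rebuildProg : Prog :=
  asg 30 (reg 8 + 0);; asg 31 (reg 7 + 0);;
  whl (lt (reg 31 + reg 30) (reg 4 + 1)) (nodeProg;; asg 31 (reg 31 + reg 30))

theorem rebuildProg_run {L m w k r : ℕ} {σ : State} (hE : Env L m w σ) (hk : k + 1 ≤ L)
    (h8 : σ.reg 8 = 2 ^ (k + 1)) (h7 : σ.reg 7 = r) (hr : r < 2 ^ (k + 1))
    (hT : Tab L σ.mem (σ.reg 50)) (hc : σ.reg 50 + (100 * 2 ^ (L - k) + 50) ≤ bb L)
    (hH : ∀ x, x % 2 ^ k = r % 2 ^ k → x + 2 ^ k ≤ wd L → HC L σ.mem k x) :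
    Run w rebuildProg σ fun t σ' => t ≤ 100 * 2 ^ (L - k) + 50 ∧
      Upd L 30 (100 * 2 ^ (L - k) + 50) σ σ' ∧
      ∀ x, x % 2 ^ (k + 1) = r → x + 2 ^ (k + 1) ≤ wd L → HC L σ'.mem (k + 1) x := by
  obtain ⟨p1, p2, p3⟩ := pow_facts (show k ≤ L by omega)
  have p4 : 2 ^ (k + 1) = 2 * 2 ^ k := by ring
  have hB := wd_lt_bb L
  have hV := hE.word
  have hw0 := hE.word_ne
  have hbb : 0 ≤ bb L * bb L := Nat.zero_le _
  have q1 := hE.r4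
  have p5 : 2 ^ (k + 1) ≤ 2 ^ L := Nat.pow_le_pow_right (by norm_num) hk
  -- The window has length `2 ^ (L + 1)`, so a residue class modulo `2 ^ (k + 1)` meets it in `2 ^
  -- (L - k)` points.
  have hJ : wd L = 2 ^ (L - k) * 2 ^ (k + 1) := by
    rw [← pow_add, show L - k + (k + 1) = L + 1 by omega]; unfold wd; ring
  set J := 2 ^ (L - k) with hJdef
  set H := 2 ^ (k + 1) with hHdef
  refine Run.seq (Run.asgv H ?_ ?_ ?_ rfl)
  · simp [h8]
  · simp [h8]; omega
  refine Run.seq (Run.asgv r ?_ ?_ ?_ rfl)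
  · simp [h7]
  · simp [h7]; omega
  set σ₁ := (σ.setReg 30 H).setReg 31 r with hσ₁
  refine Run.whl (fun (j : ℕ) σ' => σ'.reg 31 = r + j * H ∧ σ'.reg 30 = H ∧ j ≤ J ∧
      Upd L 30 (100 * j) σ σ' ∧ ∀ i < j, r + i * H + H ≤ wd L → HC L σ'.mem (k + 1) (r + i * H))
    (fun j => (J - j) * 100) 0 rfl ?_ ?_ ?_ ?_
  · refine ⟨by simp [hσ₁], by simp [hσ₁], Nat.zero_le _, ?_, by simp⟩
    refine Upd.of_mem_eq hT rfl ?_ ?_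
    · intro r hr
      simp [hσ₁]; grind
    · simp [hσ₁]
  · rintro j σ' ⟨g1, g2, g3, g4, g5⟩
    have := hE.congr (by norm_num) g4.frame
    have h4 := this.r4
    have : j * H ≤ wd L := by rw [hJ]; exact Nat.mul_le_mul_right _ g3
    simp [g1, g2, h4, hw0]
    omega
  · rintro j σ' ⟨g1, g2, g3, g4, g5⟩ hcond
    have hE' := hE.congr (by norm_num) g4.frame
    have h4 := hE'.r4
    have hx : r + j * H + H ≤ wd L := by
      simp [g1, g2, h4] at hcond; omega
    have hj : j < J := by
      rw [hJ] at hx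
      by_contra hcon
      have := Nat.mul_le_mul_right H (not_lt.1 hcon)
      omega
    have hmod : (r + j * H) % 2 ^ k = r % 2 ^ k := by
      rw [p4, show r + j * (2 * 2 ^ k) = r + (2 * j) * 2 ^ k by ring]
      exact Nat.add_mul_mod_self_right _ _ _
    have hcnt := g4.cnt
    refine Run.seq ((nodeProg_run (x := r + j * H) hE' hk g2 g1 hx g4.tab (by omega)).mono ?_)
    rintro t σ₂ ⟨t2, u2, c2⟩
    refine Run.asgv (r + (j + 1) * H) ?_ ?_ ?_ rfl
    · simp [u2.frame, g1, g2]; ring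
    · simp [u2.frame, g1, g2]; omega
    have hu : Upd L 30 (100 * j + t) σ (σ₂.setReg 31 (r + (j + 1) * H)) := by
      have := g4.trans (u2.anti (n' := 30) (by norm_num))
      refine this.trans (Upd.of_mem_eq (σ' := σ₂.setReg 31 (r + (j + 1) * H)) this.tab rfl
        (fun q hq => ?_) (by simp))
      simp; omega
    refine ⟨j + 1, ⟨?_, ?_, hj, hu.mono le_rfl (by omega), ?_⟩, ?_⟩
    · simp
    · simp [u2.frame, g2]
    · intro i hi hx'
      simp only [State.setReg_mem]
      rcases Nat.lt_succ_iff_lt_or_eq.1 hi with hi | rfl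
      · exact u2.hc _ hk _ (by omega) (g5 i hi hx')
      · refine c2 (g4.hc _ (by omega) _ (by omega) (hH _ hmod (by omega)))
          (g4.hc _ (by omega) _ (by omega) (hH _ ?_ (by omega)))
        rw [Nat.add_mod_right, hmod]
    · simp
      have : (J - j) = (J - (j + 1)) + 1 := by omega
      rw [this, add_mul]; omega
  · rintro j σ' t ⟨g1, g2, g3, g4, g5⟩ hcond ht
    simp at ht
    have hE' := hE.congr (by norm_num) g4.frame
    have h4 := hE'.r4
    have hx : wd L < r + j * H + H := by
      simp [g1, g2, h4] at hcond; omega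
    refine ⟨by simp; omega, g4.mono le_rfl (by omega), ?_⟩
    intro x hx1 hx2
    have hx3 : x = r + x / H * H := by
      conv_lhs => rw [← Nat.mod_add_div x H, hx1]
      ring
    rw [hx3] at hx2 ⊢
    refine g5 _ ?_ hx2
    by_contra hcon
    have := Nat.mul_le_mul_right H (not_lt.1 hcon)
    omega

/-! ### Keeping names up to date under insertion of letters -/

/-- The blocks of length `2 ^ j` that are kept up to date while the shift is `s`. -/
def Cl (s j x : ℕ) : Prop := x % 2 ^ j = 0 ∨ x % 2 ^ j = s % 2 ^ j

/-- The kept blocks are closed under halving, so the names needed to rename a kept block are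
themselves kept. -/
theorem Cl.child {s j x : ℕ} (h : Cl s (j + 1) x) : Cl s j x ∧ Cl s j (x + 2 ^ j) := by
  have hd : 2 ^ j ∣ 2 ^ (j + 1) := pow_dvd_pow _ (by omega)
  have : Cl s j x := by
    rcases h with h | h
    · left; rw [← Nat.mod_mod_of_dvd x hd, h, Nat.zero_mod]
    · right; rw [← Nat.mod_mod_of_dvd x hd, h, Nat.mod_mod_of_dvd s hd]
  refine ⟨this, ?_⟩
  unfold Cl
  rw [Nat.add_mod_right]
  exact this

/-- Recompute the name of the block of length `reg[17]` that contains `reg[16]` and starts at a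
number congruent to `reg[18]`. -/
def fixProg : Prog :=
  cnd (lt (reg 18) (reg 16 + 1))
    (asg 30 (reg 17 + 0);; asg 31 (reg 16 - (reg 16 - reg 18) % reg 17);;
      cnd (lt (reg 31 + reg 30) (reg 4 + 1)) nodeProg .skip)
    .skip

theorem fixProg_run {L m w k y c : ℕ} {σ : State} (hE : Env L m w σ) (hk : k + 1 ≤ L)
    (h17 : σ.reg 17 = 2 ^ (k + 1)) (h16 : σ.reg 16 = y) (h18 : σ.reg 18 = c)
    (hc : c < 2 ^ (k + 1)) (hy : y < wd L)
    (hT : Tab L σ.mem (σ.reg 50)) (hcn : σ.reg 50 < bb L) :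
    Run w fixProg σ fun t σ' => t ≤ 150 ∧ Upd L 30 150 σ σ' ∧
      ∀ x, x % 2 ^ (k + 1) = c → x ≤ y → y < x + 2 ^ (k + 1) → x + 2 ^ (k + 1) ≤ wd L →
        HC L σ.mem k x → HC L σ.mem k (x + 2 ^ k) → HC L σ'.mem (k + 1) x := by
  have hB := wd_lt_bb L
  have hV := hE.word
  have hw0 := hE.word_ne
  have hbb : 0 ≤ bb L * bb L := Nat.zero_le _
  have q1 := hE.r4
  obtain ⟨-, p2, p3⟩ := pow_facts hk
  have hrefl : Upd L 30 150 σ σ :=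
    (Upd.of_mem_eq hT rfl (fun _ _ => rfl) rfl).mono le_rfl (by norm_num)
  set H := 2 ^ (k + 1) with hHdef
  have hxc : ∀ x, x % H = c → c ≤ x := fun x h => h ▸ Nat.mod_le _ _
  refine Run.cnd rfl ?_ ?_ ?_
  · simp [h16, hw0]; omega
  · intro hcy
    replace hcy : c ≤ y := by simp [h16, h18] at hcy; omega
    have hmod : (y - c) % H < H := Nat.mod_lt _ (by omega)
    have hmle : (y - c) % H ≤ y - c := Nat.mod_le _ _
    refine Run.seq (Run.asgv H ?_ ?_ ?_ rfl)
    · simp [h17]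
    · simp [h17]; omega
    refine Run.seq (Run.asgv (y - (y - c) % H) ?_ ?_ ?_ rfl)
    · simp [h17, h16, h18]
    · simp [h17, h16, h18]; omega
    have hu : Upd L 30 0 σ ((σ.setReg 30 H).setReg 31 (y - (y - c) % H)) := by
      refine Upd.of_mem_eq hT rfl ?_ (by simp)
      intro r hr
      simp; grind
    -- Starts in the class of `c` are `H` apart, so at most one block of the class contains `y`.
    have hx0 : ∀ x, x % H = c → x ≤ y → y < x + H → x = y - (y - c) % H := by
      intro x hx h1 h2
      have h3 := hxc x hx
      have h4 : H ∣ x - c := by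
        rw [← hx]; exact Nat.dvd_sub_mod x
      obtain ⟨q, hq⟩ := h4
      have : (y - c) % H = y - x := by
        rw [show y - c = (y - x) + H * q by omega, Nat.add_mul_mod_self_left,
          Nat.mod_eq_of_lt (by omega)]
      omega
    refine Run.cnd rfl ?_ ?_ ?_
    · simp [q1, hw0]; omega
    · intro hcond
      have hx : y - (y - c) % H + H ≤ wd L := by simp [q1] at hcond; omega
      refine (nodeProg_run (hE.congr (by norm_num) hu.frame) hk (by simp [hHdef]) rfl ?_ hu.tab
        ?_).mono ?_
      · simpa using hx
      · simpa using hcn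
      rintro t σ₂ ⟨t2, u2, c2⟩
      refine ⟨by simp; omega, (hu.trans (u2.anti (n' := 30) (by norm_num))).mono le_rfl
        (by omega), ?_⟩
      intro x h1 h2 h3 h4 h5 h6
      have := hx0 x h1 h2 h3
      simp only [State.setReg_reg, State.setReg_mem, if_true, ← this] at c2
      exact c2 h5 h6
    · intro hcond
      have hx : wd L < y - (y - c) % H + H := by simp [q1] at hcond; omega
      refine Run.skip ⟨by simp, hu.mono le_rfl (by norm_num), ?_⟩
      intro x h1 h2 h3 h4
      have := hx0 x h1 h2 h3
      omega
  · intro hcy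
    replace hcy : y < c := by simp [h16, h18] at hcy; omega
    refine Run.skip ⟨by simp, hrefl, ?_⟩
    intro x h1 h2
    have := hxc x h1
    omega

/-- The names of all blocks that matter for the shift `s` are up to date. -/
def DS (L s : ℕ) (f : ℕ → ℕ) : Prop :=
  ∀ j ≤ L, ∀ x, x + 2 ^ j ≤ wd L → Cl s j x → HC L f j x

/-- Put the letter `1` at position `reg[16]`, for the shift `reg[7]`. -/
def insertAtProg : Prog :=
  sto (3 * reg 5 + reg 4 + reg 16) 1;;
  asg 17 2;;
  whl (lt (reg 17) (reg 3 + 1))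
    (asg 18 0;; fixProg;; asg 18 (reg 7 % reg 17);; fixProg;; asg 17 (reg 17 * 2))

/-- The effect of code that, in time `t` and for the shift `s`, puts the letter `1` at the positions
in `p`, changing only registers from `n` on. -/
structure Ins (L n t s : ℕ) (p : ℕ → Prop) [DecidablePred p] (σ σ' : State) : Prop where
  frame : ∀ r < n, σ'.reg r = σ.reg r
  tab : Tab L σ'.mem (σ'.reg 50)
  cnt : σ'.reg 50 ≤ σ.reg 50 + t
  ds : DS L s σ'.mem
  low : ∀ a < 3 * bb L, σ'.mem a = σ.mem a
  leaf : ∀ y < wd L, nm L σ'.mem 0 y = if p y then 1 else nm L σ.mem 0 y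

/-- Per level, one block of the class of `0` and one of the class of `s` can contain `y`. Renaming
them from the bottom up repairs all kept blocks. -/
theorem insertAtProg_run {L m w y s : ℕ} {σ : State} (hE : Env L m w σ)
    (h16 : σ.reg 16 = y) (h7 : σ.reg 7 = s) (hy : y < wd L) (hs : s < 2 ^ L)
    (hT : Tab L σ.mem (σ.reg 50)) (hD : DS L s σ.mem) (hcn : σ.reg 50 + 400 * (L + 1) ≤ bb L) :
    Run w insertAtProg σ fun t σ' => t ≤ 400 * (L + 1) ∧ Ins L 17 (400 * (L + 1)) s (· = y) σ σ' := by
  have hB := wd_lt_bb L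
  have hV := hE.word
  have hw0 := hE.word_ne
  have hbb : 0 ≤ bb L * bb L := Nat.zero_le _
  have q1 := hE.r4
  have q2 := hE.r5
  obtain ⟨-, -, p3⟩ := pow_facts (le_refl L)
  have hL : 1 ≤ L := by
    rcases Nat.eq_zero_or_pos L with rfl | h
    · have := hE.m_pos; have := hE.m_le; simp at *; omega
    · exact h
  have h2 := hT.two_le
  set f := Function.update σ.mem (naddr L 0 y) 1 with hf
  have hT' : Tab L f (σ.reg 50) := hT.setName (by omega) (by omega) hy
  have hleaf : ∀ z < wd L, nm L f 0 z = if z = y then 1 else nm L σ.mem 0 z := by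
    intro z hz
    rw [hf, nm_update _ _ hy hz]; simp
  have hHC0 : ∀ j ≤ L, ∀ x, x + 2 ^ j ≤ wd L → Cl s j x → y < x ∨ x + 2 ^ j ≤ y → HC L f j x :=
    fun j hj x hx hcl hxy => HC.setLeaf hT (by omega) hy hj hx hxy (hD j hj x hx hcl)
  refine Run.seq (Run.stov (naddr L 0 y) 1 ?_ ?_ ?_ ?_ ?_ rfl)
  · simp [q1, q2, h16, naddr]
  · simp
  · simp [q1, q2, h16]; omega
  · simp [hw0]
  refine Run.seq (Run.asgv 2 ?_ ?_ ?_ rfl)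
  · simp
  · change 2 < 2 ^ w; omega
  set σ₁ := (σ.setMem (naddr L 0 y) 1).setReg 17 2 with hσ₁
  have hm1 : σ₁.mem = f := rfl
  have hr1 : ∀ r < 17, σ₁.reg r = σ.reg r := by
    intro r hr
    simp [hσ₁]; grind
  have h50 : σ₁.reg 50 = σ.reg 50 := by simp [hσ₁]
  -- After `k` rounds the kept blocks up to level `k` are correct, and above that level those that
  -- avoid `y`.
  refine Run.whl (fun (k : ℕ) σ' => σ'.reg 17 = 2 ^ (k + 1) ∧ k ≤ L ∧ Upd L 17 (330 * k) σ₁ σ' ∧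
      ∀ j ≤ L, ∀ x, x + 2 ^ j ≤ wd L → Cl s j x → (j ≤ k ∨ y < x ∨ x + 2 ^ j ≤ y) →
        HC L σ'.mem j x) (fun k => (L - k) * 330) 0 rfl ?_ ?_ ?_ ?_
  · refine ⟨by simp [hσ₁], Nat.zero_le _, Upd.of_mem_eq (by rw [hm1, h50]; exact hT') rfl
      (fun _ _ => rfl) rfl, ?_⟩
    rintro j hj x hx hcl (hj0 | hxy)
    · obtain rfl : j = 0 := by omega
      trivial
    · exact hHC0 j hj x hx hcl hxy
  · rintro k σ' ⟨g1, g2, g3, g4⟩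
    have q3 : σ'.reg 3 = 2 ^ L := by rw [g3.frame 3 (by norm_num), hr1 3 (by norm_num), hE.r3]
    simp [q3, hw0]; omega
  · rintro k σ' ⟨g1, g2, g3, g4⟩ hcond
    have hE' : Env L m w σ' := hE.congr (n := 17) (by norm_num)
      fun r hr => (g3.frame r hr).trans (hr1 r hr)
    have q3 := hE'.r3
    have hkL : k + 1 ≤ L := by
      simp [g1, q3] at hcond
      exact (Nat.pow_le_pow_iff_right (a := 2) (by norm_num)).1 (by omega)
    have k2 : 2 ^ (k + 1 + 1) = 2 ^ (k + 1) * 2 := by ring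
    obtain ⟨p1, p2, -⟩ := pow_facts hkL
    have f7 : σ'.reg 7 = s := by rw [g3.frame 7 (by norm_num), hr1 7 (by norm_num), h7]
    have f16 : σ'.reg 16 = y := by rw [g3.frame 16 (by norm_num), hr1 16 (by norm_num), h16]
    have hcnt := g3.cnt
    have hkL' : 330 * k + 330 ≤ 330 * L := by omega
    refine Run.seq (Run.asgv 0 ?_ ?_ ?_ rfl)
    · simp
    · simp
    have u0 : Upd L 17 0 σ' (σ'.setReg 18 0) := by
      refine Upd.of_mem_eq g3.tab rfl (fun r hr => ?_) (by simp)
      simp; omega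
    refine Run.seq ((fixProg_run (y := y) (c := 0) (hE'.congr (by norm_num) u0.frame) hkL
      (by simp [g1]) (by simp [f16]) (by simp) (by positivity) hy u0.tab (by simp; omega)).mono ?_)
    rintro t₁ σ₂ ⟨t1, u1, c1⟩
    have hE2 := hE'.congr (n := 17) (by norm_num)
      (u0.trans (u1.anti (n' := 17) (by norm_num))).frame
    have hcnt1 := u1.cnt
    simp at hcnt1
    have hf2 : ∀ r < 30, r ≠ 18 → σ₂.reg r = σ'.reg r := by
      intro r hr hr'
      rw [u1.frame r hr]; simp [hr']
    refine Run.seq (Run.asgv (s % 2 ^ (k + 1)) ?_ ?_ ?_ rfl)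
    · simp [hf2, f7, g1]
    · have := Nat.mod_lt s (show 0 < 2 ^ (k + 1) by positivity)
      simp [hf2, f7, g1]; omega
    have u3 : Upd L 17 0 σ₂ (σ₂.setReg 18 (s % 2 ^ (k + 1))) := by
      refine Upd.of_mem_eq u1.tab rfl (fun r hr => ?_) (by simp)
      simp; omega
    refine Run.seq ((fixProg_run (y := y) (c := s % 2 ^ (k + 1)) (hE2.congr (by norm_num) u3.frame)
      hkL (by simp [hf2, g1]) (by simp [hf2, f16]) (by simp) (Nat.mod_lt _ (by positivity)) hy
      u3.tab (by simp; omega)).mono ?_)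
    rintro t₃ σ₃ ⟨t3, u4, c2⟩
    have f17 : σ₃.reg 17 = 2 ^ (k + 1) := by
      rw [u4.frame 17 (by norm_num)]; simp [hf2, g1]
    refine Run.asgv (2 ^ (k + 1 + 1)) ?_ ?_ ?_ rfl
    · simp [f17, k2]
    · simp [f17]; omega
    have u5 : Upd L 17 (0 + 150 + (0 + 150) + 0) σ' (σ₃.setReg 17 (2 ^ (k + 1 + 1))) := by
      have h1 := (u0.trans (u1.anti (n' := 17) (by norm_num))).trans
        (u3.trans (u4.anti (n' := 17) (by norm_num)))
      refine h1.trans (t' := 0) (Upd.of_mem_eq (n := 17) u4.tab rfl (fun r hr => ?_) (by simp))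
      rw [State.setReg_reg, if_neg (by omega)]
    refine ⟨k + 1, ⟨by simp, hkL, (g3.trans u5).mono le_rfl (by omega), ?_⟩, ?_⟩
    · intro j hj x hx hcl hxy
      by_cases hold : j ≤ k ∨ y < x ∨ x + 2 ^ j ≤ y
      · exact u5.hc j hj x hx (g4 j hj x hx hcl hold)
      · obtain rfl : j = k + 1 := by omega
        have hp : 2 ^ (k + 1) = 2 ^ k + 2 ^ k := by ring
        have h3 := g4 k (by omega) x (by omega) hcl.child.1 (Or.inl le_rfl)
        have h4 := g4 k (by omega) (x + 2 ^ k) (by omega) hcl.child.2 (Or.inl le_rfl)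
        simp only [State.setReg_mem] at c1 c2 ⊢
        rcases hcl with hcl | hcl
        · exact u4.hc _ hj _ hx (c1 x hcl (by omega) (by omega) hx h3 h4)
        · exact c2 x hcl (by omega) (by omega) hx (u1.hc _ (by omega) _ (by omega) h3)
            (u1.hc _ (by omega) _ (by omega) h4)
    · have : L - k = L - (k + 1) + 1 := by omega
      simp [this, add_mul]; omega
  · rintro k σ' t ⟨g1, g2, g3, g4⟩ hcond ht
    have q3 : σ'.reg 3 = 2 ^ L := by rw [g3.frame 3 (by norm_num), hr1 3 (by norm_num), hE.r3]
    have hkL : L ≤ k := by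
      simp [g1, q3] at hcond
      have := (Nat.pow_lt_pow_iff_right (a := 2) (by norm_num)).1 (Nat.lt_of_succ_le hcond)
      omega
    obtain rfl : k = L := by omega
    simp at ht
    have hcnt := g3.cnt
    refine ⟨by simp; omega, ⟨?_, g3.tab, by omega, ?_, ?_, ?_⟩⟩
    · intro r hr
      rw [g3.frame r hr, hr1 r hr]
    · exact fun j hj x hx hcl => g4 j hj x hx hcl (Or.inl hj)
    · intro a ha
      rw [g3.low a ha, hm1, hf, Function.update_of_ne]
      have := le_naddr k 0 y
      omega
    · intro z hz
      rw [g3.leaf z hz, hm1, hleaf z hz]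

/-- Put the letter `1` at all positions congruent to `reg[15]`, for the shift `reg[7]`. -/
def insertProg : Prog :=
  asg 16 (reg 15 + 0);; whl (lt (reg 16) (reg 4)) (insertAtProg;; asg 16 (reg 16 + reg 0))

theorem insertProg_run {L m w y s : ℕ} {σ : State} (hE : Env L m w σ)
    (h15 : σ.reg 15 = y) (h7 : σ.reg 7 = s) (hy : y < m) (hs : s < 2 ^ L)
    (hT : Tab L σ.mem (σ.reg 50)) (hD : DS L s σ.mem) (hcn : σ.reg 50 + 1700 * (L + 1) ≤ bb L) :
    Run w insertProg σ fun t σ' => t ≤ 1700 * (L + 1) ∧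
      Ins L 16 (1700 * (L + 1)) s (fun z => z % m = y) σ σ' := by
  have hB := wd_lt_bb L
  have hV := hE.word
  have hw0 := hE.word_ne
  have hbb : 0 ≤ bb L * bb L := Nat.zero_le _
  obtain ⟨-, -, p3⟩ := pow_facts (le_refl L)
  have b1 := hE.m_le
  have b2 := hE.le_m
  refine Run.seq (Run.asgv y ?_ ?_ ?_ rfl)
  · simp [h15]
  · simp [h15]; omega
  refine Run.whl (fun (j : ℕ) σ' => σ'.reg 16 = y + j * m ∧ j ≤ 4 ∧
      Ins L 16 (410 * (L + 1) * j) s (fun z => z % m = y ∧ z < y + j * m) σ σ')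
    (fun j => (4 - j) * (410 * (L + 1))) 0 rfl ?_ ?_ ?_ ?_
  · refine ⟨by simp, by omega, ⟨?_, by simpa using hT, by simp, by simpa using hD, by simp, ?_⟩⟩
    · intro r hr
      simp; omega
    · intro z hz
      have : ¬ (z % m = y ∧ z < y + 0 * m) := by
        rintro ⟨rfl, h⟩
        have := Nat.mod_le z m
        omega
      simp only [this, if_false]
      rfl
  · rintro j σ' ⟨g1, g2, g3⟩
    simp [hw0]
  · rintro j σ' ⟨g1, g2, g3⟩ hcond
    have hE' := hE.congr (by norm_num) g3.frame
    have hx : y + j * m < wd L := by simp [g1, hE'.r4] at hcond; omega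
    -- The window is shorter than `4 * m`, because `2 ^ L < 2 * m`; so a residue has at most four
    -- positions in it.
    have hj : j < 4 := by
      by_contra hcon
      have : j * m = 4 * m := by rw [show j = 4 by omega]
      omega
    have hcnt := g3.cnt
    have : 410 * (L + 1) * j ≤ 410 * (L + 1) * 3 := Nat.mul_le_mul_left _ (by omega)
    refine Run.seq ((insertAtProg_run hE' g1 (by rw [g3.frame 7 (by norm_num), h7]) hx hs g3.tab
      g3.ds (by omega)).mono ?_)
    rintro t σ₂ ⟨t2, u2⟩
    have f0 : σ₂.reg 0 = m := by rw [u2.frame 0 (by norm_num), hE'.r0]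
    have f16 : σ₂.reg 16 = y + j * m := by rw [u2.frame 16 (by norm_num), g1]
    refine Run.asgv (y + (j + 1) * m) ?_ ?_ ?_ rfl
    · simp [f0, f16]; ring
    · simp [f0, f16]; omega
    have hcnt2 := u2.cnt
    refine ⟨j + 1, ⟨by simp, hj, ⟨?_, ?_, ?_, ?_, ?_, ?_⟩⟩, ?_⟩
    · intro r hr
      rw [← g3.frame r hr, ← u2.frame r (by omega)]
      simp; omega
    · simpa using u2.tab
    · rw [State.setReg_reg, if_neg (by norm_num),
        show 410 * (L + 1) * (j + 1) = 410 * (L + 1) * j + 410 * (L + 1) by ring]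
      omega
    · simpa using u2.ds
    · intro a ha
      rw [← g3.low a ha, ← u2.low a ha]; rfl
    · intro z hz
      simp only [State.setReg_mem]
      rw [u2.leaf z hz, g3.leaf z hz]
      have key : (z % m = y ∧ z < y + (j + 1) * m) ↔
          z = y + j * m ∨ (z % m = y ∧ z < y + j * m) := by
        constructor
        · rintro ⟨h1, h2⟩
          have h3 := Nat.mod_add_div z m
          rw [h1] at h3
          have h4 : z / m < j + 1 := by
            by_contra hcon
            have := Nat.mul_le_mul_left m (not_lt.1 hcon)
            rw [mul_comm (j + 1) m] at h2
            omega
          rcases Nat.lt_succ_iff_lt_or_eq.1 h4 with h5 | h5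
          · right
            refine ⟨h1, ?_⟩
            have := Nat.mul_lt_mul_of_pos_left h5 (show 0 < m by omega)
            rw [mul_comm j m]
            omega
          · left; rw [← h5, mul_comm]; exact h3.symm
        · rintro (h | ⟨h1, h2⟩)
          · refine ⟨?_, ?_⟩
            · rw [h, Nat.add_mul_mod_self_right, Nat.mod_eq_of_lt hy]
            · rw [h, add_mul]; omega
          · refine ⟨h1, ?_⟩
            rw [add_mul]; omega
      simp only [key]
      by_cases h1 : z = y + j * m <;> simp [h1]
    · have : 4 - j = 4 - (j + 1) + 1 := by omega
      simp [this, add_mul]; omega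
  · rintro j σ' t ⟨g1, g2, g3⟩ hcond ht
    have hE' := hE.congr (by norm_num) g3.frame
    have hx : wd L ≤ y + j * m := by simp [g1, hE'.r4] at hcond; omega
    have hcnt := g3.cnt
    have : 410 * (L + 1) * j ≤ 410 * (L + 1) * 4 := Nat.mul_le_mul_left _ (by omega)
    simp at ht
    refine ⟨by simp; omega, ⟨g3.frame, g3.tab, by omega, g3.ds, g3.low, ?_⟩⟩
    intro z hz
    rw [g3.leaf z hz]
    have : z < y + j * m := by omega
    simp [this]

/-! ### Counting positions with a property and searching for them by bisection -/

open Classical in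
/-- The number of elements of `[x, x + 2 ^ k)` with the property `P`. -/
noncomputable def mc (P : ℕ → Prop) : ℕ → ℕ → ℕ
  | 0, x => if P x then 1 else 0
  | k + 1, x => mc P k x + mc P k (x + 2 ^ k)

theorem mc_eq_zero_iff (P : ℕ → Prop) (k : ℕ) :
    ∀ x, mc P k x = 0 ↔ ∀ i < 2 ^ k, ¬ P (x + i) := by
  induction k with
  | zero => intro x; simp [mc]
  | succ k ih =>
    intro x
    have hk' : 2 ^ (k + 1) = 2 ^ k + 2 ^ k := by ring
    simp only [mc, Nat.add_eq_zero_iff, ih]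
    constructor
    · rintro ⟨h1, h2⟩ i hi
      by_cases hik : i < 2 ^ k
      · exact h1 i hik
      · have := h2 (i - 2 ^ k) (by omega)
        rwa [show x + 2 ^ k + (i - 2 ^ k) = x + i by omega] at this
    · intro h
      refine ⟨fun i hi => h i (by omega), fun i hi => ?_⟩
      rw [add_assoc]
      exact h _ (by omega)

open Classical in
theorem mc_eq_card (P : ℕ → Prop) (k : ℕ) :
    ∀ x, mc P k x = ((Finset.Ico x (x + 2 ^ k)).filter P).card := by
  induction k with
  | zero => intro x; simp [mc, Finset.filter_singleton]; split_ifs <;> simp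
  | succ k ih =>
    intro x
    rw [mc, ih, ih, ← Finset.card_union_of_disjoint, ← Finset.filter_union,
      Finset.Ico_union_Ico_eq_Ico (Nat.le_add_right _ _) (Nat.le_add_right _ _), add_assoc,
      ← two_mul, ← pow_succ']
    exact Finset.disjoint_filter_filter (Finset.Ico_disjoint_Ico_consecutive _ _ _)

theorem mc_le (P : ℕ → Prop) (k x : ℕ) : mc P k x ≤ 2 ^ k := by
  classical
  rw [mc_eq_card]
  exact (Finset.card_filter_le _ _).trans (by simp)

/-- The list `[p]`, or the empty list if the block `p` has no element with the property `P`. -/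
noncomputable def pushed (P : ℕ → Prop) (p : ℕ × ℕ) : List (ℕ × ℕ) :=
  if mc P p.1 p.2 = 0 then [] else [p]

/-- The weight of a list of blocks that are still to be processed. -/
noncomputable def weight (P : ℕ → Prop) (l : List (ℕ × ℕ)) : ℕ :=
  (l.map fun p => (p.1 + 1) * mc P p.1 p.2).sum

/-- The state of the breadth-first search for the numbers below `2 ^ L` with the property `P`:
`d` lists the processed blocks and `t` those to be processed. -/
structure Search (P : ℕ → Prop) (L : ℕ) (d t : List (ℕ × ℕ)) : Prop where
  valid : ∀ p ∈ d ++ t, p.1 ≤ L ∧ 2 ^ p.1 ∣ p.2 ∧ p.2 + 2 ^ p.1 ≤ 2 ^ L ∧ mc P p.1 p.2 ≠ 0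
  closed : ∀ k x, (k + 1, x) ∈ d → ∀ y, (y = x ∨ y = x + 2 ^ k) → mc P k y ≠ 0 → (k, y) ∈ d ++ t
  root : mc P L 0 ≠ 0 → (L, 0) ∈ d ++ t
  pot : d.length + weight P t ≤ (L + 1) * mc P L 0

theorem mem_pushed {P : ℕ → Prop} {p q : ℕ × ℕ} : q ∈ pushed P p ↔ q = p ∧ mc P p.1 p.2 ≠ 0 := by
  unfold pushed
  split_ifs with h <;> simp [h]

theorem weight_append (P : ℕ → Prop) (l l' : List (ℕ × ℕ)) :
    weight P (l ++ l') = weight P l + weight P l' := by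
  simp [weight]

theorem weight_cons (P : ℕ → Prop) (p : ℕ × ℕ) (l : List (ℕ × ℕ)) :
    weight P (p :: l) = (p.1 + 1) * mc P p.1 p.2 + weight P l := by
  simp [weight]

theorem weight_pushed (P : ℕ → Prop) (p : ℕ × ℕ) :
    weight P (pushed P p) = (p.1 + 1) * mc P p.1 p.2 := by
  unfold pushed
  split_ifs with h <;> simp [weight, h]

theorem Search.init (P : ℕ → Prop) (L : ℕ) : Search P L [] (pushed P (L, 0)) where
  valid p hp := by
    rw [List.nil_append, mem_pushed] at hp
    obtain ⟨rfl, h⟩ := hp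
    simpa using h
  closed k x h := by simp at h
  root h := by rw [List.nil_append, mem_pushed]; exact ⟨rfl, h⟩
  pot := by rw [weight_pushed]; simp

theorem Search.step_leaf {P : ℕ → Prop} {L x : ℕ} {d t : List (ℕ × ℕ)}
    (h : Search P L d ((0, x) :: t)) : Search P L (d ++ [(0, x)]) t where
  valid p hp := h.valid p (by simpa using hp)
  closed k y hy z hz hz' := by
    have := h.closed k y (by simpa using hy) z hz hz'
    simpa using this
  root h' := by simpa using h.root h'
  pot := by
    have h1 := h.pot
    have h2 := (h.valid (0, x) (by simp)).2.2.2
    rw [weight_cons] at h1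
    simp at h1 h2 ⊢
    omega

/-- A block of level `k` weighs `k + 1` for each of its good positions. Passing to the halves lowers
the weight by the number of good positions, which is at least one and pays for the processed block.
-/
theorem Search.step_node {P : ℕ → Prop} {L k x : ℕ} {d t : List (ℕ × ℕ)}
    (h : Search P L d ((k + 1, x) :: t)) :
    Search P L (d ++ [(k + 1, x)]) (t ++ pushed P (k, x) ++ pushed P (k, x + 2 ^ k)) where
  valid p hp := by
    obtain ⟨h1, h2, h3, h4⟩ := h.valid (k + 1, x) (by simp)
    have hk' : 2 ^ (k + 1) = 2 ^ k + 2 ^ k := by ring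
    have hd : 2 ^ k ∣ x := (pow_dvd_pow 2 (Nat.le_succ k)).trans h2
    simp only at h1 h3
    have hp' : p ∈ d ++ (k + 1, x) :: t ∨ p ∈ pushed P (k, x) ∨ p ∈ pushed P (k, x + 2 ^ k) := by
      simp only [List.mem_append, List.mem_cons] at hp ⊢
      simp only [List.not_mem_nil, or_false] at hp
      tauto
    rcases hp' with hp | hp | hp
    · exact h.valid p hp
    · rw [mem_pushed] at hp
      obtain ⟨rfl, hne⟩ := hp
      exact ⟨by simp; omega, hd, by simp; omega, hne⟩
    · rw [mem_pushed] at hp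
      obtain ⟨rfl, hne⟩ := hp
      exact ⟨by simp; omega, (Nat.dvd_add_right hd).2 dvd_rfl, by simp; omega, hne⟩
  closed j y hy z hz hz' := by
    rw [List.mem_append, List.mem_singleton] at hy
    rcases hy with hy | hy
    · have := h.closed j y hy z hz hz'
      simp only [List.mem_append, List.mem_cons, List.not_mem_nil, or_false] at this ⊢
      tauto
    · simp only [Prod.mk.injEq, Nat.add_right_cancel_iff] at hy
      obtain ⟨rfl, rfl⟩ := hy
      simp only [List.mem_append, mem_pushed]
      rcases hz with rfl | rfl
      · exact Or.inr (Or.inl (Or.inr ⟨rfl, hz'⟩))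
      · exact Or.inr (Or.inr ⟨rfl, hz'⟩)
  root h' := by
    have := h.root h'
    simp only [List.mem_append, List.mem_cons, List.not_mem_nil, or_false] at this ⊢
    tauto
  pot := by
    have h1 := h.pot
    have h2 := (h.valid (k + 1, x) (by simp)).2.2.2
    rw [weight_cons] at h1
    rw [weight_append, weight_append, weight_pushed, weight_pushed]
    simp only [mc, List.length_append, List.length_singleton] at h1 h2 ⊢
    nlinarith [Nat.one_le_iff_ne_zero.2 h2]

theorem Search.length_le {P : ℕ → Prop} {L : ℕ} {d t : List (ℕ × ℕ)} (h : Search P L d t) :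
    (d ++ t).length ≤ (L + 1) * mc P L 0 := by
  have h1 : t.length ≤ weight P t := by
    have h2 : ∀ p ∈ t, mc P p.1 p.2 ≠ 0 := fun p hp => (h.valid p (by simp [hp])).2.2.2
    clear h
    induction t with
    | nil => simp
    | cons p t ih =>
      rw [weight_cons, List.length_cons]
      have := ih fun q hq => h2 q (by simp [hq])
      have := Nat.one_le_iff_ne_zero.2 (h2 p (by simp))
      nlinarith
  have := h.pot
  rw [List.length_append]
  omega

/-- All blocks containing a good position `p` are nonempty, so the path from the root down to `p`
has been processed. -/
theorem Search.complete {P : ℕ → Prop} {L : ℕ} {d : List (ℕ × ℕ)} (h : Search P L d [])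
    {p : ℕ} (hp : p < 2 ^ L) (hP : P p) : (0, p) ∈ d := by
  -- The block of level `L - j` that contains `p`.
  have key : ∀ j ≤ L, (L - j, 2 ^ (L - j) * (p / 2 ^ (L - j))) ∈ d := by
    intro j
    induction j with
    | zero =>
      intro _
      rw [Nat.sub_zero, Nat.div_eq_of_lt hp, mul_zero]
      have := h.root fun h0 => (mc_eq_zero_iff P L 0).1 h0 p hp (by simpa using hP)
      simpa using this
    | succ j ih =>
      intro hj
      obtain ⟨k, hk⟩ : ∃ k, L - (j + 1) = k := ⟨_, rfl⟩
      have hk' : L - j = k + 1 := by omega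
      have h1 := ih (by omega)
      rw [hk'] at h1
      rw [hk]
      have h0 := Nat.two_pow_pos k
      have hdiv : p / 2 ^ (k + 1) = p / 2 ^ k / 2 := by rw [pow_succ, Nat.div_div_eq_div_mul]
      have hlt := Nat.mod_lt p h0
      have hmd := Nat.mod_add_div p (2 ^ k)
      have := h.closed k _ h1 (2 ^ k * (p / 2 ^ k)) ?_ ?_
      · simpa using this
      · rw [hdiv, pow_succ]
        rcases Nat.mod_two_eq_zero_or_one (p / 2 ^ k) with h2 | h2
        · left
          rw [mul_assoc]; congr 1; omega
        · right
          have : p / 2 ^ k = 2 * (p / 2 ^ k / 2) + 1 := by omega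
          conv_lhs => rw [this]
          ring
      · intro h2
        refine (mc_eq_zero_iff P k _).1 h2 (p % 2 ^ k) hlt ?_
        rwa [add_comm, hmd]
  have := key L le_rfl
  simpa using this

/-! ### The search on the machine -/

/-- The code of a block in the queue. -/
def enc (L : ℕ) (p : ℕ × ℕ) : ℕ := 2 ^ p.1 * wd L + p.2

/-- The queue holds the list `l`. -/
structure QRep (L : ℕ) (σ : State) (l : List (ℕ × ℕ)) : Prop where
  tail : σ.reg 11 = l.length
  mem : ∀ i p, l[i]? = some p → σ.mem (2 * bb L + i) = enc L p

/-- Append the block `reg[14]` to the queue unless it matches the block shifted by `reg[7]`. -/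
def tryPushProg : Prog :=
  cnd (eq (load (3 * reg 5 + reg 14)) (load (3 * reg 5 + reg 14 + reg 7))) .skip
    (sto (2 * reg 5 + reg 11) (reg 14);; asg 11 (reg 11 + 1))

/-- The effect of code that only changes the queue and the registers in `p`. -/
structure QUpd (L : ℕ) (p : ℕ → Prop) (σ σ' : State) : Prop where
  frame : ∀ r, ¬ p r → σ'.reg r = σ.reg r
  mem : ∀ a, a < 2 * bb L ∨ 3 * bb L ≤ a → σ'.mem a = σ.mem a

theorem QUpd.trans {L : ℕ} {p : ℕ → Prop} {σ σ' σ'' : State} (h : QUpd L p σ σ')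
    (h' : QUpd L p σ' σ'') : QUpd L p σ σ'' where
  frame r hr := (h'.frame r hr).trans (h.frame r hr)
  mem a ha := (h'.mem a ha).trans (h.mem a ha)

theorem QUpd.nm {L : ℕ} {p : ℕ → Prop} {σ σ' : State} (h : QUpd L p σ σ') (k x : ℕ) :
    nm L σ'.mem k x = nm L σ.mem k x := h.mem _ (Or.inr (le_naddr _ _ _))

theorem QUpd.pr {L : ℕ} {p : ℕ → Prop} {σ σ' : State} (h : QUpd L p σ σ') (a b : ℕ) :
    pr L σ'.mem a b = pr L σ.mem a b :=
  h.mem _ (Or.inr (by have := le_paddr L a b; omega))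

theorem tryPushProg_run {L m w k x s c : ℕ} {P : ℕ → Prop} {σ : State} {l : List (ℕ × ℕ)}
    (hE : Env L m w σ) (h14 : σ.reg 14 = enc L (k, x)) (h7 : σ.reg 7 = s) (hk : k ≤ L)
    (hx : x + 2 ^ k ≤ 2 ^ L) (hs : s < 2 ^ L) (hd : 2 ^ k ∣ x) (hT : Tab L σ.mem c)
    (hc : c ≤ bb L) (hD : DS L s σ.mem)
    (hP : ∀ y < 2 ^ L, P y ↔ nm L σ.mem 0 y ≠ nm L σ.mem 0 (y + s))
    (hl : l.length < bb L) (hQ : QRep L σ l) :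
    Run w tryPushProg σ fun t σ' => t ≤ 40 ∧ QUpd L (· = 11) σ σ' ∧
      QRep L σ' (l ++ pushed P (k, x)) := by
  have hB := wd_lt_bb L
  have hV := hE.word
  have hw0 := hE.word_ne
  have hbb : 0 ≤ bb L * bb L := Nat.zero_le _
  have q2 := hE.r5
  obtain ⟨p0, -, p3⟩ := pow_facts hk
  have e1 := naddr_lt hk (show x < wd L by omega)
  have e2 := naddr_lt hk (show x + s < wd L by omega)
  have hE1 : 3 * bb L + enc L (k, x) = naddr L k x := by unfold enc naddr; simp; ring
  have hE2 : 3 * bb L + enc L (k, x) + s = naddr L k (x + s) := by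
    rw [hE1]; unfold naddr; ring
  -- Both blocks are kept: one starts at a multiple of its length, the other at a number congruent
  -- to `s`. Their names therefore decide equality of the words.
  have hiff : nm L σ.mem k x = nm L σ.mem k (x + s) ↔ mc P k x = 0 := by
    rw [nm_eq_iff hT hc k hk x (x + s) (by omega) (by omega), mc_eq_zero_iff]
    · refine forall₂_congr fun i hi => ?_
      rw [hP _ (by omega), not_not, show x + s + i = x + i + s by ring]
    · exact hD k hk x (by omega) (Or.inl (Nat.mod_eq_zero_of_dvd hd))
    · refine hD k hk _ (by omega) (Or.inr ?_)
      rw [Nat.add_mod, Nat.mod_eq_zero_of_dvd hd, zero_add, Nat.mod_mod]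
  refine Run.cnd rfl ?_ ?_ ?_
  · simp [q2, h14, h7, hw0]; omega
  · intro h
    replace h : nm L σ.mem k x = nm L σ.mem k (x + s) := by
      simp only [eval_eq, eval_load, eval_add, eval_mul, eval_reg, eval_ofNat, q2, h14, h7] at h
      rw [hE2, hE1] at h
      change (if nm L σ.mem k x = nm L σ.mem k (x + s) then 1 else 0) ≠ 0 at h
      by_contra hcon
      exact h (if_neg hcon)
    refine Run.skip ⟨by simp, ⟨fun _ _ => rfl, fun _ _ => rfl⟩, ?_⟩
    unfold pushed
    rw [if_pos (hiff.1 h), List.append_nil]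
    exact hQ
  · intro h
    replace h : nm L σ.mem k x ≠ nm L σ.mem k (x + s) := by
      simp only [eval_eq, eval_load, eval_add, eval_mul, eval_reg, eval_ofNat, q2, h14, h7] at h
      rw [hE2, hE1] at h
      change (if nm L σ.mem k x = nm L σ.mem k (x + s) then 1 else 0) = 0 at h
      intro hcon
      rw [if_pos hcon] at h
      omega
    refine Run.seq (Run.stov (2 * bb L + l.length) (enc L (k, x)) ?_ ?_ ?_ ?_ ?_ rfl)
    · simp [q2, hQ.tail]
    · simp [h14]
    · simp [q2, hQ.tail]; omega
    · simp
    refine Run.asgv (l.length + 1) ?_ ?_ ?_ rfl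
    · simp [hQ.tail]
    · simp [hQ.tail, hw0]; omega
    refine ⟨by simp, ⟨?_, ?_⟩, ?_, ?_⟩
    · intro r hr
      simp; omega
    · intro a ha
      simp only [State.setReg_mem, State.setMem_mem]
      rw [Function.update_of_ne (by omega)]
    · unfold pushed
      rw [if_neg fun h0 => h (hiff.2 h0)]
      simp
    · intro i p hi
      unfold pushed at hi
      rw [if_neg fun h0 => h (hiff.2 h0)] at hi
      simp only [State.setReg_mem, State.setMem_mem]
      by_cases hil : i < l.length
      · rw [Function.update_of_ne (by omega)]
        rw [List.getElem?_append_left hil] at hi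
        exact hQ.mem i p hi
      · rw [List.getElem?_append_right (by omega), List.getElem?_singleton] at hi
        split_ifs at hi with h0
        obtain rfl : i = l.length := by omega
        simp at hi
        simp [hi]

theorem DS.congr {L s c : ℕ} {f f' : ℕ → ℕ} (hT : Tab L f c) (hc : c ≤ bb L) (h : DS L s f)
    (hn : ∀ k x, nm L f' k x = nm L f k x) (hp : ∀ a b, pr L f' a b = pr L f a b) :
    DS L s f' := fun j hj x hx hcl =>
  HC.congr hT hc (fun a _ b _ _ => hp a b) j hj x hx (fun k _ y _ _ => hn k y) (h j hj x hx hcl)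

theorem Tab.congr {L c : ℕ} {f f' : ℕ → ℕ} (hT : Tab L f c)
    (hn : ∀ k x, nm L f' k x = nm L f k x) (hp : ∀ a b, pr L f' a b = pr L f a b) :
    Tab L f' c where
  two_le := hT.two_le
  nm_lt k hk x hx := by rw [hn]; exact hT.nm_lt k hk x hx
  pr_lt a ha b hb := by rw [hp]; exact hT.pr_lt a ha b hb
  inj a ha b hb a' ha' b' hb' := by rw [hp, hp]; exact hT.inj a ha b hb a' ha' b' hb'

theorem enc_div {L k x : ℕ} (hx : x < wd L) : enc L (k, x) / wd L = 2 ^ k := by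
  unfold enc
  rw [mul_comm, Nat.mul_add_div (by omega), Nat.div_eq_of_lt hx, add_zero]

theorem enc_mod {L k x : ℕ} (hx : x < wd L) : enc L (k, x) % wd L = x := by
  unfold enc
  rw [mul_comm, Nat.mul_add_mod, Nat.mod_eq_of_lt hx]

theorem enc_lt {L k x : ℕ} (hk : k ≤ L) (hx : x < wd L) : enc L (k, x) < bb L := by
  have h1 := pow_mul_wd_lt hk hx
  have h2 := wd_sq_le L
  unfold enc
  simp only
  omega

/-- Fill the queue with the dyadic blocks that differ from the blocks shifted by `reg[7]`. -/
def searchProg : Prog :=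
  asg 10 0;; asg 11 0;; asg 14 (reg 3 * reg 4);; tryPushProg;;
  whl (lt (reg 10) (reg 11))
    (asg 12 (load (2 * reg 5 + reg 10));; asg 10 (reg 10 + 1);;
      cnd (lt (reg 12) (reg 4 + reg 4)) .skip
        (asg 13 (reg 12 / reg 4 / 2);; asg 14 (reg 13 * reg 4 + reg 12 % reg 4);; tryPushProg;;
          asg 14 (reg 14 + reg 13);; tryPushProg))

set_option maxHeartbeats 1000000 in
-- The loop simulates `Search`, and the weight of the waiting blocks serves as its potential. Names
-- and letters do not change here, so all comparisons refer to the same set.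
theorem searchProg_run {L m w s c : ℕ} {P : ℕ → Prop} {σ : State}
    (hE : Env L m w σ) (h7 : σ.reg 7 = s) (hs : s < 2 ^ L) (hT : Tab L σ.mem c)
    (hc : c ≤ bb L) (hD : DS L s σ.mem)
    (hP : ∀ y < 2 ^ L, P y ↔ nm L σ.mem 0 y ≠ nm L σ.mem 0 (y + s)) :
    Run w searchProg σ fun t σ' => t ≤ 200 * ((L + 1) * mc P L 0 + 1) ∧
      QUpd L (fun r => 10 ≤ r ∧ r < 20) σ σ' ∧ ∃ l, Search P L l [] ∧ QRep L σ' l := by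
  have hB := wd_lt_bb L
  have hB' := wd_sq_le L
  have hV := hE.word
  have hw0 := hE.word_ne
  have hbb : 0 ≤ bb L * bb L := Nat.zero_le _
  obtain ⟨-, -, p3⟩ := pow_facts (le_refl L)
  -- The queue then has fewer than `bb L` entries and does not run into the names.
  have hlenb : (L + 1) * mc P L 0 ≤ wd L * wd L := by
    have h1 := mc_le P L 0
    have h2 : L < 2 ^ L := Nat.lt_two_pow_self
    exact Nat.mul_le_mul (by omega) (by omega)
  have hww : 4 ≤ wd L * wd L := Nat.mul_le_mul (wd_ge L) (wd_ge L)
  have keep : ∀ σ', QUpd L (fun r => 10 ≤ r ∧ r < 20) σ σ' → Env L m w σ' ∧ σ'.reg 7 = s ∧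
      Tab L σ'.mem c ∧ DS L s σ'.mem ∧
      ∀ y < 2 ^ L, P y ↔ nm L σ'.mem 0 y ≠ nm L σ'.mem 0 (y + s) := by
    intro σ' h
    refine ⟨hE.congr (n := 10) (by norm_num) fun r hr => h.frame r (by omega),
      (h.frame 7 (by norm_num)).trans h7, hT.congr h.nm h.pr, hD.congr hT hc h.nm h.pr, ?_⟩
    intro y hy
    rw [h.nm, h.nm]
    exact hP y hy
  have weak : ∀ σ₁ σ₂, QUpd L (· = 11) σ₁ σ₂ → QUpd L (fun r => 10 ≤ r ∧ r < 20) σ₁ σ₂ :=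
    fun _ _ h => ⟨fun r hr => h.frame r (by omega), h.mem⟩
  have hset : ∀ σ₁ : State, ∀ r v, 10 ≤ r → r < 20 →
      QUpd L (fun r => 10 ≤ r ∧ r < 20) σ₁ (σ₁.setReg r v) := by
    intro σ₁ r v h1 h2
    refine ⟨fun r' hr' => ?_, fun _ _ => rfl⟩
    rw [State.setReg_reg, if_neg]
    rintro rfl
    exact hr' ⟨h1, h2⟩
  refine Run.seq (Run.asgv 0 ?_ ?_ ?_ rfl)
  · simp
  · simp
  refine Run.seq (Run.asgv 0 ?_ ?_ ?_ rfl)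
  · simp
  · simp
  refine Run.seq (Run.asgv (enc L (L, 0)) ?_ ?_ ?_ rfl)
  · simp [hE.r3, hE.r4, enc]
  · have := enc_lt (le_refl L) (show 0 < wd L by have := wd_ge L; omega)
    simp [enc] at this
    simp [hE.r3, hE.r4]; omega
  have u1 := ((hset σ 10 0 (by norm_num) (by norm_num)).trans
    (hset _ 11 0 (by norm_num) (by norm_num))).trans
    (hset _ 14 (enc L (L, 0)) (by norm_num) (by norm_num))
  obtain ⟨k1, k2, k3, k4, k5⟩ := keep _ u1
  refine Run.seq ((tryPushProg_run (P := P) (l := []) (k := L) (x := 0) k1 (by simp) k2 le_rfl (by simp) hs (by simp) k3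
    hc k4 k5 (by simp; omega) ⟨by simp, by simp⟩).mono ?_)
  rintro t₁ σ₁ ⟨t1, v1, r1⟩
  refine Run.whl (fun (g : List (ℕ × ℕ) × List (ℕ × ℕ)) σ' => Search P L g.1 g.2 ∧
      QUpd L (fun r => 10 ≤ r ∧ r < 20) σ σ' ∧ QRep L σ' (g.1 ++ g.2) ∧ σ'.reg 10 = g.1.length)
    (fun g => 160 * weight P g.2) ([], pushed P (L, 0)) rfl ?_ ?_ ?_ ?_
  · refine ⟨Search.init P L, u1.trans (weak _ _ v1), by simpa using r1, ?_⟩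
    rw [v1.frame 10 (by norm_num)]; simp
  · rintro g σ' -
    simp [hw0]
  · rintro ⟨d, t⟩ σ' ⟨g1, g2, g3, g4⟩ hcond
    simp only at g1 g3 g4
    have hlen := g1.length_le
    have hlen' : d.length < (d ++ t).length := by
      rw [eval_lt, eval_reg, eval_reg, g4, g3.tail] at hcond
      by_contra hcon
      exact hcond (if_neg hcon)
    obtain ⟨⟨k, x⟩, t, rfl⟩ : ∃ p t', t = p :: t' := by
      cases t with
      | nil => simp at hlen'
      | cons p t' => exact ⟨p, t', rfl⟩
    obtain ⟨f1, f2, f3, f4⟩ := g1.valid (k, x) (by simp)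
    simp only at f1 f2 f3 f4
    obtain ⟨l1, l2, l3, l4, l5⟩ := keep _ g2
    have hk0 := Nat.two_pow_pos k
    have hxw : x < wd L := by omega
    have henc := enc_lt f1 hxw
    have hmem : σ'.mem (2 * bb L + d.length) = enc L (k, x) := g3.mem _ _ (by simp)
    refine Run.seq (Run.asgv (enc L (k, x)) ?_ ?_ ?_ rfl)
    · simp [l1.r5, g4, hmem]
    · simp [l1.r5, g4]; omega
    refine Run.seq (Run.asgv (d.length + 1) ?_ ?_ ?_ rfl)
    · simp [g4]
    · simp [g4, hw0]; omega
    have u2 := (g2.trans (hset _ 12 (enc L (k, x)) (by norm_num) (by norm_num))).trans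
      (hset _ 10 (d.length + 1) (by norm_num) (by norm_num))
    obtain ⟨l1', l2', l3', l4', l5'⟩ := keep _ u2
    have hq2 : QRep L ((σ'.setReg 12 (enc L (k, x))).setReg 10 (d.length + 1))
        (d ++ (k, x) :: t) := ⟨by simpa using g3.tail, by simpa using g3.mem⟩
    refine Run.cnd rfl ?_ ?_ ?_
    · simp [l1.r4, hw0]; omega
    · intro hcase
      -- The code is `2 ^ k * wd L + x`, which is below `2 * wd L` only for single positions.
      have hk : k = 0 := by
        simp [l1.r4, enc] at hcase
        by_contra hk
        have : 2 ^ 1 ≤ 2 ^ k := Nat.pow_le_pow_right (by norm_num) (by omega)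
        have := Nat.mul_le_mul_right (wd L) this
        omega
      subst hk
      refine Run.skip ⟨(d ++ [(0, x)], t), ⟨g1.step_leaf, u2, by simpa using hq2, by simp⟩, ?_⟩
      have := Nat.one_le_iff_ne_zero.2 f4
      simp [weight_cons]
      omega
    · intro hcase
      obtain ⟨k, rfl⟩ : ∃ k', k = k' + 1 := by
        cases k with
        | zero => simp [l1.r4, enc] at hcase; omega
        | succ k => exact ⟨k, rfl⟩
      have hkk : 2 ^ (k + 1) = 2 ^ k + 2 ^ k := by ring
      have hk0' := Nat.two_pow_pos k
      have hd : 2 ^ k ∣ x := (pow_dvd_pow 2 (Nat.le_succ k)).trans f2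
      have henc1 := enc_lt (show k ≤ L by omega) hxw
      have henc2 := enc_lt (show k ≤ L by omega) (show x + 2 ^ k < wd L by omega)
      refine Run.seq (Run.asgv (2 ^ k) ?_ ?_ ?_ rfl)
      · simp [l1.r4, enc_div hxw]; omega
      · simp [l1.r4, enc_div hxw]; omega
      refine Run.seq (Run.asgv (enc L (k, x)) ?_ ?_ ?_ rfl)
      · simp [l1.r4, enc_mod hxw]; simp [enc]
      · simp only [enc] at henc1
        simp [l1.r4, enc_mod hxw]; omega
      have u3 := (u2.trans (hset _ 13 (2 ^ k) (by norm_num) (by norm_num))).trans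
        (hset _ 14 (enc L (k, x)) (by norm_num) (by norm_num))
      obtain ⟨m1, m2, m3, m4, m5⟩ := keep _ u3
      refine Run.seq ((tryPushProg_run (P := P) (l := d ++ (k + 1, x) :: t) m1 (by simp) m2
        (by omega) (show x + 2 ^ k ≤ 2 ^ L by omega) hs hd m3 hc m4 m5 (by omega)
        ⟨by simpa using g3.tail, by simpa using g3.mem⟩).mono ?_)
      rintro t₂ σ₂ ⟨t2, v2, r2⟩
      have hpl : ∀ p, (pushed P p).length ≤ 1 := by
        intro p; unfold pushed; split_ifs <;> simp
      have hpl1 := hpl (k, x)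
      refine Run.seq (Run.asgv (enc L (k, x + 2 ^ k)) ?_ ?_ ?_ rfl)
      · simp [v2.frame, enc]; ring
      · simp [v2.frame]
        simp only [enc] at henc2 ⊢
        omega
      have u4 := (u3.trans (weak _ _ v2)).trans
        (hset _ 14 (enc L (k, x + 2 ^ k)) (by norm_num) (by norm_num))
      obtain ⟨n1, n2, n3, n4, n5⟩ := keep _ u4
      refine ((tryPushProg_run (P := P) (l := d ++ (k + 1, x) :: t ++ pushed P (k, x)) n1 (by simp)
        n2 (by omega) (show x + 2 ^ k + 2 ^ k ≤ 2 ^ L by omega) hs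
        ((Nat.dvd_add_right hd).2 dvd_rfl) n3 hc n4 n5 (by rw [List.length_append]; omega)
        ⟨by simpa using r2.tail, by simpa using r2.mem⟩).mono ?_)
      rintro t₃ σ₃ ⟨t3, v3, r3⟩
      refine ⟨(d ++ [(k + 1, x)], t ++ pushed P (k, x) ++ pushed P (k, x + 2 ^ k)),
        ⟨g1.step_node, u4.trans (weak _ _ v3), by simpa using r3, ?_⟩, ?_⟩
      · rw [v3.frame 10 (by norm_num)]
        simp [v2.frame]
      · have := Nat.one_le_iff_ne_zero.2 f4
        simp only [weight_append, weight_pushed, weight_cons]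
        simp only [mc] at this ⊢
        simp
        nlinarith
  · rintro ⟨d, t⟩ σ' t' ⟨g1, g2, g3, g4⟩ hcond ht
    simp only at g1 g3 g4
    obtain rfl : t = [] := by
      simp [g4, g3.tail] at hcond
      exact hcond
    have hpot := (Search.init P L).pot
    simp only [List.length_nil, zero_add] at hpot
    refine ⟨?_, g2, d, g1, by simpa using g3⟩
    generalize (L + 1) * mc P L 0 = M at hpot ⊢
    generalize weight P (pushed P (L, 0)) = M' at hpot ht
    simp at ht ⊢
    omega

/-! ### Adding a translate to the set of sums -/

/-- The letters of the window form the periodic characteristic word of `A`. -/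
def LeafRep (L : ℕ) {m : ℕ} (f : ℕ → ℕ) (A : Finset (ZMod m)) : Prop :=
  ∀ y < wd L, nm L f 0 y = if (y : ZMod m) ∈ A then 1 else 0

/-- The union of `A` and its translate by `s`. -/
def addShift {m : ℕ} (A : Finset (ZMod m)) (s : ℕ) : Finset (ZMod m) :=
  A ∪ A.image (· + (s : ZMod m))

theorem mem_addShift {m : ℕ} {A : Finset (ZMod m)} {s : ℕ} {z : ZMod m} :
    z ∈ addShift A s ↔ z ∈ A ∨ z - s ∈ A := by
  simp only [addShift, Finset.mem_union, Finset.mem_image]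
  refine or_congr Iff.rfl ⟨?_, fun h => ⟨_, h, by ring⟩⟩
  rintro ⟨a, ha, rfl⟩
  simpa using ha

theorem subset_addShift {m : ℕ} (A : Finset (ZMod m)) (s : ℕ) : A ⊆ addShift A s :=
  Finset.subset_union_left

/-- The positions at which the words of `A` and of its translate differ. -/
def Diff {m : ℕ} (A : Finset (ZMod m)) (s x : ℕ) : Prop :=
  ¬ ((x : ZMod m) ∈ A ↔ ((x + s : ℕ) : ZMod m) ∈ A)

/-- Translation is a bijection, so as many residues leave `A` under `z ↦ z + s` as enter it, and the
former give the new elements. One factor 2 counts both kinds of difference; the other counts the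
representatives of a residue below `2 ^ L`. -/
theorem mc_diff_le {m L : ℕ} (hm : 0 < m) (hL : 2 ^ L < 2 * m) (A : Finset (ZMod m)) (s : ℕ) :
    mc (Diff A s) L 0 ≤ 4 * ((addShift A s).card - A.card) := by
  classical
  have : NeZero m := ⟨hm.ne'⟩
  set X := Finset.univ.filter fun z : ZMod m => z ∈ A ∧ z + s ∉ A with hX
  set Y := Finset.univ.filter fun z : ZMod m => z ∉ A ∧ z + s ∈ A with hY
  set Z := Finset.univ.filter fun z : ZMod m => z ∈ A ∧ z + s ∈ A with hZ
  have hXZ : X.card + Z.card = A.card := by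
    rw [← Finset.card_union_of_disjoint]
    · congr 1; ext z; simp [hX, hZ]; tauto
    · rw [Finset.disjoint_left]; intro z; simp [hX, hZ]; tauto
  -- `Y` and `Z` together are the preimage of `A` under translation by `s`.
  have hYZ : Y.card + Z.card = A.card := by
    rw [← Finset.card_union_of_disjoint]
    · refine Finset.card_bij (fun z _ => z + s) ?_ ?_ ?_
      · intro z; simp [hY, hZ]; tauto
      · intro z _ z' _ h; simpa using h
      · intro z hz
        refine ⟨z - s, ?_, by ring⟩
        simp [hY, hZ]; tauto
    · rw [Finset.disjoint_left]; intro z; simp [hY, hZ]; tauto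
  have hX' : X.card + A.card = (addShift A s).card := by
    have h1 : addShift A s = X.image (· + (s : ZMod m)) ∪ A := by
      ext z
      simp only [mem_addShift, Finset.mem_union, Finset.mem_image, hX, Finset.mem_filter,
        Finset.mem_univ, true_and]
      constructor
      · intro h
        by_cases hz : z ∈ A
        · exact Or.inr hz
        · refine Or.inl ⟨z - s, ⟨by tauto, by simpa using hz⟩, by ring⟩
      · rintro (⟨a, ⟨ha, -⟩, rfl⟩ | h)
        · right; simpa using ha
        · exact Or.inl h
    rw [h1, Finset.card_union_of_disjoint, Finset.card_image_of_injective _ (add_left_injective _)]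
    rw [Finset.disjoint_left]
    intro z hz
    simp only [Finset.mem_image, hX, Finset.mem_filter, Finset.mem_univ, true_and] at hz
    obtain ⟨a, ⟨-, ha⟩, rfl⟩ := hz
    exact ha
  -- Below `2 ^ L < 2 * m` a residue has at most the two representatives `z.val` and `z.val + m`.
  have hcount : mc (Diff A s) L 0 ≤ 2 * (X ∪ Y).card := by
    rw [mc_eq_card, zero_add]
    have h1 := Finset.card_le_mul_card_image_of_maps_to (t := X ∪ Y)
      (s := (Finset.Ico 0 (2 ^ L)).filter (Diff A s)) (f := fun x : ℕ => (x : ZMod m)) ?_ 2 ?_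
    · exact h1
    · intro x hx
      have hx := (Finset.mem_filter.1 hx).2
      unfold Diff at hx
      push_cast at hx
      simp only [hX, hY, Finset.mem_union, Finset.mem_filter, Finset.mem_univ, true_and]
      tauto
    · intro z _
      refine (Finset.card_le_card (t := {z.val, z.val + m}) ?_).trans Finset.card_le_two
      intro x hx
      simp only [Finset.mem_filter, Finset.mem_Ico] at hx
      obtain ⟨⟨⟨-, hx1⟩, -⟩, rfl⟩ := hx
      rw [ZMod.val_natCast]
      simp only [Finset.mem_insert, Finset.mem_singleton]
      have h2 : x / m < 2 := Nat.div_lt_of_lt_mul (by omega)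
      have h3 := Nat.mod_add_div x m
      interval_cases h : x / m <;> omega
  have h2 := Finset.card_union_le X Y
  omega

/-- Insert the numbers in the queue, shifted by `reg[7]`. -/
def applyProg : Prog :=
  asg 10 0;;
  whl (lt (reg 10) (reg 11))
    (asg 12 (load (2 * reg 5 + reg 10));; asg 10 (reg 10 + 1);;
      cnd (lt (reg 12) (reg 4 + reg 4))
        (asg 15 ((reg 12 - reg 4 + reg 7) % reg 0);;
          cnd (load (3 * reg 5 + reg 4 + reg 15)) .skip insertProg)
        .skip)

/-- The effect of code that, in time `t`, updates the set of letters to `B` for the shift `s`. -/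
structure SetUpd (L n t s : ℕ) {m : ℕ} (B : Finset (ZMod m)) (σ σ' : State) : Prop where
  frame : ∀ r < n, σ'.reg r = σ.reg r
  tab : Tab L σ'.mem (σ'.reg 50)
  cnt : σ'.reg 50 ≤ σ.reg 50 + t
  ds : DS L s σ'.mem
  low : ∀ a < 2 * bb L, σ'.mem a = σ.mem a
  leaf : LeafRep L σ'.mem B

set_option maxHeartbeats 1000000 in
-- A position in the queue yields a new residue only if it lies in `A` and its translate does not.
-- The membership test discards the other kind of difference and repeated representatives, so each
-- new residue is inserted once.
theorem applyProg_run {L m w s : ℕ} {A : Finset (ZMod m)} {σ : State} {l : List (ℕ × ℕ)}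
    (hE : Env L m w σ) (h7 : σ.reg 7 = s) (hs : s < 2 ^ L) (hT : Tab L σ.mem (σ.reg 50))
    (hD : DS L s σ.mem) (hA : LeafRep L σ.mem A) (hl : Search (Diff A s) L l [])
    (hQ : QRep L σ l)
    (hc : σ.reg 50 + 1700 * (L + 1) * ((addShift A s).card - A.card) ≤ bb L) :
    Run w applyProg σ fun t σ' =>
      t ≤ 1700 * (L + 1) * ((addShift A s).card - A.card) + 70 * (l.length + 1) ∧
      SetUpd L 10 (1700 * (L + 1) * ((addShift A s).card - A.card)) s (addShift A s) σ σ' := by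
  have : NeZero m := ⟨by have := hE.m_pos; omega⟩
  have hm := hE.m_pos
  have hB := wd_lt_bb L
  have hB' := wd_sq_le L
  have hV := hE.word
  have hw0 := hE.word_ne
  have hbb : 0 ≤ bb L * bb L := Nat.zero_le _
  obtain ⟨-, -, p3⟩ := pow_facts (le_refl L)
  have b1 := hE.m_le
  have hlen : l.length ≤ wd L * wd L := by
    have h0 := hl.length_le
    rw [List.append_nil] at h0
    have h1 := mc_le (Diff A s) L 0
    have h2 : L < 2 ^ L := Nat.lt_two_pow_self
    exact h0.trans (Nat.mul_le_mul (by omega) (by omega))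
  have hww : 4 ≤ wd L * wd L := Nat.mul_le_mul (wd_ge L) (wd_ge L)
  set B := addShift A s with hBdef
  have hAB : A.card ≤ B.card := Finset.card_le_card (subset_addShift A s)
  refine Run.seq (Run.asgv 0 ?_ ?_ ?_ rfl)
  · simp
  · simp
  -- The ghost state is the number of queue entries read and the current set, which lies between `A`
  -- and `B`. The potential charges a constant per entry and one insertion per residue of `B` still
  -- missing.
  refine Run.whl (fun (g : ℕ × Finset (ZMod m)) σ' => g.1 ≤ l.length ∧ A ⊆ g.2 ∧ g.2 ⊆ B ∧
      σ'.reg 10 = g.1 ∧ σ'.reg 11 = l.length ∧ (∀ r < 10, σ'.reg r = σ.reg r) ∧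
      Tab L σ'.mem (σ'.reg 50) ∧ σ'.reg 50 ≤ σ.reg 50 + 1700 * (L + 1) * (g.2.card - A.card) ∧
      DS L s σ'.mem ∧ (∀ a < 3 * bb L, σ'.mem a = σ.mem a) ∧ LeafRep L σ'.mem g.2 ∧
      ∀ i < g.1, ∀ x, l[i]? = some (0, x) → ((x + s : ℕ) : ZMod m) ∈ g.2)
    (fun g => (l.length - g.1) * 50 + 1700 * (L + 1) * (B.card - g.2.card)) (0, A) rfl ?_ ?_ ?_ ?_
  · refine ⟨Nat.zero_le _, subset_rfl, subset_addShift A s, by simp, by simpa using hQ.tail, ?_,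
      by simpa using hT, by simp, hD, fun _ _ => rfl, hA, by simp⟩
    intro r hr
    rw [State.setReg_reg, if_neg (by omega)]
  · rintro g σ' -
    simp [hw0]
  · rintro ⟨j, A'⟩ σ' ⟨g1, g2, g3, g4, g5, g6, g7, g8, g9, g10, g11, g12⟩ hcond
    simp only at g1 g2 g3 g4 g8 g11 g12
    have hj : j < l.length := by
      rw [eval_lt, eval_reg, eval_reg, g4, g5] at hcond
      by_contra hcon
      exact hcond (if_neg hcon)
    have hE' := hE.congr (by norm_num) g6
    obtain ⟨⟨k, x⟩, hkx⟩ : ∃ p, l[j] = p := ⟨_, rfl⟩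
    have hget : l[j]? = some (k, x) := by rw [List.getElem?_eq_getElem hj, hkx]
    obtain ⟨f1, f2, f3, f4⟩ := hl.valid (k, x) (by rw [← hkx]; simp)
    simp only at f1 f2 f3 f4
    have hk0 := Nat.two_pow_pos k
    have hxw : x < wd L := by omega
    have henc := enc_lt f1 hxw
    have hmem : σ'.mem (2 * bb L + j) = enc L (k, x) := by
      rw [g10 _ (by omega)]
      exact hQ.mem _ _ hget
    have hjl : l.length - j = l.length - (j + 1) + 1 := by omega
    refine Run.seq (Run.asgv (enc L (k, x)) ?_ ?_ ?_ rfl)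
    · simp [hE'.r5, g4, hmem]
    · simp [hE'.r5, g4]; omega
    refine Run.seq (Run.asgv (j + 1) ?_ ?_ ?_ rfl)
    · simp [g4]
    · simp [g4, hw0]; omega
    have hfr : ∀ r < 10, ((σ'.setReg 12 (enc L (k, x))).setReg 10 (j + 1)).reg r = σ.reg r := by
      intro r hr
      rw [State.setReg_reg, if_neg (by omega), State.setReg_reg, if_neg (by omega), g6 r hr]
    refine Run.cnd rfl ?_ ?_ ?_
    · simp [hE'.r4, hw0]; omega
    · intro hcase
      have hk : k = 0 := by
        simp [hE'.r4, enc] at hcase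
        by_contra hk
        have : 2 ^ 1 ≤ 2 ^ k := Nat.pow_le_pow_right (by norm_num) (by omega)
        have := Nat.mul_le_mul_right (wd L) this
        omega
      subst hk
      have he : enc L (0, x) = wd L + x := by simp [enc]
      have hylt : (x + s) % m < m := Nat.mod_lt _ (by omega)
      have hcast : (((x + s) % m : ℕ) : ZMod m) = ((x + s : ℕ) : ZMod m) := by
        rw [ZMod.natCast_mod]
      refine Run.seq (Run.asgv ((x + s) % m) ?_ ?_ ?_ rfl)
      · simp [hE'.r4, hE'.r0, g6, h7, he]
      · simp [hE'.r4, hE'.r0, g6, h7, he]; omega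
      set σ₂ := ((σ'.setReg 12 (enc L (0, x))).setReg 10 (j + 1)).setReg 15 ((x + s) % m) with hσ₂
      have hfr2 : ∀ r < 10, σ₂.reg r = σ.reg r := by
        intro r hr
        rw [hσ₂, State.setReg_reg, if_neg (by omega), hfr r hr]
      have hE2 := hE.congr (by norm_num) hfr2
      have h10 : σ₂.reg 10 = j + 1 := by simp [hσ₂]
      have h11 : σ₂.reg 11 = l.length := by simp [hσ₂, g5]
      have h15 : σ₂.reg 15 = (x + s) % m := by simp [hσ₂]
      have h50 : σ₂.reg 50 = σ'.reg 50 := by simp [hσ₂]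
      have hm2 : σ₂.mem = σ'.mem := rfl
      have hleaf : (load (3 * reg 5 + reg 4 + reg 15)).eval σ₂ =
          if ((x + s : ℕ) : ZMod m) ∈ A' then 1 else 0 := by
        have h1 := g11 ((x + s) % m) (by omega)
        rw [hcast] at h1
        rw [← h1]
        simp [hE2.r5, hE2.r4, h15, hm2, nm, naddr]
      refine Run.cnd rfl ?_ ?_ ?_
      · simp [hE2.r5, hE2.r4, h15]; omega
      · intro hin
        replace hin : ((x + s : ℕ) : ZMod m) ∈ A' := by
          by_contra hcon
          exact hin (by rw [hleaf, if_neg hcon])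
        refine Run.skip ⟨(j + 1, A'), ⟨hj, g2, g3, h10, h11, hfr2, by rwa [h50, hm2],
          by rwa [h50], by rwa [hm2], by rwa [hm2], by rwa [hm2], ?_⟩, ?_⟩
        · intro i hi y hy
          rcases Nat.lt_succ_iff_lt_or_eq.1 hi with hi | rfl
          · exact g12 i hi y hy
          · rw [hget] at hy
            simp at hy
            rwa [← hy]
        · simp only [hjl, add_mul]; simp; omega
      · intro hin
        replace hin : ((x + s : ℕ) : ZMod m) ∉ A' := by
          intro hcon
          rw [hleaf, if_pos hcon] at hin
          omega
        -- The words differ at `x` and `x + s` is not in `A`; hence `x` is in `A`.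
        have hzB : ((x + s : ℕ) : ZMod m) ∈ B := by
          have h1 : Diff A s x := by
            by_contra hcon
            refine f4 ((mc_eq_zero_iff _ _ _).2 ?_)
            intro i hi
            obtain rfl : i = 0 := by simpa using hi
            exact hcon
          have h2 : ((x + s : ℕ) : ZMod m) ∉ A := fun h => hin (g2 h)
          rw [hBdef, mem_addShift]
          right
          unfold Diff at h1
          push_cast at h1 h2 ⊢
          rw [add_sub_cancel_right]
          tauto
        set A'' := insert ((x + s : ℕ) : ZMod m) A' with hA''
        have hcard : A''.card = A'.card + 1 := Finset.card_insert_of_notMem hin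
        have hsub : A'' ⊆ B := Finset.insert_subset hzB g3
        have hcB := Finset.card_le_card hsub
        have hcA := Finset.card_le_card g2
        have e1 : 1700 * (L + 1) * (A''.card - A.card) =
            1700 * (L + 1) * (A'.card - A.card) + 1700 * (L + 1) := by
          rw [hcard, show A'.card + 1 - A.card = A'.card - A.card + 1 by omega]; ring
        have e2 : 1700 * (L + 1) * (B.card - A'.card) =
            1700 * (L + 1) * (B.card - A''.card) + 1700 * (L + 1) := by
          rw [hcard, show B.card - A'.card = B.card - (A'.card + 1) + 1 by omega]; ring
        have e3 : 1700 * (L + 1) * (A''.card - A.card) ≤ 1700 * (L + 1) * (B.card - A.card) :=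
          Nat.mul_le_mul_left _ (by omega)
        refine (insertProg_run (s := s) hE2 h15 (by rw [hfr2 7 (by norm_num), h7]) hylt hs
          (by rwa [h50, hm2]) (by rwa [hm2]) (by rw [h50]; omega)).mono ?_
        rintro t₃ σ₃ ⟨t3, v3⟩
        have hcnt := v3.cnt
        refine ⟨(j + 1, A''), ⟨hj, g2.trans (Finset.subset_insert _ _), hsub, ?_, ?_, ?_, v3.tab,
          ?_, v3.ds, ?_, ?_, ?_⟩, ?_⟩
        · rw [v3.frame 10 (by norm_num), h10]
        · rw [v3.frame 11 (by norm_num), h11]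
        · intro r hr
          rw [v3.frame r (by omega), hfr2 r hr]
        · simp only
          rw [h50] at hcnt
          omega
        · intro a ha
          rw [v3.low a ha, hm2, g10 a ha]
        · intro z hz
          rw [v3.leaf z hz, hm2, g11 z hz]
          have hiff : (z % m = (x + s) % m) ↔ ((z : ℕ) : ZMod m) = ((x + s : ℕ) : ZMod m) :=
            (ZMod.natCast_eq_natCast_iff' _ _ _).symm
          simp only [hiff, hA'', Finset.mem_insert]
          by_cases h1 : (z : ZMod m) = ((x + s : ℕ) : ZMod m)
          · simp [h1]
          · simp only [h1, if_false, false_or]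
        · intro i hi y hy
          rcases Nat.lt_succ_iff_lt_or_eq.1 hi with hi | rfl
          · exact Finset.mem_insert_of_mem (g12 i hi y hy)
          · rw [hget] at hy
            simp at hy
            rw [← hy]
            exact Finset.mem_insert_self _ _
        · simp only [hjl, add_mul, e2]; simp; omega
    · intro hcase
      have hk : k ≠ 0 := by
        rintro rfl
        simp [hE'.r4, enc] at hcase; omega
      refine Run.skip ⟨(j + 1, A'), ⟨hj, g2, g3, by simp, by simpa using g5, hfr, by simpa using g7,
        by simpa using g8, g9, g10, g11, ?_⟩, ?_⟩
      · intro i hi y hy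
        rcases Nat.lt_succ_iff_lt_or_eq.1 hi with hi | rfl
        · exact g12 i hi y hy
        · rw [hget] at hy
          simp at hy
          exact absurd hy.1 hk
      · simp only [hjl, add_mul]; simp; omega
  · rintro ⟨j, A'⟩ σ' t ⟨g1, g2, g3, g4, g5, g6, g7, g8, g9, g10, g11, g12⟩ hcond ht
    simp only at g1 g2 g3 g4 g8 g11 g12
    have hj : j = l.length := by
      rw [eval_lt, eval_reg, eval_reg, g4, g5] at hcond
      by_contra hcon
      rw [if_pos (by omega)] at hcond
      omega
    have hA' : A' = B := by
      refine Finset.Subset.antisymm g3 fun z hz => ?_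
      rw [hBdef, mem_addShift] at hz
      by_cases hzA : z ∈ A
      · exact g2 hzA
      have hzs : z - s ∈ A := by tauto
      set a := (z - (s : ZMod m)).val with ha
      have ha1 : ((a : ℕ) : ZMod m) = z - s := ZMod.natCast_zmod_val _
      have ha2 : a < m := ZMod.val_lt _
      have ha3 : ((a + s : ℕ) : ZMod m) = z := by push_cast; rw [ha1]; ring
      have hP : Diff A s a := by
        unfold Diff
        rw [ha1, ha3]
        tauto
      have h1 := hl.complete (show a < 2 ^ L by omega) hP
      obtain ⟨i, hi, hia⟩ := List.getElem_of_mem h1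
      have := g12 i (by omega) a (by rw [List.getElem?_eq_getElem hi, hia])
      rwa [ha3] at this
    subst hA'
    refine ⟨?_, ⟨g6, g7, g8, g9, fun a ha => g10 a (by omega), g11⟩⟩
    simp at ht ⊢
    omega

/-- Replace the set by its union with its translate by `reg[7]`. -/
def shiftProg : Prog := searchProg;; applyProg

/-- If the set grows by `δ`, the queue has at most `4 * (L + 1) * δ` entries. The search then costs
at most `800 * (L + 1) * δ + 200`, and the insertions at most `1980 * (L + 1) * δ + 70`. -/
theorem shiftProg_run {L m w s : ℕ} {A : Finset (ZMod m)} {σ : State}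
    (hE : Env L m w σ) (h7 : σ.reg 7 = s) (hs : s < 2 ^ L) (hT : Tab L σ.mem (σ.reg 50))
    (hD : DS L s σ.mem) (hA : LeafRep L σ.mem A)
    (hc : σ.reg 50 + 3000 * (L + 1) * ((addShift A s).card - A.card) + 300 ≤ bb L) :
    Run w shiftProg σ fun t σ' =>
      t ≤ 3000 * (L + 1) * ((addShift A s).card - A.card) + 300 ∧
      SetUpd L 10 (3000 * (L + 1) * ((addShift A s).card - A.card) + 300) s (addShift A s) σ σ' := by
  obtain ⟨-, -, p3⟩ := pow_facts (le_refl L)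
  have hmc := mc_diff_le (L := L) (by have := hE.m_pos; omega) hE.le_m A s
  have hmul := Nat.mul_le_mul_left (L + 1) hmc
  have e1 : (L + 1) * (4 * ((addShift A s).card - A.card)) =
    4 * ((L + 1) * ((addShift A s).card - A.card)) := by ring
  have e2 : 3000 * (L + 1) * ((addShift A s).card - A.card) =
    3000 * ((L + 1) * ((addShift A s).card - A.card)) := by ring
  have e3 : 1700 * (L + 1) * ((addShift A s).card - A.card) =
    1700 * ((L + 1) * ((addShift A s).card - A.card)) := by ring
  refine Run.seq ((searchProg_run (P := Diff A s) hE h7 hs hT (by omega) hD ?_).mono ?_)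
  · intro y hy
    rw [hA y (by omega), hA (y + s) (by omega)]
    unfold Diff
    split_ifs <;> simp_all
  rintro t₁ σ₁ ⟨t1, u1, l, hl, hq⟩
  have h50 : σ₁.reg 50 = σ.reg 50 := u1.frame 50 (by norm_num)
  have hlen := hl.length_le
  rw [List.append_nil] at hlen
  have hf : ∀ r < 10, σ₁.reg r = σ.reg r := fun r hr => u1.frame r (by omega)
  refine (applyProg_run (A := A) (hE.congr (by norm_num) hf) ((hf 7 (by norm_num)).trans h7) hs
    (by rw [h50]; exact hT.congr u1.nm u1.pr) (hD.congr hT (by omega) u1.nm u1.pr) ?_ hl hq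
    (by rw [h50]; omega)).mono ?_
  · intro y hy
    rw [u1.nm, hA y hy]
  rintro t₂ σ₂ ⟨t2, u2⟩
  have hcnt := u2.cnt
  refine ⟨by omega, ⟨fun r hr => (u2.frame r hr).trans (hf r hr), u2.tab, by omega, u2.ds, ?_,
    u2.leaf⟩⟩
  intro a ha
  rw [u2.low a ha, u1.mem a (Or.inl ha)]

/-! ### The order of reversed digits and the amortized cost of rebuilding -/

/-- The number whose `k` binary digits are the first `k` of the `L` digits of `i`, reversed. -/
def rv (L i : ℕ) : ℕ → ℕ
  | 0 => 0
  | k + 1 => rv L i k + (i / 2 ^ (L - (k + 1)) % 2) * 2 ^ k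

theorem rv_lt (L i k : ℕ) : rv L i k < 2 ^ k := by
  induction k with
  | zero => simp [rv]
  | succ k ih =>
    have h1 := Nat.mod_lt (i / 2 ^ (L - (k + 1))) (show 0 < 2 by norm_num)
    have h2 : (i / 2 ^ (L - (k + 1)) % 2) * 2 ^ k ≤ 1 * 2 ^ k := Nat.mul_le_mul_right _ (by omega)
    rw [rv, pow_succ]
    omega

theorem rv_succ_mod (L i k : ℕ) : rv L i (k + 1) % 2 ^ k = rv L i k := by
  rw [rv, Nat.add_mul_mod_self_right, Nat.mod_eq_of_lt (rv_lt L i k)]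

theorem rv_mod {L i j k : ℕ} (h : j ≤ k) : rv L i k % 2 ^ j = rv L i j := by
  induction k, h using Nat.le_induction with
  | base => exact Nat.mod_eq_of_lt (rv_lt L i j)
  | succ k hk ih => rw [← Nat.mod_mod_of_dvd _ (pow_dvd_pow 2 hk), rv_succ_mod, ih]

theorem rv_zero (L k : ℕ) : rv L 0 k = 0 := by
  induction k with
  | zero => rfl
  | succ k ih => simp [rv, ih]

/-- The low `k` digits of the shift are the leading `k` digits of `i`, which change from `i - 1` to
`i` only by a carry out of the last `L - k` digits. -/
theorem rv_sub_one {L i k : ℕ} (hi : 0 < i) (hk : k ≤ L) (h : ¬ 2 ^ (L - k) ∣ i) :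
    rv L (i - 1) k = rv L i k := by
  obtain ⟨i, rfl⟩ : ∃ i', i = i' + 1 := ⟨i - 1, by omega⟩
  rw [Nat.add_sub_cancel]
  induction k with
  | zero => rfl
  | succ k ih =>
    have hd : 2 ^ (L - (k + 1)) ∣ 2 ^ (L - k) := pow_dvd_pow 2 (by omega)
    rw [rv, rv, ih (by omega) fun h' => h (hd.trans h'), Nat.succ_div_of_not_dvd h]

theorem rv_inj {L i j : ℕ} (hi : i < 2 ^ L) (hj : j < 2 ^ L) (h : rv L i L = rv L j L) : i = j := by
  have key : ∀ k ≤ L, i / 2 ^ (L - k) = j / 2 ^ (L - k) := by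
    intro k
    induction k with
    | zero => intro _; rw [Nat.sub_zero, Nat.div_eq_of_lt hi, Nat.div_eq_of_lt hj]
    | succ k ih =>
      intro hk
      have h1 := ih (by omega)
      have h2 : rv L i (k + 1) = rv L j (k + 1) := by rw [← rv_mod hk, h, rv_mod hk]
      have h3 : rv L i k = rv L j k := by rw [← rv_succ_mod, h2, rv_succ_mod]
      have h4 : i / 2 ^ (L - (k + 1)) % 2 = j / 2 ^ (L - (k + 1)) % 2 := by
        rw [rv, rv, h3] at h2
        exact Nat.eq_of_mul_eq_mul_right (Nat.two_pow_pos k) (by omega)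
      rw [show L - k = L - (k + 1) + 1 by omega, pow_succ, ← Nat.div_div_eq_div_mul,
        ← Nat.div_div_eq_div_mul] at h1
      omega
  simpa using key L le_rfl

theorem rv_surj {L s : ℕ} (hs : s < 2 ^ L) : ∃ i < 2 ^ L, rv L i L = s := by
  let f : Fin (2 ^ L) → Fin (2 ^ L) := fun i => ⟨rv L i L, rv_lt L i L⟩
  have hf : Function.Injective f := fun i j h => Fin.ext (rv_inj i.2 j.2 (congrArg Fin.val h))
  obtain ⟨i, hi⟩ := Finite.injective_iff_surjective.1 hf ⟨s, hs⟩
  exact ⟨i, i.2, congrArg Fin.val hi⟩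

/-- A bound for the time to update the first `k` levels for the `i`-th shift. -/
def levelCost (L i k : ℕ) : ℕ :=
  ∑ j ∈ Finset.range k, (110 + if 2 ^ (L - (j + 1)) ∣ i then 200 * 2 ^ (L - (j + 1)) else 0)

theorem levelCost_succ (L i k : ℕ) : levelCost L i (k + 1) =
    levelCost L i k + (110 + if 2 ^ (L - (k + 1)) ∣ i then 200 * 2 ^ (L - (k + 1)) else 0) :=
  Finset.sum_range_succ _ _

theorem levelCost_mono (L i : ℕ) {k k' : ℕ} (h : k ≤ k') : levelCost L i k ≤ levelCost L i k' :=
  Finset.sum_le_sum_of_subset (Finset.range_mono h)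

theorem sum_dvd (g n : ℕ) :
    ∑ i ∈ Finset.range (n * g), (if g ∣ i then g else 0) = n * g := by
  induction n with
  | zero => simp
  | succ n ih =>
    have : ∑ x ∈ Finset.range g, (if g ∣ n * g + x then g else 0) = g := by
      rw [Finset.sum_eq_single 0]
      · simp
      · intro x hx hx0
        rw [if_neg]
        intro hd
        have hd := (Nat.dvd_add_right (Dvd.intro_left n rfl)).1 hd
        exact absurd (Nat.le_of_dvd (by omega) hd) (by simpa using hx)
      · simp
    rw [add_mul, one_mul, Finset.sum_range_add, ih, this]

/-- At each level the frequency of rebuilding is the reciprocal of `2 ^ (L - (j + 1))`, a fixed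
multiple of which is its cost. Each level thus contributes `(110 + 200) * 2 ^ L`. -/
theorem sum_levelCost (L : ℕ) :
    ∑ i ∈ Finset.range (2 ^ L), levelCost L i L = 310 * (L * 2 ^ L) := by
  unfold levelCost
  rw [Finset.sum_comm]
  have : ∀ j ∈ Finset.range L, ∑ i ∈ Finset.range (2 ^ L),
      (110 + if 2 ^ (L - (j + 1)) ∣ i then 200 * 2 ^ (L - (j + 1)) else 0) = 310 * 2 ^ L := by
    intro j hj
    have hj := Finset.mem_range.1 hj
    have h1 := sum_dvd (2 ^ (L - (j + 1))) (2 ^ (j + 1))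
    rw [← pow_add, show j + 1 + (L - (j + 1)) = L by omega] at h1
    have h2 : ∀ i, (if 2 ^ (L - (j + 1)) ∣ i then 200 * 2 ^ (L - (j + 1)) else 0) =
        200 * (if 2 ^ (L - (j + 1)) ∣ i then 2 ^ (L - (j + 1)) else 0) := by
      intro i; split_ifs <;> rfl
    simp only [h2]
    rw [Finset.sum_add_distrib, ← Finset.mul_sum, h1]
    simp; ring
  rw [Finset.sum_congr rfl this]
  simp; ring

/-- Compute the shift number `reg[6]` in `reg[7]`, and the names of the blocks that matter for it
from those for the shift before it. -/
def levelsProg : Prog :=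
  asg 7 0;; asg 8 2;; asg 9 (reg 3 / 2);;
  whl (lt (reg 8) (reg 3 + 1))
    (asg 7 (reg 7 + reg 6 / reg 9 % 2 * (reg 8 / 2));;
      cnd (reg 6 % reg 9) .skip rebuildProg;;
      asg 8 (reg 8 * 2);; asg 9 (reg 9 / 2))

set_option maxHeartbeats 1000000 in
-- Levels are treated from the bottom up, so the halves of a block are correct when it is renamed.
-- For `i = 0` every level is rebuilt, which also creates the names of the aligned blocks.
theorem levelsProg_run {L m w i : ℕ} {σ : State} (hE : Env L m w σ) (h6 : σ.reg 6 = i)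
    (hi : i < 2 ^ L) (hT : Tab L σ.mem (σ.reg 50))
    (hD : 0 < i → DS L (rv L (i - 1) L) σ.mem) (hc : σ.reg 50 + levelCost L i L ≤ bb L) :
    Run w levelsProg σ fun t σ' => t ≤ levelCost L i L + 20 ∧ Upd L 7 (levelCost L i L) σ σ' ∧
      σ'.reg 7 = rv L i L ∧ DS L (rv L i L) σ'.mem := by
  have hB := wd_lt_bb L
  have hV := hE.word
  have hw0 := hE.word_ne
  have hbb : 0 ≤ bb L * bb L := Nat.zero_le _
  obtain ⟨p1, -, p3⟩ := pow_facts (le_refl L)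
  refine Run.seq (Run.asgv 0 ?_ ?_ ?_ rfl)
  · simp
  · simp
  refine Run.seq (Run.asgv 2 ?_ ?_ ?_ rfl)
  · simp
  · change 2 < 2 ^ w; omega
  refine Run.seq (Run.asgv (2 ^ L / 2) ?_ ?_ ?_ rfl)
  · simp [hE.r3]
  · simp [hE.r3]; omega
  set σ₁ := ((σ.setReg 7 0).setReg 8 2).setReg 9 (2 ^ L / 2) with hσ₁
  have hu1 : Upd L 7 0 σ σ₁ := by
    refine Upd.of_mem_eq hT rfl (fun r hr => ?_) (by simp [hσ₁])
    rw [hσ₁, State.setReg_reg, if_neg (by omega), State.setReg_reg, if_neg (by omega),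
      State.setReg_reg, if_neg (by omega)]
  refine Run.whl (fun (k : ℕ) σ' => σ'.reg 7 = rv L i k ∧ σ'.reg 8 = 2 ^ (k + 1) ∧
      σ'.reg 9 = 2 ^ L / 2 ^ (k + 1) ∧ k ≤ L ∧ Upd L 7 (levelCost L i k) σ σ' ∧
      ∀ j ≤ k, ∀ x, x + 2 ^ j ≤ wd L → x % 2 ^ j = rv L i j → HC L σ'.mem j x)
    (fun k => levelCost L i L - levelCost L i k) 0 rfl ?_ ?_ ?_ ?_
  · refine ⟨by simp [hσ₁, rv], by simp [hσ₁], by simp [hσ₁], Nat.zero_le _, by simpa [levelCost] using hu1, ?_⟩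
    intro j hj x _ _
    obtain rfl : j = 0 := by omega
    trivial
  · rintro k σ' ⟨g1, g2, g3, g4, g5, g6⟩
    have hE' := hE.congr (by norm_num) g5.frame
    simp [hE'.r3, hw0]; omega
  · rintro k σ' ⟨g1, g2, g3, g4, g5, g6⟩ hcond
    have hE' := hE.congr (by norm_num) g5.frame
    have hkL : k + 1 ≤ L := by
      simp [g2, hE'.r3] at hcond
      exact (Nat.pow_le_pow_iff_right (a := 2) (by norm_num)).1 (by omega)
    obtain ⟨k1, k2, -⟩ := pow_facts hkL
    have hpk : 2 ^ (k + 1) = 2 ^ k * 2 := by ring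
    have hpk2 : 2 ^ (k + 1 + 1) = 2 ^ (k + 1) * 2 := by ring
    have hG : 2 ^ L / 2 ^ (k + 1) = 2 ^ (L - (k + 1)) := Nat.pow_div hkL (by norm_num)
    have hG1 : 2 ^ (L - (k + 1)) ≤ 2 ^ L := Nat.pow_le_pow_right (by norm_num) (by omega)
    have hG2 : 100 * 2 ^ (L - k) = 200 * 2 ^ (L - (k + 1)) := by
      rw [show L - k = L - (k + 1) + 1 by omega, pow_succ]; ring
    rw [hG] at g3
    set G := 2 ^ (L - (k + 1)) with hGdef
    have hG0 : 0 < G := Nat.two_pow_pos _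
    have f6 : σ'.reg 6 = i := by rw [g5.frame 6 (by norm_num), h6]
    have hlc := levelCost_succ L i k
    have hlm := levelCost_mono L i hkL
    have hcnt := g5.cnt
    have hr := rv_lt L i (k + 1)
    have hmod : i / G % 2 < 2 := Nat.mod_lt _ (by norm_num)
    have hdivG : i / G ≤ i := Nat.div_le_self _ _
    have hmul : i / G % 2 * 2 ^ k ≤ 1 * 2 ^ k := Nat.mul_le_mul_right _ (by omega)
    have hrv : rv L i (k + 1) = rv L i k + i / G % 2 * 2 ^ k := rfl
    have hp2 : 2 ^ (k + 1) / 2 = 2 ^ k := by omega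
    refine Run.seq (Run.asgv (rv L i (k + 1)) ?_ ?_ ?_ rfl)
    · simp [g1, g2, g3, f6, hrv, hp2]
    · simp [g1, g2, g3, f6, hp2]; omega
    set σ₂ := σ'.setReg 7 (rv L i (k + 1)) with hσ₂
    have u2 : Upd L 7 0 σ' σ₂ := by
      refine Upd.of_mem_eq g5.tab rfl (fun r hr => ?_) (by simp [hσ₂])
      rw [hσ₂, State.setReg_reg, if_neg (by omega)]
    have f9 : σ₂.reg 9 = G := by simp [hσ₂, g3]
    have f8 : σ₂.reg 8 = 2 ^ (k + 1) := by simp [hσ₂, g2]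
    have f6' : σ₂.reg 6 = i := by simp [hσ₂, f6]
    have hmG : i % G < G := Nat.mod_lt _ hG0
    -- The common end of a round, whether or not the level was rebuilt.
    have finish : ∀ t₃ σ₃, t₃ + 30 ≤ levelCost L i (k + 1) - levelCost L i k →
        Upd L 10 (levelCost L i (k + 1) - levelCost L i k) σ₂ σ₃ →
        (∀ x, x + 2 ^ (k + 1) ≤ wd L → x % 2 ^ (k + 1) = rv L i (k + 1) →
          HC L σ₃.mem (k + 1) x) →
        Run w (asg 8 (reg 8 * 2);; asg 9 (reg 9 / 2)) σ₃ fun t σ₄ => ∃ k',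
          (σ₄.reg 7 = rv L i k' ∧ σ₄.reg 8 = 2 ^ (k' + 1) ∧
            σ₄.reg 9 = 2 ^ L / 2 ^ (k' + 1) ∧ k' ≤ L ∧ Upd L 7 (levelCost L i k') σ σ₄ ∧
            ∀ j ≤ k', ∀ x, x + 2 ^ j ≤ wd L → x % 2 ^ j = rv L i j → HC L σ₄.mem j x) ∧
          (levelCost L i L - levelCost L i k') + t + t₃ + 20 ≤
            levelCost L i L - levelCost L i k := by
      intro t₃ σ₃ t3 u3 c3
      have e8 : σ₃.reg 8 = 2 ^ (k + 1) := by rw [u3.frame 8 (by norm_num), f8]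
      have e9 : σ₃.reg 9 = G := by rw [u3.frame 9 (by norm_num), f9]
      refine Run.seq (Run.asgv (2 ^ (k + 1 + 1)) ?_ ?_ ?_ rfl)
      · simp [e8, hpk2]
      · simp [e8]; omega
      refine Run.asgv (G / 2) ?_ ?_ ?_ rfl
      · simp [e9]
      · simp [e9]; omega
      have u4 : Upd L 7 0 σ₃ ((σ₃.setReg 8 (2 ^ (k + 1 + 1))).setReg 9 (G / 2)) := by
        refine Upd.of_mem_eq u3.tab rfl (fun r hr => ?_) (by simp)
        rw [State.setReg_reg, if_neg (by omega), State.setReg_reg, if_neg (by omega)]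
      refine ⟨k + 1, ⟨?_, by simp, ?_, hkL, ?_, ?_⟩, ?_⟩
      · simp [u3.frame, hσ₂]
      · rw [pow_succ 2 (k + 1), ← Nat.div_div_eq_div_mul, hG]; simp
      · exact (((g5.trans u2).trans (u3.anti (n' := 7) (by norm_num))).trans u4).mono le_rfl
          (by omega)
      · intro j hj x hx hxj
        simp only [State.setReg_mem]
        by_cases hjk : j ≤ k
        · exact u3.hc j (by omega) x hx (g6 j hjk x hx hxj)
        · obtain rfl : j = k + 1 := by omega
          exact c3 x hx hxj
      · simp; omega
    refine Run.seq (Run.cnd rfl ?_ ?_ ?_)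
    · simp [f6', f9]; omega
    · intro hne
      have hnd : ¬ G ∣ i := by
        intro h
        apply hne
        simp [f6', f9, Nat.mod_eq_zero_of_dvd h]
      have hi0 : 0 < i := by
        rcases Nat.eq_zero_or_pos i with rfl | h
        · exact absurd (dvd_zero _) hnd
        · exact h
      rw [if_neg hnd] at hlc
      refine Run.skip ((finish 10 σ₂ (by omega) ?_ ?_).mono ?_)
      · exact Upd.mono (t := 0) (n := 10) (Upd.of_mem_eq u2.tab rfl (fun _ _ => rfl) rfl) le_rfl
          (by omega)
      -- The shift is unchanged modulo `2 ^ (k + 1)`, so the names kept for the previous shift serve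
      -- again.
      · intro x hx hxk
        refine u2.hc _ hkL _ hx (g5.hc _ hkL _ hx (hD hi0 _ hkL _ hx (Or.inr ?_)))
        rw [hxk, rv_mod hkL, rv_sub_one hi0 hkL hnd]
      · rintro t σ₄ ⟨k', h1, h2⟩
        refine ⟨k', h1, ?_⟩
        simp; omega
    · intro he
      have hd : G ∣ i := by
        simp [f6', f9] at he
        exact Nat.dvd_of_mod_eq_zero he
      rw [if_pos hd] at hlc
      refine (rebuildProg_run (hE'.congr (by norm_num) u2.frame) hkL f8 (by simp [hσ₂]) hr u2.tab
        ?_ ?_).mono ?_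
      · have := u2.cnt
        omega
      · intro x hxk hx
        rw [rv_succ_mod] at hxk
        exact u2.hc _ (by omega) _ hx (g6 k le_rfl x hx hxk)
      rintro t₃ σ₃ ⟨t3, u3, c3⟩
      refine (finish (t₃ + 10) σ₃ (by omega) (u3.mono (by norm_num) (by omega))
        fun x hx hxk => c3 x hxk hx).mono ?_
      rintro t σ₄ ⟨k', h1, h2⟩
      refine ⟨k', h1, ?_⟩
      simp; omega
  · rintro k σ' t ⟨g1, g2, g3, g4, g5, g6⟩ hcond ht
    have hE' := hE.congr (by norm_num) g5.frame
    have hkL : L ≤ k := by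
      simp [g2, hE'.r3] at hcond
      have := (Nat.pow_lt_pow_iff_right (a := 2) (by norm_num)).1 (Nat.lt_of_succ_le hcond)
      omega
    obtain rfl : k = L := by omega
    have : levelCost k i 0 = 0 := rfl
    refine ⟨?_, g5, g1, ?_⟩
    · simp at ht ⊢; omega
    -- Aligned blocks are inherited from the previous shift; for `i = 0` the shift is `0` and they
    -- form the rebuilt class.
    · intro j hj x hx hcl
      rcases hcl with hcl | hcl
      · rcases Nat.eq_zero_or_pos i with rfl | hi0
        · exact g6 j hj x hx (by rw [hcl, rv_zero])
        · exact g5.hc j hj x hx (hD hi0 j hj x hx (Or.inl hcl))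
      · exact g6 j hj x hx (by rw [hcl, rv_mod hj])

/-! ### The loop over all shifts -/

/-- The main loop over all shifts, in the order of their reversed digits. -/
def mainLoop : Prog :=
  asg 6 0;;
  whl (lt (reg 6) (reg 3))
    (levelsProg;; cnd (load (reg 5 + reg 7)) shiftProg .skip;; asg 6 (reg 6 + 1))

/-- The elements of `S` among the first `i` shifts. -/
def processed (L : ℕ) {m : ℕ} (S : Finset (ZMod m)) (i : ℕ) : Finset (ZMod m) :=
  S.filter fun z => ∃ j < i, rv L j L = z.val

/-- A subset of `insert z T` omits `z`, or is `z` together with a subset of `T`. -/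
theorem subsetSums_insert {m : ℕ} {T : Finset (ZMod m)} {z : ZMod m} (hz : z ∉ T)
    {A : Finset (ZMod m)} (hA : (A : Set (ZMod m)) = subsetSums T) (s : ℕ) (hs : (s : ZMod m) = z) :
    ((addShift A s : Finset (ZMod m)) : Set (ZMod m)) = subsetSums (insert z T) := by
  ext x
  have hmem : ∀ y, y ∈ A ↔ ∃ U ⊆ T, ∑ u ∈ U, u = y := by
    intro y
    rw [← Finset.mem_coe, hA]
    rfl
  rw [Finset.mem_coe, mem_addShift, hmem, hmem, hs]
  constructor
  · rintro (⟨U, hU, rfl⟩ | ⟨U, hU, hx⟩)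
    · exact ⟨U, hU.trans (Finset.subset_insert _ _), rfl⟩
    · refine ⟨insert z U, Finset.insert_subset_insert _ hU, ?_⟩
      rw [Finset.sum_insert fun h => hz (hU h), hx]
      ring
  · rintro ⟨U, hU, rfl⟩
    by_cases hzU : z ∈ U
    · right
      refine ⟨U.erase z, ?_, ?_⟩
      · rw [← Finset.subset_insert_iff]; exact hU
      · rw [← Finset.add_sum_erase _ _ hzU]; ring
    · left
      exact ⟨U, (Finset.subset_insert_iff_of_notMem hzU).1 hU, rfl⟩

theorem processed_succ_of_mem {L m i : ℕ} [NeZero m] {S : Finset (ZMod m)} (hi : i < 2 ^ L)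
    (hm : rv L i L < m) (hS : ((rv L i L : ℕ) : ZMod m) ∈ S) :
    ((rv L i L : ℕ) : ZMod m) ∉ processed L S i ∧
      processed L S (i + 1) = insert ((rv L i L : ℕ) : ZMod m) (processed L S i) := by
  have hval : ((rv L i L : ℕ) : ZMod m).val = rv L i L := by
    rw [ZMod.val_natCast, Nat.mod_eq_of_lt hm]
  constructor
  · intro h
    obtain ⟨-, j, hj, hj'⟩ := Finset.mem_filter.1 h
    rw [hval] at hj'
    exact absurd (rv_inj (by omega) hi hj') (by omega)
  · ext z
    simp only [processed, Finset.mem_filter, Finset.mem_insert, Nat.lt_succ_iff_lt_or_eq]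
    constructor
    · rintro ⟨hz, j, hj | rfl, hj'⟩
      · exact Or.inr ⟨hz, j, hj, hj'⟩
      · left; rw [hj', ZMod.natCast_zmod_val]
    · rintro (rfl | ⟨hz, j, hj, hj'⟩)
      · exact ⟨hS, i, Or.inr rfl, hval.symm⟩
      · exact ⟨hz, j, Or.inl hj, hj'⟩

theorem processed_succ_of_notMem {L m i : ℕ} [NeZero m] {S : Finset (ZMod m)}
    (h : ¬ (rv L i L < m ∧ ((rv L i L : ℕ) : ZMod m) ∈ S)) :
    processed L S (i + 1) = processed L S i := by
  refine Finset.filter_congr fun z hz => ⟨?_, ?_⟩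
  · rintro ⟨j, hj, hj'⟩
    rcases Nat.lt_succ_iff_lt_or_eq.1 hj with hj | rfl
    · exact ⟨j, hj, hj'⟩
    · refine absurd ⟨?_, ?_⟩ h
      · rw [hj']; exact ZMod.val_lt z
      · rwa [hj', ZMod.natCast_zmod_val]
  · rintro ⟨j, hj, hj'⟩
    exact ⟨j, by omega, hj'⟩

/-- A bound for the time of the main loop. -/
def totalCost (L m : ℕ) : ℕ := 310 * (L * 2 ^ L) + 400 * 2 ^ L + 3000 * (L + 1) * m

set_option maxHeartbeats 1000000 in
-- The growths of the set telescope to at most `m`, and the level costs are summed by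
-- `sum_levelCost`.
theorem mainLoop_run {L m w : ℕ} {S : Finset (ZMod m)} {σ : State} (hE : Env L m w σ)
    (hT : Tab L σ.mem (σ.reg 50)) (hA : LeafRep L σ.mem ({0} : Finset (ZMod m)))
    (hS : ∀ s < 2 ^ L, σ.mem (bb L + s) = if s < m ∧ (s : ZMod m) ∈ S then 1 else 0)
    (hc : σ.reg 50 + totalCost L m ≤ bb L) :
    Run w mainLoop σ fun t σ' => t ≤ totalCost L m + 10 ∧ (∀ r < 6, σ'.reg r = σ.reg r) ∧
      ∃ A : Finset (ZMod m), (A : Set (ZMod m)) = subsetSums S ∧ LeafRep L σ'.mem A := by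
  have : NeZero m := ⟨by have := hE.m_pos; omega⟩
  have hB := wd_lt_bb L
  have hV := hE.word
  have hw0 := hE.word_ne
  have hbb : 0 ≤ bb L * bb L := Nat.zero_le _
  obtain ⟨p1, -, p3⟩ := pow_facts (le_refl L)
  refine Run.seq (Run.asgv 0 ?_ ?_ ?_ rfl)
  · simp
  · simp
  have hcardm : ∀ A : Finset (ZMod m), A.card ≤ m := fun A => by
    simpa [ZMod.card] using Finset.card_le_univ A
  -- The potential is the level cost of the remaining shifts plus `3000 * (L + 1)` for each residue
  -- not yet reached. The last clause uses the same budget for names, so that they fit in the table.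
  refine Run.whl (fun (g : ℕ × Finset (ZMod m)) σ' => σ'.reg 6 = g.1 ∧ g.1 ≤ 2 ^ L ∧
      (∀ r < 6, σ'.reg r = σ.reg r) ∧ Tab L σ'.mem (σ'.reg 50) ∧
      (0 < g.1 → DS L (rv L (g.1 - 1) L) σ'.mem) ∧ LeafRep L σ'.mem g.2 ∧
      (g.2 : Set (ZMod m)) = subsetSums (processed L S g.1) ∧
      (∀ a < 2 * bb L, σ'.mem a = σ.mem a) ∧
      σ'.reg 50 + (∑ j ∈ Finset.Ico g.1 (2 ^ L), (levelCost L j L + 400) +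
        3000 * (L + 1) * (m - g.2.card)) ≤ σ.reg 50 + totalCost L m)
    (fun g => ∑ j ∈ Finset.Ico g.1 (2 ^ L), (levelCost L j L + 400) +
      3000 * (L + 1) * (m - g.2.card)) (0, {0}) rfl ?_ ?_ ?_ ?_
  · refine ⟨by simp, by simp, ?_, by simpa using hT, by simp, hA, ?_, fun _ _ => rfl, ?_⟩
    · intro r hr
      rw [State.setReg_reg, if_neg (by omega)]
    · have : processed L S 0 = ∅ := by simp [processed]
      simp only [this]
      ext x
      simp [subsetSums, eq_comm]
    · have h1 : 3000 * (L + 1) * (m - 1) ≤ 3000 * (L + 1) * m := Nat.mul_le_mul_left _ (by omega)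
      have h2 := sum_levelCost L
      rw [Finset.range_eq_Ico] at h2
      simp only [Finset.sum_add_distrib, h2, totalCost]
      simp
      omega
  · rintro g σ' -
    simp [hw0]
  · rintro ⟨i, A⟩ σ' ⟨g1, g2, g3, g4, g5, g6, g7, g8, g9⟩ hcond
    simp only at g1 g2 g5 g6 g7 g9
    have hE' := hE.congr (by norm_num) g3
    have hi : i < 2 ^ L := by
      rw [eval_lt, eval_reg, eval_reg, g1, hE'.r3] at hcond
      by_contra hcon
      exact hcond (if_neg hcon)
    have hsum := Finset.sum_eq_sum_Ico_succ_bot hi fun j => levelCost L j L + 400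
    set R := ∑ j ∈ Finset.Ico (i + 1) (2 ^ L), (levelCost L j L + 400) with hR
    rw [hsum] at g9
    simp only [hsum]
    refine Run.seq ((levelsProg_run hE' g1 hi g4 g5 (by omega)).mono ?_)
    rintro t₁ σ₁ ⟨t1, u1, f7, d1⟩
    have hE1 := hE'.congr (n := 7) (by norm_num) u1.frame
    have f6 : σ₁.reg 6 = i := by rw [u1.frame 6 (by norm_num), g1]
    have hcnt := u1.cnt
    have hs := rv_lt L i L
    have hA1 : LeafRep L σ₁.mem A := fun y hy => by rw [u1.leaf y hy, g6 y hy]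
    have hfr1 : ∀ r < 6, σ₁.reg r = σ.reg r := fun r hr => by
      rw [u1.frame r (by omega), g3 r hr]
    have hmem : (load (reg 5 + reg 7)).eval σ₁ =
        if rv L i L < m ∧ ((rv L i L : ℕ) : ZMod m) ∈ S then 1 else 0 := by
      rw [← hS _ hs]
      simp only [eval_load, eval_add, eval_reg, hE1.r5, f7]
      rw [u1.low _ (by omega), g8 _ (by omega)]
    refine Run.seq (Run.cnd rfl ?_ ?_ ?_)
    · simp [hE1.r5, f7]; omega
    · intro hne
      replace hne : rv L i L < m ∧ ((rv L i L : ℕ) : ZMod m) ∈ S := by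
        by_contra hcon
        exact hne (by rw [hmem, if_neg hcon])
      obtain ⟨hp1, hp2⟩ := processed_succ_of_mem hi hne.1 hne.2
      have hB' := subsetSums_insert hp1 g7 _ rfl
      rw [← hp2] at hB'
      have hcA := Finset.card_le_card (subset_addShift A (rv L i L))
      have hcB := hcardm (addShift A (rv L i L))
      have e1 : 3000 * (L + 1) * (m - A.card) =
          3000 * (L + 1) * ((addShift A (rv L i L)).card - A.card) +
          3000 * (L + 1) * (m - (addShift A (rv L i L)).card) := by
        rw [← mul_add]; congr 1; omega
      rw [e1] at g9
      simp only [e1]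
      refine (shiftProg_run hE1 f7 hs u1.tab d1 hA1 (by omega)).mono ?_
      rintro t₂ σ₂ ⟨t2, u2⟩
      have f6' : σ₂.reg 6 = i := by rw [u2.frame 6 (by norm_num), f6]
      have hcnt2 := u2.cnt
      refine Run.asgv (i + 1) ?_ ?_ ?_ rfl
      · simp [f6']
      · simp [f6', hw0]; omega
      refine ⟨(i + 1, addShift A (rv L i L)), ⟨by simp, hi, ?_, by simpa using u2.tab,
        fun _ => u2.ds, u2.leaf, hB', ?_, ?_⟩, ?_⟩
      · intro r hr
        rw [State.setReg_reg, if_neg (by omega), u2.frame r (by omega), hfr1 r hr]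
      · intro a ha
        rw [State.setReg_mem, u2.low a ha, u1.low a (by omega), g8 a ha]
      · rw [State.setReg_reg, if_neg (by norm_num)]
        simp only [← hR]
        omega
      · simp only [← hR]
        simp
        omega
    · intro he
      replace he : ¬ (rv L i L < m ∧ ((rv L i L : ℕ) : ZMod m) ∈ S) := by
        intro hcon
        rw [hmem, if_pos hcon] at he
        omega
      have hp := processed_succ_of_notMem he
      refine Run.skip (Run.asgv (i + 1) ?_ ?_ ?_ rfl)
      · simp [f6]
      · simp [f6, hw0]; omega
      refine ⟨(i + 1, A), ⟨by simp, hi, ?_, by simpa using u1.tab,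
        fun _ => d1, hA1, ?_, ?_, ?_⟩, ?_⟩
      · intro r hr
        rw [State.setReg_reg, if_neg (by omega), hfr1 r hr]
      · simp only [hp]; exact g7
      · intro a ha
        rw [State.setReg_mem, u1.low a (by omega), g8 a ha]
      · rw [State.setReg_reg, if_neg (by norm_num)]
        simp only [← hR]
        omega
      · simp only [← hR]
        simp
        omega
  · rintro ⟨i, A⟩ σ' t ⟨g1, g2, g3, g4, g5, g6, g7, g8, g9⟩ hcond ht
    simp only at g1 g2 g5 g6 g7 g9
    have hE' := hE.congr (by norm_num) g3
    have hi : i = 2 ^ L := by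
      rw [eval_lt, eval_reg, eval_reg, g1, hE'.r3] at hcond
      by_contra hcon
      rw [if_pos (by omega)] at hcond
      omega
    refine ⟨?_, g3, A, ?_, g6⟩
    · have h1 : 3000 * (L + 1) * (m - 1) ≤ 3000 * (L + 1) * m := Nat.mul_le_mul_left _ (by omega)
      have h2 := sum_levelCost L
      rw [Finset.range_eq_Ico] at h2
      simp only [Finset.sum_add_distrib, h2] at ht
      simp at ht
      simp [totalCost]
      omega
    -- Every residue has its value below `2 ^ L`, and digit reversal reaches all these numbers.
    · rw [g7]
      congr 1
      refine Finset.filter_true_of_mem fun z _ => ?_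
      rw [hi]
      exact rv_surj ((ZMod.val_lt z).trans_le hE.m_le)

/-! ### Size parameters, input and output -/

/-- Compute the least power of two that is at least the modulus, in `reg[3]`. -/
def sizeProg : Prog :=
  asg 3 1;; whl (lt (reg 3) (reg 0)) (asg 3 (reg 3 + reg 3))

theorem sizeProg_run {m w : ℕ} {σ : State} (h0 : σ.reg 0 = m) (hm : 2 ≤ m) (hw : 2 * m ≤ 2 ^ w) :
    Run w sizeProg σ fun t σ' => ∃ L, t ≤ 10 * L + 10 ∧ m ≤ 2 ^ L ∧ 2 ^ L < 2 * m ∧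
      σ' = σ.setReg 3 (2 ^ L) := by
  have hw0 : w ≠ 0 := by rintro rfl; simp at hw; omega
  refine Run.seq (Run.asgv 1 ?_ ?_ ?_ rfl)
  · simp
  · simp [hw0]
  have hpow : ∀ k, 2 ^ k < 2 * m → k ≤ 2 * m := fun k hk =>
    (Nat.lt_two_pow_self.trans hk).le
  refine Run.whl (fun (k : ℕ) σ' => σ' = σ.setReg 3 (2 ^ k) ∧ 2 ^ k < 2 * m ∧
      2 ^ (k - 1) < m) (fun k => 10 * (2 * m - k)) 0 rfl ?_ ?_ ?_ ?_
  · exact ⟨by simp, by simp; omega, by simp; omega⟩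
  · rintro k σ' ⟨rfl, -⟩
    simp [hw0]
  · rintro k σ' ⟨rfl, g2, g3⟩ hcond
    have hlt : 2 ^ k < m := by
      simp [h0] at hcond; exact hcond
    have hk : 2 ^ (k + 1) < 2 * m := by rw [pow_succ]; omega
    have := hpow _ hk
    refine Run.asgv (2 ^ (k + 1)) ?_ ?_ ?_ rfl
    · simp; ring
    · simp; omega
    refine ⟨k + 1, ⟨?_, hk, by simpa using hlt⟩, by simp; omega⟩
    simp [State.setReg]
  · rintro k σ' t ⟨rfl, g2, g3⟩ hcond ht
    have hge : m ≤ 2 ^ k := by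
      simp [h0] at hcond; exact hcond
    have := hpow _ g2
    exact ⟨k, by simp at ht ⊢; omega, hge, g2, rfl⟩

/-- Copy the input to a characteristic vector. -/
def readProg : Prog :=
  asg 6 0;;
  whl (lt (reg 6) (reg 1)) (sto (reg 5 + load (reg 6)) 1;; asg 6 (reg 6 + 1))

/-- The vector starts at `bb L ≥ m`, beyond the input, so entries still to be read are not
overwritten. -/
theorem readProg_run {L m w : ℕ} [NeZero m] {σ : State} {l : List (ZMod m)} (hE : Env L m w σ)
    (h1 : σ.reg 1 = l.length) (hl : l.length ≤ m) (hmem : ∀ i, σ.mem i = (l.getD i 0).val) :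
    Run w readProg σ fun t σ' => t ≤ 20 * m + 10 ∧ (∀ r < 6, σ'.reg r = σ.reg r) ∧
      (∀ s < m, σ'.mem (bb L + s) = if (s : ZMod m) ∈ l then 1 else 0) ∧
      ∀ a, bb L + m ≤ a → σ'.mem a = 0 := by
  have hB := wd_lt_bb L
  have hV := hE.word
  have hw0 := hE.word_ne
  have hbb : 0 ≤ bb L * bb L := Nat.zero_le _
  obtain ⟨p1, -, p3⟩ := pow_facts (le_refl L)
  have b1 := hE.m_le
  have hbig : ∀ a, m ≤ a → σ.mem a = 0 := by
    intro a ha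
    rw [hmem, List.getD_eq_default _ _ (by omega), ZMod.val_zero]
  refine Run.seq (Run.asgv 0 ?_ ?_ ?_ rfl)
  · simp
  · simp
  refine Run.whl (fun (i : ℕ) σ' => σ'.reg 6 = i ∧ i ≤ l.length ∧ (∀ r < 6, σ'.reg r = σ.reg r) ∧
      (∀ a < bb L, σ'.mem a = σ.mem a) ∧
      (∀ s < m, σ'.mem (bb L + s) = if (s : ZMod m) ∈ l.take i then 1 else 0) ∧
      ∀ a, bb L + m ≤ a → σ'.mem a = 0)
    (fun i => (m - i) * 20) 0 rfl ?_ ?_ ?_ ?_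
  · refine ⟨by simp, by simp, ?_, fun _ _ => rfl, ?_, ?_⟩
    · intro r hr
      rw [State.setReg_reg, if_neg (by omega)]
    · intro s hs
      simp [hbig (bb L + s) (by omega)]
    · intro a ha
      exact hbig a (by omega)
  · rintro i σ' -
    simp [hw0]
  · rintro i σ' ⟨g1, g2, g3, g4, g5, g6⟩ hcond
    have hE' := hE.congr (by norm_num) g3
    have hi : i < l.length := by
      rw [eval_lt, eval_reg, eval_reg, g1, g3 1 (by norm_num), h1] at hcond
      by_contra hcon
      exact hcond (if_neg hcon)
    have hget : l.getD i 0 = l[i] := List.getD_eq_getElem _ _ hi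
    have hv : (l[i]).val < m := ZMod.val_lt _
    have hload : σ'.mem i = (l[i]).val := by rw [g4 i (by omega), hmem, hget]
    refine Run.seq (Run.stov (bb L + (l[i]).val) 1 ?_ ?_ ?_ ?_ ?_ rfl)
    · simp [hE'.r5, g1, hload]
    · simp
    · simp [hE'.r5, g1, hload]; omega
    · simp [hw0]
    refine Run.asgv (i + 1) ?_ ?_ ?_ rfl
    · simp [g1]
    · simp [g1, hw0]; omega
    refine ⟨i + 1, ⟨by simp, hi, ?_, ?_, ?_, ?_⟩, ?_⟩
    · intro r hr
      rw [State.setReg_reg, if_neg (by omega), State.setMem_reg, g3 r hr]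
    · intro a ha
      rw [State.setReg_mem, State.setMem_mem, Function.update_of_ne (by omega), g4 a ha]
    · intro s hs
      rw [State.setReg_mem, State.setMem_mem, Function.update_apply, g5 s hs, List.take_succ_eq_append_getElem hi]
      have hiff : bb L + s = bb L + (l[i]).val ↔ (s : ZMod m) = l[i] := by
        rw [Nat.add_left_cancel_iff]
        constructor
        · intro h; rw [h, ZMod.natCast_zmod_val]
        · intro h; rw [← h, ZMod.val_natCast, Nat.mod_eq_of_lt hs]
      simp only [hiff, List.mem_append, List.mem_singleton]
      by_cases h : (s : ZMod m) = l[i] <;> simp [h]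
    · intro a ha
      rw [State.setReg_mem, State.setMem_mem, Function.update_of_ne (by omega), g6 a ha]
    · have : m - i = m - (i + 1) + 1 := by omega
      simp [this, add_mul]
  · rintro i σ' t ⟨g1, g2, g3, g4, g5, g6⟩ hcond ht
    have hi : i = l.length := by
      rw [eval_lt, eval_reg, eval_reg, g1, g3 1 (by norm_num), h1] at hcond
      by_contra hcon
      rw [if_pos (by omega)] at hcond
      omega
    refine ⟨by simp at ht ⊢; omega, g3, ?_, g6⟩
    intro s hs
    rw [g5 s hs, hi, List.take_length]

/-- Write the periodic characteristic word of `{0}`, and initialize the supply of names. -/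
def initProg : Prog :=
  asg 50 2;; asg 6 0;;
  whl (lt (reg 6) (reg 4)) (sto (3 * reg 5 + reg 4 + reg 6) 1;; asg 6 (reg 6 + reg 0))

/-- Memory is still zero there, so the table has no entries and its injectivity is vacuous. The
letters occupy the names `0` and `1`; fresh names start at `2`. -/
theorem initProg_run {L m w : ℕ} {σ : State} (hE : Env L m w σ)
    (hmem : ∀ a, 2 * bb L ≤ a → σ.mem a = 0) :
    Run w initProg σ fun t σ' => t ≤ 150 ∧ (∀ r < 6, σ'.reg r = σ.reg r) ∧ σ'.reg 50 = 2 ∧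
      (∀ a < 2 * bb L, σ'.mem a = σ.mem a) ∧ Tab L σ'.mem 2 ∧
      LeafRep L σ'.mem ({0} : Finset (ZMod m)) := by
  have hm := hE.m_pos
  have hB := wd_lt_bb L
  have hV := hE.word
  have hw0 := hE.word_ne
  have hbb : 0 ≤ bb L * bb L := Nat.zero_le _
  obtain ⟨p1, -, p3⟩ := pow_facts (le_refl L)
  have b1 := hE.m_le
  have b2 := hE.le_m
  have hpr0 : ∀ a b, pr L σ.mem a b = 0 := fun a b =>
    hmem _ (by have := le_paddr L a b; omega)
  have hnm0 : ∀ k x, nm L σ.mem k x = 0 := fun k x =>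
    hmem _ (by have := le_naddr L k x; omega)
  refine Run.seq (Run.asgv 2 ?_ ?_ ?_ rfl)
  · simp
  · change 2 < 2 ^ w; omega
  refine Run.seq (Run.asgv 0 ?_ ?_ ?_ rfl)
  · simp
  · simp
  refine Run.whl (fun (j : ℕ) σ' => σ'.reg 6 = j * m ∧ j ≤ 4 ∧ (∀ r < 6, σ'.reg r = σ.reg r) ∧
      σ'.reg 50 = 2 ∧ (∀ a < 2 * bb L, σ'.mem a = σ.mem a) ∧ Tab L σ'.mem 2 ∧
      ∀ y < wd L, nm L σ'.mem 0 y = if m ∣ y ∧ y < j * m then 1 else 0)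
    (fun j => (4 - j) * 30) 0 rfl ?_ ?_ ?_ ?_
  · refine ⟨by simp, by simp, ?_, by simp, fun _ _ => rfl, ⟨le_rfl, ?_, ?_, ?_⟩, ?_⟩
    · intro r hr
      rw [State.setReg_reg, if_neg (by omega), State.setReg_reg, if_neg (by omega)]
    · intro k _ x _
      change nm L σ.mem k x < 2
      rw [hnm0]; norm_num
    · intro a _ b _
      change pr L σ.mem a b < 2
      rw [hpr0]; norm_num
    · intro a _ b _ a' _ b' _ h
      exact absurd (hpr0 a b) h
    · intro y _
      change nm L σ.mem 0 y = _
      rw [hnm0]; simp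
  · rintro j σ' -
    simp [hw0]
  · rintro j σ' ⟨g1, g2, g3, g4, g5, g6, g7⟩ hcond
    have hE' := hE.congr (by norm_num) g3
    have hx : j * m < wd L := by
      rw [eval_lt, eval_reg, eval_reg, g1, hE'.r4] at hcond
      by_contra hcon
      exact hcond (if_neg hcon)
    -- The multiples of `m` in the window are at most `0`, `m`, `2 * m` and `3 * m`.
    have hj : j < 4 := by
      by_contra hcon
      have : j * m = 4 * m := by rw [show j = 4 by omega]
      omega
    refine Run.seq (Run.stov (naddr L 0 (j * m)) 1 ?_ ?_ ?_ ?_ ?_ rfl)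
    · simp [hE'.r5, hE'.r4, g1, naddr]
    · simp
    · simp [hE'.r5, hE'.r4, g1]; omega
    · simp [hw0]
    refine Run.asgv ((j + 1) * m) ?_ ?_ ?_ rfl
    · simp [g1, hE'.r0]; ring
    · simp [g1, hE'.r0]; omega
    refine ⟨j + 1, ⟨by simp, hj, ?_, by simpa using g4, ?_, ?_, ?_⟩, ?_⟩
    · intro r hr
      rw [State.setReg_reg, if_neg (by omega), State.setMem_reg, g3 r hr]
    · intro a ha
      have := le_naddr L 0 (j * m)
      rw [State.setReg_mem, State.setMem_mem, Function.update_of_ne (by omega), g5 a ha]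
    · exact g6.setName (by norm_num) (by omega) hx
    · intro y hy
      rw [State.setReg_mem, State.setMem_mem, nm_update _ _ hx hy, g7 y hy]
      have key : (m ∣ y ∧ y < (j + 1) * m) ↔ y = j * m ∨ (m ∣ y ∧ y < j * m) := by
        constructor
        · rintro ⟨⟨q, rfl⟩, h2⟩
          have h3 : q < j + 1 := by
            rw [mul_comm] at h2
            exact Nat.lt_of_mul_lt_mul_right h2
          rcases Nat.lt_succ_iff_lt_or_eq.1 h3 with h3 | rfl
          · right
            refine ⟨dvd_mul_right _ _, ?_⟩
            rw [mul_comm]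
            exact Nat.mul_lt_mul_of_pos_right h3 (by omega)
          · left; ring
        · rintro (rfl | ⟨h1, h2⟩)
          · exact ⟨dvd_mul_left _ _, by rw [add_mul]; omega⟩
          · exact ⟨h1, by rw [add_mul]; omega⟩
      simp only [key]
      by_cases h : y = j * m <;> simp [h]
    · have : 4 - j = 4 - (j + 1) + 1 := by omega
      simp [this, add_mul]
  · rintro j σ' t ⟨g1, g2, g3, g4, g5, g6, g7⟩ hcond ht
    have hE' := hE.congr (by norm_num) g3
    have hx : wd L ≤ j * m := by
      rw [eval_lt, eval_reg, eval_reg, g1, hE'.r4] at hcond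
      by_contra hcon
      rw [if_pos (by omega)] at hcond
      omega
    refine ⟨by simp at ht ⊢; omega, g3, g4, g5, g6, ?_⟩
    intro y hy
    rw [g7 y hy]
    have : y < j * m := by omega
    simp [this, ZMod.natCast_eq_zero_iff]

/-- Copy the result to the output cells. -/
def writeProg : Prog :=
  asg 6 0;;
  whl (lt (reg 6) (reg 0)) (sto (reg 6) (load (3 * reg 5 + reg 4 + reg 6));; asg 6 (reg 6 + 1))

theorem writeProg_run {L m w : ℕ} {σ : State} {A : Finset (ZMod m)} (hE : Env L m w σ)
    (hA : LeafRep L σ.mem A) :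
    Run w writeProg σ fun t σ' => t ≤ 30 * m + 10 ∧
      ∀ x < m, σ'.mem x = if (x : ZMod m) ∈ A then 1 else 0 := by
  have hm := hE.m_pos
  have hB := wd_lt_bb L
  have hV := hE.word
  have hw0 := hE.word_ne
  have hbb : 0 ≤ bb L * bb L := Nat.zero_le _
  obtain ⟨p1, -, p3⟩ := pow_facts (le_refl L)
  have b1 := hE.m_le
  refine Run.seq (Run.asgv 0 ?_ ?_ ?_ rfl)
  · simp
  · simp
  refine Run.whl (fun (i : ℕ) σ' => σ'.reg 6 = i ∧ i ≤ m ∧ (∀ r < 6, σ'.reg r = σ.reg r) ∧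
      (∀ a, 3 * bb L ≤ a → σ'.mem a = σ.mem a) ∧
      ∀ x < i, σ'.mem x = if (x : ZMod m) ∈ A then 1 else 0)
    (fun i => (m - i) * 30) 0 rfl ?_ ?_ ?_ ?_
  · refine ⟨by simp, by simp, ?_, fun _ _ => rfl, by simp⟩
    intro r hr
    rw [State.setReg_reg, if_neg (by omega)]
  · rintro i σ' -
    simp [hw0]
  · rintro i σ' ⟨g1, g2, g3, g4, g5⟩ hcond
    have hE' := hE.congr (by norm_num) g3
    have hi : i < m := by
      rw [eval_lt, eval_reg, eval_reg, g1, hE'.r0] at hcond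
      by_contra hcon
      exact hcond (if_neg hcon)
    refine Run.seq (Run.stov i (if (i : ZMod m) ∈ A then 1 else 0) ?_ ?_ ?_ ?_ ?_ rfl)
    · simp [g1]
    · rw [← hA i (by omega)]
      simp only [eval_load, eval_add, eval_mul, eval_reg, eval_ofNat, hE'.r5, hE'.r4, g1]
      rw [g4 _ (by omega)]
      simp [nm, naddr]
    · simp
    · simp [hE'.r5, hE'.r4, g1]; omega
    refine Run.asgv (i + 1) ?_ ?_ ?_ rfl
    · simp [g1]
    · simp [g1, hw0]; omega
    refine ⟨i + 1, ⟨by simp, hi, ?_, ?_, ?_⟩, ?_⟩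
    · intro r hr
      rw [State.setReg_reg, if_neg (by omega), State.setMem_reg, g3 r hr]
    · intro a ha
      rw [State.setReg_mem, State.setMem_mem, Function.update_of_ne (by omega), g4 a ha]
    · intro x hx
      rw [State.setReg_mem, State.setMem_mem, Function.update_apply]
      by_cases h : x = i
      · simp [h]
      · rw [if_neg h, g5 x (by omega)]
    · have : m - i = m - (i + 1) + 1 := by omega
      simp [this, add_mul]
  · rintro i σ' t ⟨g1, g2, g3, g4, g5⟩ hcond ht
    have hE' := hE.congr (by norm_num) g3
    have hi : i = m := by
      rw [eval_lt, eval_reg, eval_reg, g1, hE'.r0] at hcond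
      by_contra hcon
      rw [if_pos (by omega)] at hcond
      omega
    refine ⟨by simp at ht ⊢; omega, ?_⟩
    rwa [hi] at g5

/-! ### The whole program and its time bound -/

/-- The subset sum program. -/
def subsetSumProg : Prog :=
  sizeProg;; asg 4 (reg 3 + reg 3);; asg 5 (reg 4 * reg 4);; asg 5 (reg 5 * reg 5);;
  asg 5 (reg 5 * reg 5);; asg 5 (reg 5 * reg 5);; readProg;; initProg;; mainLoop;; writeProg

/-- Here `wd L ≤ 4 * m ≤ m ^ 3`, hence `bb L ≤ m ^ 48`. The sum is at most `6 * m ^ 96`, and `8 ≤ m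
^ 3` brings it below `m ^ 99`. -/
theorem word_bound {L m w : ℕ} (hm : 2 ≤ m) (hL : 2 ^ L < 2 * m) (hw : m ^ 99 ≤ 2 ^ w) :
    5 * bb L + bb L * bb L ≤ 2 ^ w := by
  have h1 : wd L ≤ m ^ 3 := by
    have : wd L = 2 * 2 ^ L := rfl
    have h2 : 2 * 2 * m ≤ m * m * m := Nat.mul_le_mul_right _ (Nat.mul_le_mul hm hm)
    calc wd L ≤ 2 * 2 * m := by omega
      _ ≤ m * m * m := h2
      _ = m ^ 3 := by ring
  have h2 : bb L ≤ m ^ 48 := by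
    calc bb L = wd L ^ 16 := by unfold bb; rfl
      _ ≤ (m ^ 3) ^ 16 := Nat.pow_le_pow_left h1 16
      _ = m ^ 48 := by ring
  have h3 : 1 ≤ bb L := by
    have := wd_lt_bb L
    have := wd_ge L
    omega
  have h4 : bb L * bb L ≤ m ^ 48 * m ^ 48 := Nat.mul_le_mul h2 h2
  have h5 : bb L ≤ bb L * bb L := Nat.le_mul_of_pos_left _ h3
  have h6 : 2 * 2 * 2 * (m ^ 48 * m ^ 48) ≤ m * m * m * (m ^ 48 * m ^ 48) :=
    Nat.mul_le_mul_right _ (Nat.mul_le_mul (Nat.mul_le_mul hm hm) hm)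
  have h7 : m * m * m * (m ^ 48 * m ^ 48) = m ^ 99 := by ring
  omega

theorem totalCost_le {L m : ℕ} (hL : 1 ≤ L) (hm : m ≤ 2 ^ L) :
    totalCost L m ≤ 6710 * (L * 2 ^ L) := by
  have h1 : 3000 * (L + 1) * m ≤ 3000 * (2 * L) * 2 ^ L :=
    Nat.mul_le_mul (Nat.mul_le_mul_left _ (by omega)) hm
  have h2 : 1 * 2 ^ L ≤ L * 2 ^ L := Nat.mul_le_mul_right _ hL
  have h3 : 3000 * (2 * L) * 2 ^ L = 6000 * (L * 2 ^ L) := by ring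
  unfold totalCost
  omega

theorem subsetSumProg_run {m w : ℕ} (hm : 2 ≤ m) {l : List (ZMod m)} (hl : l.Nodup)
    (hw : m ^ 99 ≤ 2 ^ w) :
    Run w subsetSumProg (inputState m l) fun t σ => HoldsSet σ (subsetSums l.toFinset) ∧
      ∃ L, 2 ^ L < 2 * m ∧ t ≤ 7000 * (L * 2 ^ L) := by
  have : NeZero m := ⟨by omega⟩
  have hlen : l.length ≤ m := by
    rw [← List.toFinset_card_of_nodup hl]
    simpa [ZMod.card] using Finset.card_le_univ l.toFinset
  have hmw : 2 * m ≤ 2 ^ w := by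
    refine le_trans ?_ hw
    calc 2 * m ≤ m * m := Nat.mul_le_mul_right _ hm
      _ = m ^ 2 := by ring
      _ ≤ m ^ 99 := Nat.pow_le_pow_right (by omega) (by norm_num)
  refine Run.seq ((sizeProg_run (m := m) rfl hm hmw).mono ?_)
  rintro t₁ σ₁ ⟨L, t1, hL1, hL2, rfl⟩
  have hV := word_bound hm hL2 hw
  have hL : 1 ≤ L := by
    rcases Nat.eq_zero_or_pos L with rfl | h
    · simp at hL1; omega
    · exact h
  obtain ⟨p1, -, p3⟩ := pow_facts (le_refl L)
  have hB := wd_lt_bb L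
  have hB' := wd_sq_le L
  have hw2 := wd_ge L
  have hbb : 0 ≤ bb L * bb L := Nat.zero_le _
  have hb : bb L = wd L ^ 16 := by unfold bb; rfl
  have hp : ∀ k ≤ 16, wd L ^ k < 2 ^ w := by
    intro k hk
    have := Nat.pow_le_pow_right (show 0 < wd L by omega) hk
    omega
  have e2 := hp 2 (by norm_num)
  have e4 := hp 4 (by norm_num)
  have e8 := hp 8 (by norm_num)
  have e16 := hp 16 (by norm_num)
  refine Run.seq (Run.asgv (wd L) ?_ ?_ ?_ rfl)
  · simp [p3]
  · simp; omega
  refine Run.seq (Run.asgv (wd L ^ 2) ?_ ?_ ?_ rfl)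
  · simp; ring
  · simp; rwa [← pow_two]
  refine Run.seq (Run.asgv (wd L ^ 4) ?_ ?_ ?_ rfl)
  · simp; ring
  · simp; rwa [← pow_add]
  refine Run.seq (Run.asgv (wd L ^ 8) ?_ ?_ ?_ rfl)
  · simp; ring
  · simp; rwa [← pow_add]
  refine Run.seq (Run.asgv (bb L) ?_ ?_ ?_ rfl)
  · simp [hb]; ring
  · simp; rwa [← pow_add]
  set σ₂ := ((((((inputState m l).setReg 3 (2 ^ L)).setReg 4 (wd L)).setReg 5 (wd L ^ 2)).setReg 5
    (wd L ^ 4)).setReg 5 (wd L ^ 8)).setReg 5 (bb L) with hσ₂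
  have hE : Env L m w σ₂ := by
    refine ⟨?_, ?_, ?_, ?_, hV, hm, hL1, hL2⟩ <;> simp [hσ₂, inputState]
  refine Run.seq ((readProg_run (l := l) hE (by simp [hσ₂, inputState]) hlen
    fun i => rfl).mono ?_)
  rintro t₃ σ₃ ⟨t3, f3, s3, z3⟩
  have hE3 := hE.congr (by norm_num) f3
  refine Run.seq ((initProg_run hE3 fun a ha => z3 a (by omega)).mono ?_)
  rintro t₄ σ₄ ⟨t4, f4, c4, low4, tab4, leaf4⟩
  have hE4 := hE3.congr (by norm_num) f4
  have htot := totalCost_le hL hL1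
  have hLL : L < 2 ^ L := Nat.lt_two_pow_self
  -- With `wd_sq_le` this keeps the total number of names below `bb L`.
  have hLW : L * 2 ^ L ≤ wd L * wd L := Nat.mul_le_mul (by omega) (by omega)
  have hLm : 1 * 2 ^ L ≤ L * 2 ^ L := Nat.mul_le_mul_right _ hL
  have hLm' : L * 1 ≤ L * 2 ^ L := Nat.mul_le_mul_left _ p1
  refine Run.seq ((mainLoop_run (S := l.toFinset) hE4 (by rwa [c4]) leaf4 ?_
    (by rw [c4]; omega)).mono ?_)
  · intro s hs
    rw [low4 _ (by omega)]
    by_cases hsm : s < m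
    · rw [s3 s hsm]
      simp [hsm]
    · rw [z3 _ (by omega), if_neg (by tauto)]
  rintro t₅ σ₅ ⟨t5, f5, A, hA, leaf5⟩
  have hE5 := hE4.congr (by norm_num) f5
  refine (writeProg_run hE5 leaf5).mono ?_
  rintro t₆ σ₆ ⟨t6, h6⟩
  refine ⟨?_, L, hL2, ?_⟩
  · intro x hx
    rw [← hA, h6 x hx]
    constructor
    · intro h; exact if_pos h
    · intro h; exact if_neg h
  · simp; omega

/-- The time bound of the program in terms of the modulus. -/
theorem time_le {m n L t : ℕ} (hm : 2 ≤ m) (hn : 1 ≤ n) (hL : 2 ^ L < 2 * m)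
    (ht : t ≤ 7000 * (L * 2 ^ L)) :
    (t : ℝ) ≤ 28000 / Real.log 2 ^ 2 * (min (√(n : ℝ) * (m : ℝ)) ((m : ℝ) ^ (5 / 4 : ℝ)) *
      Real.log (m : ℝ) ^ 2) := by
  have hm' : (2 : ℝ) ≤ m := by exact_mod_cast hm
  have hn' : (1 : ℝ) ≤ n := by exact_mod_cast hn
  have hl2 : 0 < Real.log 2 := Real.log_pos (by norm_num)
  have hlm : Real.log 2 ≤ Real.log m := Real.log_le_log (by norm_num) hm'
  have hL' : (L : ℝ) * Real.log 2 ≤ 2 * Real.log m := by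
    have h1 : Real.log ((2 : ℝ) ^ L) ≤ Real.log (2 * m) := by
      refine Real.log_le_log (by positivity) ?_
      exact_mod_cast hL.le
    rw [Real.log_pow, Real.log_mul (by norm_num) (by positivity)] at h1
    linarith
  have hLp : ((2 : ℝ) ^ L) ≤ 2 * m := by exact_mod_cast hL.le
  have ht' : (t : ℝ) ≤ 7000 * (L * 2 ^ L) := by exact_mod_cast ht
  -- A bound linear in `m` up to logarithms suffices. The first term needs `n ≥ 1`, that is, a
  -- nonempty set.
  have hmin : (m : ℝ) ≤ min (√(n : ℝ) * (m : ℝ)) ((m : ℝ) ^ (5 / 4 : ℝ)) := by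
    refine le_min ?_ ?_
    · have : (1 : ℝ) ≤ √(n : ℝ) := Real.one_le_sqrt.2 hn'
      nlinarith
    · calc (m : ℝ) = (m : ℝ) ^ (1 : ℝ) := (Real.rpow_one _).symm
        _ ≤ (m : ℝ) ^ (5 / 4 : ℝ) :=
          Real.rpow_le_rpow_of_exponent_le (by linarith) (by norm_num)
  -- One factor `log 2` turns `L` into at most `2 * log m`, the other is at most `log m`, and `2 ^ L
  -- ≤ 2 * m`; so `28000 = 7000 * 2 * 2`.
  have h1 : (t : ℝ) * Real.log 2 ^ 2 ≤ 28000 * (m * Real.log m ^ 2) := by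
    calc (t : ℝ) * Real.log 2 ^ 2 ≤ 7000 * (L * 2 ^ L) * Real.log 2 ^ 2 := by gcongr
      _ = 7000 * ((L * Real.log 2) * 2 ^ L * Real.log 2) := by ring
      _ ≤ 7000 * ((2 * Real.log m) * (2 * m) * Real.log m) := by gcongr
      _ = 28000 * (m * Real.log m ^ 2) := by ring
  calc (t : ℝ) = (t * Real.log 2 ^ 2) / Real.log 2 ^ 2 := by field_simp
    _ ≤ 28000 * (m * Real.log m ^ 2) / Real.log 2 ^ 2 := by gcongr
    _ = 28000 / Real.log 2 ^ 2 * (m * Real.log m ^ 2) := by ring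
    _ ≤ _ := by gcongr

end ShiftTree

theorem mainTheorem3 :
    ∃ (P : WordRAM.Prog) (c : ℕ) (C : ℝ), 0 < c ∧
      ∀ (m : ℕ), 2 ≤ m → ∀ (S : Finset (ZMod m)), S.Nonempty →
      ∀ (l : List (ZMod m)), l.Nodup → l.toFinset = S →
      ∀ (w : ℕ), m ^ c ≤ 2 ^ w →
        ∃ (t : ℕ) (s : WordRAM.State),
          WordRAM.Exec w P (inputState m l) t s ∧
          HoldsSet s (subsetSums S) ∧
          (t : ℝ) ≤ C * (min (√(S.card : ℝ) * (m : ℝ)) ((m : ℝ) ^ (5 / 4 : ℝ)) *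
            Real.log (m : ℝ) ^ 2) := by
  refine ⟨ShiftTree.subsetSumProg, 99, 28000 / Real.log 2 ^ 2, by norm_num, ?_⟩
  rintro m hm S hS l hl rfl w hw
  obtain ⟨t, s, σ, hexec, hsim, hset, L, hL, ht⟩ :=
    ShiftTree.subsetSumProg_run hm hl hw (inputState m l) (WordRAM.Sim.refl _)
  refine ⟨t, s, hexec, ?_, ShiftTree.time_le hm (Finset.card_pos.2 hS) hL ht⟩
  intro x hx
  rw [hsim.1]
  exact hset x hx
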